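/- **Theorem 4.3.** Let $N\ge 1$, let $\Omega\subseteq\mathbb R^N$ be a domain, $p\in(1,\infty)$, let $A\in L^\infty_{\rm loc}(\Omega;\mathbb R^{N\times N})$ be a symmetric and locally uniformly positive definite matrix field, $|\xi|_A^2=\langle A(x)\xi,\xi\rangle$, and let $V$ belong to the local Morrey space $\mathcal M^q_{\rm loc}(p;\Omega)$, that is, $V\in L^1_{\rm loc}(\Omega)$ and, in addition: if $p<N$, then for some $q>N/p$ and every open set $\omega\Subset\Omega$, with $d=\operatorname{diam}\omega$ and $q'=q/(q-1)$, $$\sup_{y\in\omega,\ 0<r<d} r^{-N/q'}\int_{\omega\cap B_r(y)}|V|\,dx<\infty ;$$ if $p=N$, the same holds for some $q>N$ with the weight $r^{-N/q'}$ replaced by $[\log(d/r)]^{q(N-1)/N}$. Put $V^+=\max(0,V)$ and $$Q(\phi)=\int_\Omega\big(|\nabla\phi|_A^p+V^+|\phi|^p\big)\,dx,\qquad \phi\in W^{1,p}(\Omega)\cap C_c(\Omega).$$ Let $\mathcal H_p(\Omega,V^+)$ be the space of all $g\in L^1_{\rm loc}(\Omega)$ for which there is $C>0$ with $\int_\Omega|g||\phi|^p\,dx\le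 C\,Q(\phi)$ for all $\phi\in W^{1,p}(\Omega)\cap C_c(\Omega)$, and assume that $Q$ is subcritical, i.e. $\mathcal H_p(\Omega,V^+)\ne\{0\}$. Let $\mathbf u\in W^{1,p}_{\rm loc}(\Omega)\cap C(\Omega)$ be a positive weak solution of $$-\operatorname{div}\big(|\nabla \mathbf u|_A^{p-2}A\nabla \mathbf u\big)+V^+|\mathbf u|^{p-2}\mathbf u=0\quad\text{in }\Omega .$$ For compact $F\subset\Omega$ let $\mathrm{Cap}_{\mathbf u}(F,\Omega)=\inf\{Q(\phi): \phi\in W^{1,p}(\Omega)\cap C_c(\Omega),\ \phi\ge\mathbf u\text{ on }F\}$, and equip $\mathcal H_p(\Omega,V^+)$ with the norm $$\|g\|_{\mathcal H_p(\Omega,V^+)}=\sup\Big\{\frac{\int_F|g|\,\mathbf u^p\,dx}{\mathrm{Cap}_{\mathbf u}(F,\Omega)}: F\subset\Omega\text{ compact},\ \mathrm{Cap}_{\mathbf u}(F,\Omega)\neq0\Big\}.$$ Let $\mathcal H_{p,0}(\Omega,V^+)$ be the closure, in $\mathcal H_p(\Omega,V^+)$ with this norm, of the set of those Hardy-weights $h\in\mathcal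 H_p(\Omega,V^+)$ that are essentially bounded and vanish a.e. outside a compact subset of $\Omega$. Let $\mathcal D=\mathcal D^{1,p}_{A,V^+}(\Omega)$ be the completion of $W^{1,p}(\Omega)\cap C_c(\Omega)$ with respect to the norm $\|\phi\|_{\mathcal D}=Q(\phi)^{1/p}$. Let $g\in\mathcal H_{p,0}(\Omega,V^+)$. Then: 1. Every $x\in\mathcal D$ is represented by a measurable function on $\Omega$, unique up to null sets: there is a function $f$ that is the limit in $L^p_{\rm loc}(\Omega)$ of some sequence in $W^{1,p}(\Omega)\cap C_c(\Omega)$ converging to $x$ in $\mathcal D$, and any two such functions agree a.e. in $\Omega$. We identify $x$ with $f$. 2. $T_g(\phi)=\int_\Omega|g||\phi|^p\,dx$ is finite for every $\phi\in\mathcal D$. 3. $T_g$ is compact on $\mathcal D$: if $\phi_n\rightharpoonup\phi$ weakly in $\mathcal D$, then $T_g(\phi_n)\to T_g(\phi)$. -/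

import Mathlib

open MeasureTheory Filter Topology Set
open scoped ContDiff ENNReal

noncomputable section

namespace HardyWeights

/-- Euclidean space of dimension `N`. -/
abbrev E (N : ℕ) : Type := EuclideanSpace ℝ (Fin N)

variable {N : ℕ}

/-! ### Weak gradients and Sobolev spaces -/

/-- `G` is a weak gradient of `f` in the open set `Ω`, tested against `C_c^∞(Ω)`. -/
structure HasWeakGrad (Ω : Set (E N)) (f : E N → ℝ) (G : E N → E N) : Prop where
  locInt : LocallyIntegrableOn f Ω volume
  locIntGrad : LocallyIntegrableOn G Ω volume
  integral_eq : ∀ η : E N → ℝ, ContDiff ℝ ∞ η → HasCompactSupport η → tsupport η ⊆ Ω →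
    ∀ v : E N, ∫ x in Ω, f x * fderiv ℝ η x v = - ∫ x in Ω, inner ℝ (G x) v * η x

open Classical in
/-- The weak gradient of `f` in `Ω` (a representative of the a.e. class), `0` if there is none. -/
def weakGrad (Ω : Set (E N)) (f : E N → ℝ) : E N → E N :=
  if h : ∃ G, HasWeakGrad Ω f G then h.choose else 0

/-- `f ∈ W^{1,p}(Ω)`. -/
def MemW1p (Ω : Set (E N)) (p : ℝ) (f : E N → ℝ) : Prop :=
  MemLp f (ENNReal.ofReal p) (volume.restrict Ω) ∧
    ∃ G, HasWeakGrad Ω f G ∧ MemLp G (ENNReal.ofReal p) (volume.restrict Ω)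

/-- `f ∈ W^{1,p}_loc(Ω)`. -/
def MemW1pLoc (Ω : Set (E N)) (p : ℝ) (f : E N → ℝ) : Prop :=
  ∃ G, HasWeakGrad Ω f G ∧ ∀ K : Set (E N), IsCompact K → K ⊆ Ω →
    MemLp f (ENNReal.ofReal p) (volume.restrict K) ∧
      MemLp G (ENNReal.ofReal p) (volume.restrict K)

/-- `f ∈ W^{1,p}(Ω) ∩ C_c(Ω)`; a function in `C_c(Ω)` is extended by zero to the whole space. -/
structure IsTestFunction (Ω : Set (E N)) (p : ℝ) (f : E N → ℝ) : Prop where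
  continuous : Continuous f
  hasCompactSupport : HasCompactSupport f
  tsupport_subset : tsupport f ⊆ Ω
  memW1p : MemW1p Ω p f

/-! ### Coefficients and energy -/

/-- `|ξ|_M = (∑ M_ij ξ_i ξ_j)^{1/2}` for a matrix `M`. -/
def matNorm (M : Matrix (Fin N) (Fin N) ℝ) (ξ : E N) : ℝ :=
  Real.sqrt (∑ i, ∑ j, M i j * ξ i * ξ j)

/-- The bilinear form `⟨Mξ, ζ⟩ = ∑ M_ij ξ_i ζ_j` (for symmetric `M`). -/
def matInner (M : Matrix (Fin N) (Fin N) ℝ) (ξ ζ : E N) : ℝ :=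
  ∑ i, ∑ j, M i j * ξ i * ζ j

/-- The local Morrey space `M^q_loc(p; Ω)` (for some admissible exponent `q`):
`q > N/p` if `p < N`, a logarithmic weight with `q > N` if `p = N`, and `L¹_loc(Ω)` if `p > N`.
For `p < N` finite `q` suffice, as the spaces `M^q_loc(Ω)` decrease in `q`. All these spaces
consist of locally integrable functions. -/
def MemMorreyLoc (Ω : Set (E N)) (p : ℝ) (f : E N → ℝ) : Prop :=
  LocallyIntegrableOn f Ω volume ∧
  (p < N → ∃ q : ℝ, (N : ℝ) / p < q ∧
    ∀ U : Set (E N), IsOpen U → IsCompact (closure U) → closure U ⊆ Ω →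
      ∃ C : ℝ, ∀ y ∈ U, ∀ r : ℝ, 0 < r → r < Metric.diam U →
        r ^ (-((N : ℝ) * (1 - 1 / q))) * ∫ x in U ∩ Metric.ball y r, |f x| ≤ C) ∧
  (p = N → ∃ q : ℝ, (N : ℝ) < q ∧
    ∀ U : Set (E N), IsOpen U → IsCompact (closure U) → closure U ⊆ Ω →
      ∃ C : ℝ, ∀ y ∈ U, ∀ r : ℝ, 0 < r → r < Metric.diam U →
        Real.log (Metric.diam U / r) ^ (q * (1 - 1 / (N : ℝ))) *
          ∫ x in U ∩ Metric.ball y r, |f x| ≤ C)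

/-- The standing assumptions: `Ω` is a domain, `1 < p < ∞`, `A` is a symmetric, locally bounded and
locally uniformly positive definite measurable matrix field, and `V` is a potential in
`M^q_loc(p; Ω)`. -/
structure IsAdmissible (Ω : Set (E N)) (p : ℝ) (A : E N → Matrix (Fin N) (Fin N) ℝ)
    (V : E N → ℝ) : Prop where
  isOpen : IsOpen Ω
  isConnected : IsConnected Ω
  one_lt : 1 < p
  measurable : ∀ i j, AEStronglyMeasurable (fun x => A x i j) (volume.restrict Ω)
  symm : ∀ᵐ x ∂(volume.restrict Ω), (A x).IsSymm
  locBdd : ∀ K : Set (E N), IsCompact K → K ⊆ Ω →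
    ∃ C : ℝ, ∀ᵐ x ∂(volume.restrict K), ∀ i j, |A x i j| ≤ C
  locElliptic : ∀ K : Set (E N), IsCompact K → K ⊆ Ω →
    ∃ c : ℝ, 0 < c ∧ ∀ᵐ x ∂(volume.restrict K), ∀ ξ : E N,
      c * ‖ξ‖ ^ 2 ≤ ∑ i, ∑ j, A x i j * ξ i * ξ j
  morrey : MemMorreyLoc Ω p V

/-- The positive part `V⁺ = max(0, V)` of a potential. -/
def posPot (V : E N → ℝ) : E N → ℝ := fun x => max 0 (V x)

/-- The energy functional `Q_{p,A,W}(φ) = ∫_Ω |∇φ|_A^p + W |φ|^p`. -/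
def energy (Ω : Set (E N)) (p : ℝ) (A : E N → Matrix (Fin N) (Fin N) ℝ) (W : E N → ℝ)
    (φ : E N → ℝ) : ℝ :=
  ∫ x in Ω, (matNorm (A x) (weakGrad Ω φ x) ^ p + W x * |φ x| ^ p)

/-! ### Hardy-weights -/

/-- `g ∈ H_p(Ω, W)`: `g ∈ L¹_loc(Ω)` is a Hardy-weight of `Q_{p,A,W}`. -/
def IsHardyWeight (Ω : Set (E N)) (p : ℝ) (A : E N → Matrix (Fin N) (Fin N) ℝ) (W : E N → ℝ)
    (g : E N → ℝ) : Prop :=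
  LocallyIntegrableOn g Ω volume ∧ ∃ C : ℝ, 0 < C ∧ ∀ φ, IsTestFunction Ω p φ →
    ∫ x in Ω, |g x| * |φ x| ^ p ≤ C * energy Ω p A W φ

/-- `Q_{p,A,W}` is subcritical in `Ω`: the space `H_p(Ω, W)` is not `{0}`. -/
def IsSubcritical (Ω : Set (E N)) (p : ℝ) (A : E N → Matrix (Fin N) (Fin N) ℝ)
    (W : E N → ℝ) : Prop :=
  ∃ g, IsHardyWeight Ω p A W g ∧ ¬ g =ᵐ[volume.restrict Ω] 0

/-- `u ∈ W^{1,p}_loc(Ω) ∩ C(Ω)` is a positive weak solution in `Ω` of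
`-div(|∇u|_A^{p-2} A ∇u) + W |u|^{p-2} u = 0`. (Where `∇u` vanishes, so does
`|∇u|_A^{p-2} A ∇u`, also for `p < 2`.) -/
structure IsPositiveSolution (Ω : Set (E N)) (p : ℝ) (A : E N → Matrix (Fin N) (Fin N) ℝ)
    (W : E N → ℝ) (u : E N → ℝ) : Prop where
  memW1pLoc : MemW1pLoc Ω p u
  continuousOn : ContinuousOn u Ω
  pos : ∀ x ∈ Ω, 0 < u x
  weak_eq : ∀ φ, IsTestFunction Ω p φ →
    ∫ x in Ω, (matNorm (A x) (weakGrad Ω u x) ^ (p - 2) *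
        matInner (A x) (weakGrad Ω u x) (weakGrad Ω φ x)
      + W x * |u x| ^ (p - 2) * u x * φ x) = 0

/-- The `Q_{p,A,W}`-capacity of `F` with respect to `(u, Ω)`. -/
def capacity (Ω : Set (E N)) (p : ℝ) (A : E N → Matrix (Fin N) (Fin N) ℝ) (W : E N → ℝ)
    (u : E N → ℝ) (F : Set (E N)) : ℝ :=
  sInf (energy Ω p A W '' {φ | IsTestFunction Ω p φ ∧ ∀ x ∈ F, u x ≤ φ x})

/-- The norm of `H_p(Ω, W)` determined by the positive solution `u`: the supremum of
`(∫_F |g| |u|^p) / Cap_u(F, Ω)` over the compact sets `F ⊆ Ω` of nonzero capacity. -/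
def hardyNorm (Ω : Set (E N)) (p : ℝ) (A : E N → Matrix (Fin N) (Fin N) ℝ) (W : E N → ℝ)
    (u : E N → ℝ) (g : E N → ℝ) : ℝ≥0∞ :=
  ⨆ (F : Set (E N)) (_ : IsCompact F) (_ : F ⊆ Ω) (_ : capacity Ω p A W u F ≠ 0),
    (∫⁻ x in F, ENNReal.ofReal (|g x| * |u x| ^ p)) / ENNReal.ofReal (capacity Ω p A W u F)

/-- `h ∈ L^∞_c(Ω)`: `h` is essentially bounded and vanishes a.e. off a compact subset of `Ω`. -/
def MemLinftyC (Ω : Set (E N)) (h : E N → ℝ) : Prop :=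
  MemLp h ∞ (volume.restrict Ω) ∧
    ∃ K : Set (E N), IsCompact K ∧ K ⊆ Ω ∧ ∀ᵐ x ∂(volume.restrict Ω), x ∉ K → h x = 0

/-- `g ∈ H_{p,0}(Ω, W)`: `g` lies in the closure of `H_p(Ω, W) ∩ L^∞_c(Ω)` in `H_p(Ω, W)`. -/
def MemHardyZero (Ω : Set (E N)) (p : ℝ) (A : E N → Matrix (Fin N) (Fin N) ℝ) (W : E N → ℝ)
    (u : E N → ℝ) (g : E N → ℝ) : Prop :=
  IsHardyWeight Ω p A W g ∧ ∀ ε : ℝ≥0∞, 0 < ε →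
    ∃ h, IsHardyWeight Ω p A W h ∧ MemLinftyC Ω h ∧ hardyNorm Ω p A W u (g - h) < ε

/-! ### Helper facts -/

theorem integrable_smul_of_tsupport {F : Type*} [NormedAddCommGroup F] [NormedSpace ℝ F]
    {Ω : Set (E N)} {H : E N → F} (hH : LocallyIntegrableOn H Ω volume) {η : E N → ℝ}
    (hη : Continuous η) (hc : HasCompactSupport η) (hs : tsupport η ⊆ Ω) :
    Integrable (fun x => η x • H x) volume := by
  have h1 : IntegrableOn H (tsupport η) volume := hH.integrableOn_compact_subset hs hc
  have h2 : IntegrableOn (fun x => η x • H x) (tsupport η) volume :=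
    h1.continuousOn_smul hη.continuousOn hc
  refine (integrableOn_iff_integrable_of_support_subset ?_).1 h2
  intro x hx
  refine subset_tsupport η ?_
  intro h0
  simp [h0] at hx

theorem integrable_mul_fderiv {Ω : Set (E N)} {f : E N → ℝ}
    (hf : LocallyIntegrableOn f Ω volume) {η : E N → ℝ} (hη : ContDiff ℝ ∞ η)
    (hc : HasCompactSupport η) (hs : tsupport η ⊆ Ω) (v : E N) :
    IntegrableOn (fun x => f x * fderiv ℝ η x v) Ω volume := by
  have hcont : Continuous (fun x => fderiv ℝ η x v) :=
    (hη.continuous_fderiv (by simp)).clm_apply continuous_const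
  have hsub : tsupport (fun x => fderiv ℝ η x v) ⊆ tsupport η :=
    (tsupport_fderiv_apply_subset ℝ v)
  have := (integrable_smul_of_tsupport hf hcont (hc.of_isClosed_subset
    (isClosed_tsupport _) hsub) (hsub.trans hs)).integrableOn (s := Ω)
  refine this.congr (Eventually.of_forall fun x => ?_)
  simp [mul_comm]

theorem integrable_inner_mul {Ω : Set (E N)} {G : E N → E N}
    (hG : LocallyIntegrableOn G Ω volume) {η : E N → ℝ} (hη : Continuous η)
    (hc : HasCompactSupport η) (hs : tsupport η ⊆ Ω) (v : E N) :
    IntegrableOn (fun x => inner ℝ (G x) v * η x) Ω volume := by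
  have := ((integrable_smul_of_tsupport hG hη hc hs).inner_const (𝕜 := ℝ) v).integrableOn (s := Ω)
  refine this.congr (Eventually.of_forall fun x => ?_)
  simp only [inner_smul_left]
  simp [mul_comm]

theorem HasWeakGrad.ae_eq_zero_of_eqOn {Ω U : Set (E N)} (hU : IsOpen U) (hUΩ : U ⊆ Ω)
    {f : E N → ℝ} {G : E N → E N} (h : HasWeakGrad Ω f G) (hf : ∀ x ∈ U, f x = 0) :
    ∀ᵐ x ∂(volume : Measure (E N)), x ∈ U → G x = 0 := by
  refine hU.ae_eq_zero_of_integral_contDiff_smul_eq_zero (h.locIntGrad.mono_set hUΩ) ?_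
  intro η hη hc hs
  have hi := integrable_smul_of_tsupport h.locIntGrad hη.continuous hc (hs.trans hUΩ)
  have e : ∀ v : E N, inner ℝ (∫ x in Ω, η x • G x) v = 0 := by
    intro v
    rw [real_inner_comm, ← integral_inner hi.integrableOn]
    have e1 := h.integral_eq η hη hc (hs.trans hUΩ) v
    have e0 : ∀ x, f x * fderiv ℝ η x v = 0 := by
      intro x
      by_cases hx : x ∈ tsupport η
      · rw [hf x (hs hx), zero_mul]
      · have : fderiv ℝ η x = 0 := by
          by_contra hne
          exact hx (support_fderiv_subset ℝ hne)
        simp [this]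
    simp only [e0, integral_zero] at e1
    have e3 : ∀ x, inner ℝ v (η x • G x) = inner ℝ (G x) v * η x := by
      intro x
      rw [inner_smul_right, real_inner_comm v (G x)]
      ring
    simp only [e3]
    linarith
  have Z := e (∫ x in Ω, η x • G x)
  rw [inner_self_eq_zero] at Z
  rw [← Z]
  symm
  refine setIntegral_eq_integral_of_forall_compl_eq_zero ?_
  intro x hx
  have : η x = 0 := image_eq_zero_of_notMem_tsupport fun hx' => hx (hUΩ (hs hx'))
  simp [this]

theorem HasWeakGrad.add {Ω : Set (E N)} {f f' : E N → ℝ} {G G' : E N → E N}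
    (h : HasWeakGrad Ω f G) (h' : HasWeakGrad Ω f' G') : HasWeakGrad Ω (f + f') (G + G') where
  locInt := h.locInt.add h'.locInt
  locIntGrad := h.locIntGrad.add h'.locIntGrad
  integral_eq η hη hc hs v := by
    simp only [Pi.add_apply, add_mul, inner_add_left]
    rw [integral_add (integrable_mul_fderiv h.locInt hη hc hs v)
        (integrable_mul_fderiv h'.locInt hη hc hs v),
      integral_add (integrable_inner_mul h.locIntGrad hη.continuous hc hs v)
        (integrable_inner_mul h'.locIntGrad hη.continuous hc hs v),
      h.integral_eq η hη hc hs v, h'.integral_eq η hη hc hs v]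
    ring

theorem HasWeakGrad.smul {Ω : Set (E N)} {f : E N → ℝ} {G : E N → E N} (c : ℝ)
    (h : HasWeakGrad Ω f G) : HasWeakGrad Ω (c • f) (c • G) where
  locInt := h.locInt.smul c
  locIntGrad := h.locIntGrad.smul c
  integral_eq η hη hc hs v := by
    simp only [Pi.smul_apply, smul_eq_mul, mul_assoc, inner_smul_left]
    simp only [RCLike.conj_to_real, integral_const_mul]
    rw [h.integral_eq η hη hc hs v]
    ring

theorem hasWeakGrad_zero (Ω : Set (E N)) : HasWeakGrad Ω 0 0 where
  locInt := (locallyIntegrable_zero (μ := volume)).locallyIntegrableOn Ω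
  locIntGrad := (locallyIntegrable_zero (μ := volume)).locallyIntegrableOn Ω
  integral_eq η hη hc hs v := by simp

theorem HasWeakGrad.ae_eq {Ω : Set (E N)} (hΩ : IsOpen Ω) {f : E N → ℝ} {G G' : E N → E N}
    (h : HasWeakGrad Ω f G) (h' : HasWeakGrad Ω f G') : G =ᵐ[volume.restrict Ω] G' := by
  have key := (h.add (h'.smul (-1))).ae_eq_zero_of_eqOn hΩ subset_rfl (by intro x _; simp)
  rw [EventuallyEq, ae_restrict_iff' hΩ.measurableSet]
  filter_upwards [key] with x hx hxΩ
  have := hx hxΩ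
  simp only [Pi.add_apply, neg_smul, one_smul] at this
  exact sub_eq_zero.1 (by rw [sub_eq_add_neg]; exact this)

theorem hasWeakGrad_weakGrad {Ω : Set (E N)} {f : E N → ℝ} (h : ∃ G, HasWeakGrad Ω f G) :
    HasWeakGrad Ω f (weakGrad Ω f) := by
  unfold weakGrad
  rw [dif_pos h]
  exact h.choose_spec

theorem HasWeakGrad.weakGrad_ae_eq {Ω : Set (E N)} (hΩ : IsOpen Ω) {f : E N → ℝ} {G : E N → E N}
    (h : HasWeakGrad Ω f G) : weakGrad Ω f =ᵐ[volume.restrict Ω] G :=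
  (hasWeakGrad_weakGrad ⟨G, h⟩).ae_eq hΩ h

theorem IsTestFunction.hasWeakGrad {Ω : Set (E N)} {p : ℝ} {f : E N → ℝ}
    (h : IsTestFunction Ω p f) : HasWeakGrad Ω f (weakGrad Ω f) :=
  hasWeakGrad_weakGrad ⟨_, h.memW1p.2.choose_spec.1⟩

theorem IsTestFunction.memLp_weakGrad {Ω : Set (E N)} (hΩ : IsOpen Ω) {p : ℝ} {f : E N → ℝ}
    (h : IsTestFunction Ω p f) :
    MemLp (weakGrad Ω f) (ENNReal.ofReal p) (volume.restrict Ω) := by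
  obtain ⟨G, hG, hL⟩ := h.memW1p.2
  exact hL.ae_eq (hG.weakGrad_ae_eq hΩ).symm

theorem IsTestFunction.add {Ω : Set (E N)} {p : ℝ} {f f' : E N → ℝ}
    (h : IsTestFunction Ω p f) (h' : IsTestFunction Ω p f') : IsTestFunction Ω p (f + f') where
  continuous := h.continuous.add h'.continuous
  hasCompactSupport := h.hasCompactSupport.add h'.hasCompactSupport
  tsupport_subset := (tsupport_add f f').trans (union_subset h.tsupport_subset h'.tsupport_subset)
  memW1p := by
    obtain ⟨hf, G, hG, hL⟩ := h.memW1p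
    obtain ⟨hf', G', hG', hL'⟩ := h'.memW1p
    exact ⟨hf.add hf', _, hG.add hG', hL.add hL'⟩

theorem IsTestFunction.smul {Ω : Set (E N)} {p : ℝ} {f : E N → ℝ} (c : ℝ)
    (h : IsTestFunction Ω p f) : IsTestFunction Ω p (c • f) where
  continuous := h.continuous.const_smul c
  hasCompactSupport := h.hasCompactSupport.smul_left (f := fun _ => c)
  tsupport_subset := (tsupport_smul_subset_right (fun _ => c) f).trans h.tsupport_subset
  memW1p := by
    obtain ⟨hf, G, hG, hL⟩ := h.memW1p
    exact ⟨hf.const_smul c, _, hG.smul c, hL.const_smul c⟩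

theorem isTestFunction_zero (Ω : Set (E N)) (p : ℝ) : IsTestFunction Ω p (0 : E N → ℝ) where
  continuous := continuous_zero
  hasCompactSupport := HasCompactSupport.zero
  tsupport_subset := by simp [tsupport]
  memW1p := ⟨MemLp.zero, 0, hasWeakGrad_zero Ω, MemLp.zero⟩

/-! ### The Beppo-Levi space -/

/-- The real vector space `W^{1,p}(Ω) ∩ C_c(Ω)`. -/
def testSpace (Ω : Set (E N)) (p : ℝ) : Submodule ℝ (E N → ℝ) where
  carrier := {f | IsTestFunction Ω p f}
  add_mem' h h' := h.add h'
  zero_mem' := isTestFunction_zero Ω p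
  smul_mem' c _ h := h.smul c

/-- The pointwise density `(|∇f|_A^p + V⁺ |f|^p)^{1/p}`, whose `L^p(Ω)` norm is the Beppo-Levi
norm. -/
def density (Ω : Set (E N)) (p : ℝ) (A : E N → Matrix (Fin N) (Fin N) ℝ) (V : E N → ℝ)
    (f : E N → ℝ) (x : E N) : ℝ :=
  (matNorm (A x) (weakGrad Ω f x) ^ p + posPot V x * |f x| ^ p) ^ (1 / p)

/-- The Beppo-Levi norm `(‖|∇f|_A‖_{L^p(Ω)}^p + ‖f‖_{L^p(Ω, V⁺dx)}^p)^{1/p}`. -/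
def beppoLeviNorm (Ω : Set (E N)) (p : ℝ) (A : E N → Matrix (Fin N) (Fin N) ℝ) (V : E N → ℝ)
    (f : E N → ℝ) : ℝ :=
  energy Ω p A (posPot V) f ^ (1 / p)

theorem matNorm_nonneg (M : Matrix (Fin N) (Fin N) ℝ) (ξ : E N) : 0 ≤ matNorm M ξ :=
  Real.sqrt_nonneg _

theorem posPot_nonneg (V : E N → ℝ) (x : E N) : 0 ≤ posPot V x := le_max_left _ _

theorem matNorm_smul (M : Matrix (Fin N) (Fin N) ℝ) (c : ℝ) (ξ : E N) :
    matNorm M (c • ξ) = |c| * matNorm M ξ := by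
  unfold matNorm
  rw [← Real.sqrt_sq_eq_abs, ← Real.sqrt_mul (sq_nonneg c), Finset.mul_sum]
  congr 1
  refine Finset.sum_congr rfl fun i _ => ?_
  rw [Finset.mul_sum]
  refine Finset.sum_congr rfl fun j _ => ?_
  simp only [PiLp.smul_apply, smul_eq_mul]
  ring

theorem matInner_comm {M : Matrix (Fin N) (Fin N) ℝ} (hM : M.IsSymm) (ξ ζ : E N) :
    matInner M ξ ζ = matInner M ζ ξ := by
  unfold matInner
  rw [Finset.sum_comm]
  refine Finset.sum_congr rfl fun i _ => Finset.sum_congr rfl fun j _ => ?_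
  rw [hM.apply]
  ring

theorem matInner_add_smul (M : Matrix (Fin N) (Fin N) ℝ) (hM : M.IsSymm) (t : ℝ) (ξ ζ : E N) :
    matInner M (ξ + t • ζ) (ξ + t • ζ)
      = matInner M ζ ζ * (t * t) + (2 * matInner M ξ ζ) * t + matInner M ξ ξ := by
  have h : matInner M (ξ + t • ζ) (ξ + t • ζ)
      = matInner M ξ ξ + t * matInner M ξ ζ + t * matInner M ζ ξ + t * t * matInner M ζ ζ := by
    simp only [matInner, Finset.mul_sum, ← Finset.sum_add_distrib]
    refine Finset.sum_congr rfl fun i _ => Finset.sum_congr rfl fun j _ => ?_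
    simp only [PiLp.add_apply, PiLp.smul_apply, smul_eq_mul]
    ring
  rw [h, matInner_comm hM ζ ξ]
  ring

theorem matNorm_add_le {M : Matrix (Fin N) (Fin N) ℝ} (hM : M.IsSymm)
    (hpos : ∀ ξ : E N, 0 ≤ matInner M ξ ξ) (ξ ζ : E N) :
    matNorm M (ξ + ζ) ≤ matNorm M ξ + matNorm M ζ := by
  have hd := discrim_le_zero (a := matInner M ζ ζ) (b := 2 * matInner M ξ ζ)
    (c := matInner M ξ ξ) (fun t => by rw [← matInner_add_smul M hM]; exact hpos _)
  have e1 : matNorm M ξ = Real.sqrt (matInner M ξ ξ) := rfl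
  have e2 : matNorm M ζ = Real.sqrt (matInner M ζ ζ) := rfl
  have e3 : matNorm M (ξ + ζ) = Real.sqrt (matInner M (ξ + ζ) (ξ + ζ)) := rfl
  have hadd := matInner_add_smul M hM 1 ξ ζ
  rw [one_smul] at hadd
  have hcs : matInner M ξ ζ ≤ matNorm M ξ * matNorm M ζ := by
    rw [e1, e2, ← Real.sqrt_mul (hpos ξ)]
    refine Real.le_sqrt_of_sq_le ?_
    unfold discrim at hd
    nlinarith
  rw [e3]
  refine Real.sqrt_le_iff.2 ⟨add_nonneg (matNorm_nonneg _ _) (matNorm_nonneg _ _), ?_⟩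
  have s1 : matNorm M ξ ^ 2 = matInner M ξ ξ := Real.sq_sqrt (hpos ξ)
  have s2 : matNorm M ζ ^ 2 = matInner M ζ ζ := Real.sq_sqrt (hpos ζ)
  nlinarith

section Admissible

variable {Ω : Set (E N)} {p : ℝ} {A : E N → Matrix (Fin N) (Fin N) ℝ} {V : E N → ℝ}

theorem IsAdmissible.pos (h : IsAdmissible Ω p A V) : 0 < p := zero_lt_one.trans h.one_lt

theorem IsAdmissible.ae_nonneg (h : IsAdmissible Ω p A V) :
    ∀ᵐ x ∂(volume.restrict Ω), ∀ ξ : E N, 0 ≤ matInner (A x) ξ ξ := by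
  rw [ae_restrict_iff' h.isOpen.measurableSet]
  obtain ⟨K, hK, hKU⟩ : ∃ K : ℕ → Set (E N), (∀ n, IsCompact (K n)) ∧ (⋃ n, K n) = Ω := by
    have hl : LocallyCompactSpace Ω := h.isOpen.locallyCompactSpace
    exact isSigmaCompact_iff_sigmaCompactSpace.2 inferInstance
  have hall : ∀ n, ∀ᵐ x ∂(volume : Measure (E N)), x ∈ K n →
      ∀ ξ : E N, 0 ≤ matInner (A x) ξ ξ := by
    intro n
    obtain ⟨c, hc, hx⟩ := h.locElliptic (K n) (hK n) (hKU ▸ subset_iUnion K n)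
    rw [ae_restrict_iff' (hK n).measurableSet] at hx
    filter_upwards [hx] with x hx hxK ξ
    exact le_trans (by positivity) (hx hxK ξ)
  filter_upwards [ae_all_iff.2 hall] with x hx hxΩ
  rw [← hKU] at hxΩ
  obtain ⟨n, hn⟩ := mem_iUnion.1 hxΩ
  exact hx n hn

theorem density_nonneg (f : E N → ℝ) (x : E N) : 0 ≤ density Ω p A V f x :=
  Real.rpow_nonneg (add_nonneg (Real.rpow_nonneg (matNorm_nonneg _ _) _)
    (mul_nonneg (posPot_nonneg _ _) (Real.rpow_nonneg (abs_nonneg _) _))) _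

theorem density_rpow (hp : 0 < p) (f : E N → ℝ) (x : E N) :
    density Ω p A V f x ^ p
      = matNorm (A x) (weakGrad Ω f x) ^ p + posPot V x * |f x| ^ p := by
  unfold density
  rw [← Real.rpow_mul (add_nonneg (Real.rpow_nonneg (matNorm_nonneg _ _) _)
    (mul_nonneg (posPot_nonneg _ _) (Real.rpow_nonneg (abs_nonneg _) _)))]
  rw [one_div_mul_cancel hp.ne', Real.rpow_one]

theorem aestronglyMeasurable_density (h : IsAdmissible Ω p A V) {f : E N → ℝ}
    (hf : IsTestFunction Ω p f) :
    AEStronglyMeasurable (density Ω p A V f) (volume.restrict Ω) := by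
  have hG := (hf.memLp_weakGrad h.isOpen).aestronglyMeasurable.aemeasurable
  have hGi : ∀ i, AEMeasurable (fun x => weakGrad Ω f x i) (volume.restrict Ω) := by
    intro i
    exact (EuclideanSpace.proj (𝕜 := ℝ) i).continuous.measurable.comp_aemeasurable hG
  have hV : AEMeasurable V (volume.restrict Ω) :=
    (h.morrey.1.aestronglyMeasurable).aemeasurable
  have hm : AEMeasurable (fun x => matNorm (A x) (weakGrad Ω f x)) (volume.restrict Ω) := by
    unfold matNorm
    refine Real.continuous_sqrt.measurable.comp_aemeasurable ?_
    refine Finset.aemeasurable_fun_sum _ fun i _ => Finset.aemeasurable_fun_sum _ fun j _ => ?_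
    exact (((h.measurable i j).aemeasurable).mul (hGi i)).mul (hGi j)
  have hfm : AEMeasurable f (volume.restrict Ω) := hf.continuous.measurable.aemeasurable
  refine AEMeasurable.aestronglyMeasurable ?_
  unfold density
  refine AEMeasurable.pow_const ?_ _
  refine (hm.pow_const _).add (AEMeasurable.mul ?_ ?_)
  · exact aemeasurable_const.max hV
  · exact (hfm.abs).pow_const _

theorem matNorm_le {M : Matrix (Fin N) (Fin N) ℝ} {C : ℝ} (hC : ∀ i j, |M i j| ≤ C) (ξ : E N) :
    matNorm M ξ ≤ Real.sqrt ((N : ℝ) * N * |C|) * ‖ξ‖ := by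
  unfold matNorm
  refine Real.sqrt_le_iff.2 ⟨by positivity, ?_⟩
  rw [mul_pow, Real.sq_sqrt (by positivity)]
  have : ∀ i j, M i j * ξ i * ξ j ≤ |C| * ‖ξ‖ ^ 2 := by
    intro i j
    have h1 : |ξ i| ≤ ‖ξ‖ := by simpa using PiLp.norm_apply_le ξ i
    have h2 : |ξ j| ≤ ‖ξ‖ := by simpa using PiLp.norm_apply_le ξ j
    calc M i j * ξ i * ξ j ≤ |M i j * ξ i * ξ j| := le_abs_self _
      _ = |M i j| * (|ξ i| * |ξ j|) := by rw [abs_mul, abs_mul, mul_assoc]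
      _ ≤ |C| * (‖ξ‖ * ‖ξ‖) := by
          exact mul_le_mul ((hC i j).trans (le_abs_self C))
            (mul_le_mul h1 h2 (abs_nonneg _) (norm_nonneg _)) (by positivity) (abs_nonneg _)
      _ = |C| * ‖ξ‖ ^ 2 := by ring
  calc ∑ i, ∑ j, M i j * ξ i * ξ j ≤ ∑ _i : Fin N, ∑ _j : Fin N, |C| * ‖ξ‖ ^ 2 :=
        Finset.sum_le_sum fun i _ => Finset.sum_le_sum fun j _ => this i j
    _ = (N : ℝ) * N * |C| * ‖ξ‖ ^ 2 := by simp; ring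

theorem integrable_energy (h : IsAdmissible Ω p A V) {f : E N → ℝ} (hf : IsTestFunction Ω p f) :
    Integrable (fun x => matNorm (A x) (weakGrad Ω f x) ^ p + posPot V x * |f x| ^ p)
      (volume.restrict Ω) := by
  have hp := h.pos
  have hmeas : AEStronglyMeasurable
      (fun x => matNorm (A x) (weakGrad Ω f x) ^ p + posPot V x * |f x| ^ p)
      (volume.restrict Ω) := by
    have := ((aestronglyMeasurable_density h hf).aemeasurable.pow_const p).aestronglyMeasurable
    refine this.congr (Eventually.of_forall fun x => ?_)
    exact density_rpow hp f x
  obtain ⟨C, hC⟩ := h.locBdd (tsupport f) hf.hasCompactSupport hf.tsupport_subset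
  rw [ae_restrict_iff' (isClosed_tsupport f).measurableSet] at hC
  have hz := hf.hasWeakGrad.ae_eq_zero_of_eqOn
    (U := Ω \ tsupport f) (h.isOpen.sdiff (isClosed_tsupport f)) sdiff_subset
    (fun x hx => image_eq_zero_of_notMem_tsupport hx.2)
  have i1 : Integrable (fun x => Real.sqrt ((N : ℝ) * N * |C|) ^ p * ‖weakGrad Ω f x‖ ^ p)
      (volume.restrict Ω) := by
    have := (hf.memLp_weakGrad h.isOpen).integrable_norm_rpow
      (by simpa using hp) (by simp)
    rw [ENNReal.toReal_ofReal hp.le] at this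
    exact this.const_mul _
  have i2 : Integrable (fun x => |f x| ^ p * |V x|) (volume.restrict Ω) := by
    have hl : LocallyIntegrableOn (fun x => |V x|) Ω volume := h.morrey.1.norm
    have hsupp : Function.support (fun x => |f x| ^ p) ⊆ Function.support f := by
      intro x hx h0
      simp [h0, Real.zero_rpow hp.ne'] at hx
    have := integrable_smul_of_tsupport (η := fun x => |f x| ^ p) hl
      (hf.continuous.abs.rpow_const fun x => Or.inr hp.le)
      (hf.hasCompactSupport.mono hsupp)
      ((closure_mono hsupp).trans hf.tsupport_subset)
    exact this.integrableOn
  refine (i1.add i2).mono' hmeas ?_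
  rw [ae_restrict_iff' h.isOpen.measurableSet]
  filter_upwards [hC, hz] with x hCx hzx hxΩ
  rw [Real.norm_of_nonneg (add_nonneg (Real.rpow_nonneg (matNorm_nonneg _ _) _)
    (mul_nonneg (posPot_nonneg _ _) (Real.rpow_nonneg (abs_nonneg _) _)))]
  refine add_le_add ?_ ?_
  · simp only []
    rw [← Real.mul_rpow (Real.sqrt_nonneg _) (norm_nonneg _)]
    refine Real.rpow_le_rpow (matNorm_nonneg _ _) ?_ hp.le
    by_cases hx : x ∈ tsupport f
    · exact matNorm_le (hCx hx) _
    · rw [hzx ⟨hxΩ, hx⟩]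
      simp [matNorm]
  · rw [mul_comm]
    refine mul_le_mul_of_nonneg_left ?_ (Real.rpow_nonneg (abs_nonneg _) _)
    exact max_le (abs_nonneg _) (le_abs_self _)

theorem memLp_density (h : IsAdmissible Ω p A V) {f : E N → ℝ} (hf : IsTestFunction Ω p f) :
    MemLp (density Ω p A V f) (ENNReal.ofReal p) (volume.restrict Ω) := by
  have hp := h.pos
  rw [← integrable_norm_rpow_iff (aestronglyMeasurable_density h hf) (by simpa using hp) (by simp)]
  rw [ENNReal.toReal_ofReal hp.le]
  refine (integrable_energy h hf).congr (Eventually.of_forall fun x => ?_)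
  simp only []
  rw [Real.norm_of_nonneg (density_nonneg f x), density_rpow hp]

theorem beppoLeviNorm_eq (h : IsAdmissible Ω p A V) {f : E N → ℝ} (hf : IsTestFunction Ω p f) :
    beppoLeviNorm Ω p A V f
      = (eLpNorm (density Ω p A V f) (ENNReal.ofReal p) (volume.restrict Ω)).toReal := by
  have hp := h.pos
  rw [(memLp_density h hf).eLpNorm_eq_integral_rpow_norm (by simpa using hp) (by simp),
    ENNReal.toReal_ofReal hp.le, ENNReal.toReal_ofReal (Real.rpow_nonneg (integral_nonneg
      fun x => Real.rpow_nonneg (norm_nonneg _) _) _)]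
  unfold beppoLeviNorm energy
  rw [one_div]
  congr 2
  funext x
  rw [Real.norm_of_nonneg (density_nonneg f x), density_rpow hp]

theorem density_add_le (h : IsAdmissible Ω p A V) {f f' : E N → ℝ} (hf : IsTestFunction Ω p f)
    (hf' : IsTestFunction Ω p f') : ∀ᵐ x ∂(volume.restrict Ω),
      density Ω p A V (f + f') x ≤ density Ω p A V f x + density Ω p A V f' x := by
  have hp := h.pos
  filter_upwards [(hf.hasWeakGrad.add hf'.hasWeakGrad).weakGrad_ae_eq h.isOpen, h.symm,
    h.ae_nonneg] with x hx hs hn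
  set a := matNorm (A x) (weakGrad Ω f x)
  set a' := matNorm (A x) (weakGrad Ω f' x)
  set w := posPot V x with hw
  have hw0 : 0 ≤ w := posPot_nonneg V x
  have hwp : (w ^ (1 / p)) ^ p = w := by
    rw [← Real.rpow_mul hw0, one_div_mul_cancel hp.ne', Real.rpow_one]
  have key := Real.Lp_add_le_of_nonneg (Finset.univ : Finset (Fin 2)) (p := p)
    (f := ![a, w ^ (1 / p) * |f x|]) (g := ![a', w ^ (1 / p) * |f' x|]) h.one_lt.le
    (by
      intro i _
      fin_cases i
      · exact matNorm_nonneg _ _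
      · exact mul_nonneg (Real.rpow_nonneg hw0 _) (abs_nonneg _))
    (by
      intro i _
      fin_cases i
      · exact matNorm_nonneg _ _
      · exact mul_nonneg (Real.rpow_nonneg hw0 _) (abs_nonneg _))
  simp only [Fin.sum_univ_two, Matrix.cons_val_zero, Matrix.cons_val_one] at key
  rw [← mul_add, Real.mul_rpow (Real.rpow_nonneg hw0 _) (by positivity),
    Real.mul_rpow (Real.rpow_nonneg hw0 _) (abs_nonneg _),
    Real.mul_rpow (Real.rpow_nonneg hw0 _) (abs_nonneg _), hwp] at key
  refine le_trans ?_ key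
  unfold density
  rw [hx]
  refine Real.rpow_le_rpow ?_ ?_ (by positivity)
  · exact add_nonneg (Real.rpow_nonneg (matNorm_nonneg _ _) _)
      (mul_nonneg hw0 (Real.rpow_nonneg (abs_nonneg _) _))
  · refine add_le_add ?_ ?_
    · exact Real.rpow_le_rpow (matNorm_nonneg _ _) (matNorm_add_le hs hn _ _) hp.le
    · refine mul_le_mul_of_nonneg_left ?_ hw0
      exact Real.rpow_le_rpow (abs_nonneg _) (abs_add_le _ _) hp.le

theorem beppoLeviNorm_add_le (h : IsAdmissible Ω p A V) {f f' : E N → ℝ}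
    (hf : IsTestFunction Ω p f) (hf' : IsTestFunction Ω p f') :
    beppoLeviNorm Ω p A V (f + f') ≤ beppoLeviNorm Ω p A V f + beppoLeviNorm Ω p A V f' := by
  rw [beppoLeviNorm_eq h (hf.add hf'), beppoLeviNorm_eq h hf, beppoLeviNorm_eq h hf']
  rw [← ENNReal.toReal_add (memLp_density h hf).eLpNorm_ne_top (memLp_density h hf').eLpNorm_ne_top]
  refine ENNReal.toReal_mono (ENNReal.add_ne_top.2
    ⟨(memLp_density h hf).eLpNorm_ne_top, (memLp_density h hf').eLpNorm_ne_top⟩) ?_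
  refine le_trans (eLpNorm_mono_ae_real
    (g := density Ω p A V f + density Ω p A V f') ?_)
    (eLpNorm_add_le (aestronglyMeasurable_density h hf) (aestronglyMeasurable_density h hf') ?_)
  · filter_upwards [density_add_le h hf hf'] with x hx
    rw [Real.norm_of_nonneg (density_nonneg _ x)]
    exact hx
  · simpa using h.one_lt.le

theorem beppoLeviNorm_smul (h : IsAdmissible Ω p A V) (c : ℝ) {f : E N → ℝ}
    (hf : IsTestFunction Ω p f) :
    beppoLeviNorm Ω p A V (c • f) = |c| * beppoLeviNorm Ω p A V f := by
  have hp := h.pos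
  have e : energy Ω p A (posPot V) (c • f) = |c| ^ p * energy Ω p A (posPot V) f := by
    unfold energy
    rw [← integral_const_mul]
    refine integral_congr_ae ?_
    filter_upwards [(hf.hasWeakGrad.smul c).weakGrad_ae_eq h.isOpen] with x hx
    simp only [hx, Pi.smul_apply, matNorm_smul, smul_eq_mul, abs_mul]
    rw [Real.mul_rpow (abs_nonneg _) (matNorm_nonneg _ _),
      Real.mul_rpow (abs_nonneg _) (abs_nonneg _)]
    ring
  have hn : 0 ≤ energy Ω p A (posPot V) f :=
    integral_nonneg fun x => add_nonneg (Real.rpow_nonneg (matNorm_nonneg _ _) _)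
      (mul_nonneg (posPot_nonneg _ _) (Real.rpow_nonneg (abs_nonneg _) _))
  unfold beppoLeviNorm
  rw [e, Real.mul_rpow (Real.rpow_nonneg (abs_nonneg _) _) hn, ← Real.rpow_mul (abs_nonneg _),
    mul_one_div_cancel hp.ne', Real.rpow_one]

/-- `W^{1,p}(Ω) ∩ C_c(Ω)`, to be equipped with the Beppo-Levi norm. -/
def EnergySpace (_h : IsAdmissible Ω p A V) : Type := testSpace Ω p

instance (h : IsAdmissible Ω p A V) : AddCommGroup (EnergySpace h) :=
  inferInstanceAs (AddCommGroup (testSpace Ω p))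

instance (h : IsAdmissible Ω p A V) : Module ℝ (EnergySpace h) :=
  inferInstanceAs (Module ℝ (testSpace Ω p))

/-- The function underlying an element of `W^{1,p}(Ω) ∩ C_c(Ω)`. -/
def EnergySpace.fn {h : IsAdmissible Ω p A V} (φ : EnergySpace h) : E N → ℝ :=
  (show testSpace Ω p from φ).1

theorem EnergySpace.isTestFunction {h : IsAdmissible Ω p A V} (φ : EnergySpace h) :
    IsTestFunction Ω p φ.fn :=
  (show testSpace Ω p from φ).2

theorem EnergySpace.fn_add {h : IsAdmissible Ω p A V} (φ ψ : EnergySpace h) :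
    (φ + ψ).fn = φ.fn + ψ.fn := rfl

theorem EnergySpace.fn_smul {h : IsAdmissible Ω p A V} (c : ℝ) (φ : EnergySpace h) :
    (c • φ).fn = c • φ.fn := rfl

/-- The Beppo-Levi norm on `W^{1,p}(Ω) ∩ C_c(Ω)`, as a seminorm. -/
def energySeminorm (h : IsAdmissible Ω p A V) : Seminorm ℝ (EnergySpace h) :=
  Seminorm.of (fun φ => beppoLeviNorm Ω p A V φ.fn)
    (fun φ ψ => beppoLeviNorm_add_le h φ.isTestFunction ψ.isTestFunction)
    (fun c φ => beppoLeviNorm_smul h c φ.isTestFunction)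

instance (h : IsAdmissible Ω p A V) : SeminormedAddCommGroup (EnergySpace h) :=
  (energySeminorm h).toSeminormedAddCommGroup

theorem EnergySpace.norm_def {h : IsAdmissible Ω p A V} (φ : EnergySpace h) :
    ‖φ‖ = beppoLeviNorm Ω p A V φ.fn := rfl

instance (h : IsAdmissible Ω p A V) : NormedSpace ℝ (EnergySpace h) where
  norm_smul_le c φ := (beppoLeviNorm_smul h c φ.isTestFunction).le

/-- The Beppo-Levi space `D^{1,p}_{A,V⁺}(Ω)`: the completion of `W^{1,p}(Ω) ∩ C_c(Ω)` with respect
to the Beppo-Levi norm. It is a real Banach space. -/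
abbrev BeppoLevi (h : IsAdmissible Ω p A V) : Type :=
  UniformSpace.Completion (EnergySpace h)

/-- The measurable function `f` represents the element `x` of the Beppo-Levi space: some sequence
in `W^{1,p}(Ω) ∩ C_c(Ω)` converges to `x` in the Beppo-Levi space and to `f` in `L^p_loc(Ω)`. -/
def Represents {h : IsAdmissible Ω p A V} (x : BeppoLevi h) (f : E N → ℝ) : Prop :=
  AEStronglyMeasurable f (volume.restrict Ω) ∧
  ∃ φ : ℕ → EnergySpace h, Tendsto (fun n => (φ n : BeppoLevi h)) atTop (𝓝 x) ∧
    ∀ K : Set (E N), IsCompact K → K ⊆ Ω →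
      Tendsto (fun n => eLpNorm ((φ n).fn - f) (ENNReal.ofReal p) (volume.restrict K))
        atTop (𝓝 0)

open Classical in
/-- The function on `Ω` (up to null sets) with which an element of the Beppo-Levi space is
identified. -/
def BeppoLevi.fn {h : IsAdmissible Ω p A V} (x : BeppoLevi h) : E N → ℝ :=
  if hx : ∃ f, Represents x f then hx.choose else 0

/-- The functional `T_g(x) = ∫_Ω |g| |x|^p` on the Beppo-Levi space. -/
def T (h : IsAdmissible Ω p A V) (g : E N → ℝ) (x : BeppoLevi h) : ℝ :=
  ∫ y in Ω, |g y| * |BeppoLevi.fn x y| ^ p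

end Admissible

/-- A real functional on a real normed space is compact if it maps weakly convergent sequences to
convergent sequences, with the value at the weak limit as the limit. -/
def IsCompactFunctional {X : Type*} [SeminormedAddCommGroup X] [NormedSpace ℝ X]
    (T : X → ℝ) : Prop :=
  ∀ (x : ℕ → X) (x₀ : X), (∀ l : X →L[ℝ] ℝ, Tendsto (fun n => l (x n)) atTop (𝓝 (l x₀))) →
    Tendsto (fun n => T (x n)) atTop (𝓝 (T x₀))

end HardyWeights

end

/-!
For weights that are bounded with compact support, compactness of `T_g` is a matter of local strong
convergence; the Hardy norm is strong enough to pass to the closure of these weights.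

*Elements of the Beppo-Levi space are functions.* Subcriticality provides a set of positive measure
on which the energy dominates the `L^p` norm. A Poincaré inequality on balls spreads this property
over the connected set `Ω`, so that on every compact subset the energy of a test function dominates
its `L^p` norm (`IsSubcritical.isControlled`). Hence the Beppo-Levi space maps continuously into
`L^p` of a measure that locally dominates Lebesgue measure (`IsEnergyMeasure`), which yields the
representing functions (`BeppoLevi.fn_spec`). Weighted inequalities for test functions extend to
them by Fatou's lemma (`BeppoLevi.lintegral_le`).

*Local strong convergence.* A function with an `L^p` gradient is close in `L^p` to its averages over
small balls, and these averages are continuous functionals on the Beppo-Levi space. Weakly null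
sequences therefore tend to zero in `L^p` of compact sets (`BeppoLevi.tendsto_lintegral_zero`). This
replaces the Rellich-Kondrachov theorem. Both this step and the Poincaré inequality rest on the
formula `f (x + v) - f x = ∫₀¹ ⟨∇f (x + t v), v⟩ dt` for weakly differentiable functions
(`HasWeakGrad.translate_sub_ae_eq`).

*The Hardy norm dominates the best Hardy constant*
(`IsPositiveSolution.exists_lintegral_le_hardyNorm_mul`). By the layer cake formula, `∫ |g| |φ|ᵖ` is
an integral over `t` of the masses of the sets `{|φ| ≥ t u}` with respect to `|g| uᵖ`. The Hardy
norm bounds these masses by the energy of a smooth truncation of `φ` at the level `t u / 2`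
(`IsPositiveSolution.exists_truncation`). Integrated over `t`, these energies add up to at most a
multiple of the energy of `φ` plus `∫ ((|φ| / u) |∇u|_A)ᵖ`. The latter is bounded by the energy of
`φ` through a Caccioppoli estimate, in which the equation for `u` is tested with `|φ|ᵖ u^(1 - p)`
(`IsPositiveSolution.integral_ratio_le`). The two test functions are legitimate by a chain rule for
functions of `φ` and `u` (`IsTestFunction.comp₂`), proved with difference quotients.

Together these give `∫ |g| |yₙ|ᵖ → 0` along weakly null sequences
(`MemHardyZero.tendsto_lintegral_zero`), and `T_g` is the `p`-th power of a seminorm.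
-/

noncomputable section

namespace HardyWeights

variable {N : ℕ}

/-! ### Translations of weakly differentiable functions -/

/-- Translations of a smooth test function can be differentiated under the integral: up to
reflections, the integral is a convolution. -/
theorem hasDerivAt_integral_mul_translate {f η : E N → ℝ} (hf : LocallyIntegrable f volume)
    (hη : ContDiff ℝ ∞ η) (hc : HasCompactSupport η) (v : E N) :
    (∀ t : ℝ, HasDerivAt (fun t : ℝ => ∫ x, f x * η (x + t • v))
      (∫ x, f x * fderiv ℝ η (x + t • v) v) t) ∧
    Continuous (fun t : ℝ => ∫ x, f x * fderiv ℝ η (x + t • v) v) := by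
  set θ : E N → ℝ := fun z => η (-z) with hθ
  have hθs : ContDiff ℝ ∞ θ := hη.comp contDiff_neg
  have hθc : HasCompactSupport θ := hc.comp_homeomorph (Homeomorph.neg (E N))
  have hdc : HasCompactSupport (fderiv ℝ θ) := hθc.fderiv (𝕜 := ℝ)
  have hdcont : Continuous (fderiv ℝ θ) := hθs.continuous_fderiv (by simp)
  have hfd : ∀ z w, fderiv ℝ θ z w = - fderiv ℝ η (-z) w := by
    intro z w
    have h1 : HasFDerivAt θ ((fderiv ℝ η (-z)).comp (-ContinuousLinearMap.id ℝ (E N))) z :=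
      ((hη.differentiable (by simp)) (-z)).hasFDerivAt.comp z (hasFDerivAt_id z).neg
    rw [h1.fderiv]
    simp
  have hval : ∀ t : ℝ, -∫ x, f x * fderiv ℝ θ (t • (-v) - x) v
      = ∫ x, f x * fderiv ℝ η (x + t • v) v := by
    intro t
    rw [← integral_neg]
    congr 1
    funext x
    rw [hfd]
    have : -(t • (-v) - x) = x + t • v := by rw [smul_neg]; abel
    rw [this]; ring
  constructor
  · intro t
    have h1 := hθc.hasFDerivAt_convolution_right (ContinuousLinearMap.mul ℝ ℝ) hf
      (hθs.of_le (by simp)) (t • (-v))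
    have h2 : HasDerivAt (fun s : ℝ => s • (-v)) (-v) t := by
      simpa using (hasDerivAt_id t).smul_const (-v)
    have h3 := h1.comp_hasDerivAt t h2
    rw [convolution_precompR_apply _ hf hdc hdcont] at h3
    have e1 : (convolution f θ (ContinuousLinearMap.mul ℝ ℝ) volume ∘ fun s : ℝ => s • (-v))
        = fun t : ℝ => ∫ x, f x * η (x + t • v) := by
      funext s
      simp only [Function.comp, convolution_def, ContinuousLinearMap.mul_apply', hθ]
      congr 1; funext x
      congr 2; rw [smul_neg]; abel
    rw [e1] at h3
    refine h3.congr_deriv ?_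
    change ∫ x, f x * fderiv ℝ θ (t • (-v) - x) (-v) = _
    simp only [map_neg, mul_neg]
    rw [integral_neg, hval]
  · have hc2 : HasCompactSupport (fun a => fderiv ℝ θ a v) := hθc.fderiv_apply (𝕜 := ℝ) v
    have h1 := hc2.continuous_convolution_right (ContinuousLinearMap.mul ℝ ℝ) (μ := volume) hf
      (hdcont.clm_apply continuous_const)
    have hs : Continuous fun s : ℝ => s • (-v) := continuous_id.smul continuous_const
    have h2 := (h1.comp hs).neg
    refine h2.congr fun t => ?_
    rw [← hval]
    rfl

/-- The fundamental theorem of calculus along segments, tested against a smooth function. -/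
theorem HasWeakGrad.integral_mul_translate_sub {f : E N → ℝ} {G : E N → E N}
    (h : HasWeakGrad univ f G) {η : E N → ℝ} (hη : ContDiff ℝ ∞ η) (hc : HasCompactSupport η)
    (v : E N) :
    (∫ x, f x * η (x + v)) - ∫ x, f x * η x
      = - ∫ t in (0 : ℝ)..1, ∫ x, inner ℝ (G x) v * η (x + t • v) := by
  have hf : LocallyIntegrable f volume := locallyIntegrableOn_univ.1 h.locInt
  obtain ⟨h1, h2⟩ := hasDerivAt_integral_mul_translate hf hη hc v
  have h3 := intervalIntegral.integral_eq_sub_of_hasDerivAt (a := 0) (b := 1) (fun t _ => h1 t)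
    (h2.intervalIntegrable _ _)
  simp only [one_smul, zero_smul, add_zero] at h3
  rw [← h3, ← intervalIntegral.integral_neg]
  refine intervalIntegral.integral_congr fun t _ => ?_
  have hs : ContDiff ℝ ∞ (fun x => η (x + t • v)) := hη.comp (contDiff_id.add contDiff_const)
  have hcs : HasCompactSupport (fun x => η (x + t • v)) :=
    hc.comp_homeomorph (Homeomorph.addRight (t • v))
  have := h.integral_eq _ hs hcs (subset_univ _) v
  simp only [Measure.restrict_univ] at this
  rw [← this]
  congr 1; funext x
  rw [fderiv_comp_add_right]

theorem integrable_inner_translate_prod {G : E N → E N} (hG : StronglyMeasurable G)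
    (hGi : Integrable G) (v : E N) : Integrable (fun z : ℝ × E N => inner ℝ (G (z.2 + z.1 • v)) v)
      ((volume.restrict (Ioc (0:ℝ) 1)).prod volume) := by
  have hm : StronglyMeasurable (fun z : ℝ × E N => inner ℝ (G (z.2 + z.1 • v)) v) := by
    have : StronglyMeasurable (fun z : ℝ × E N => G (z.2 + z.1 • v)) :=
      hG.comp_measurable (by fun_prop)
    exact this.inner stronglyMeasurable_const
  rw [integrable_prod_iff hm.aestronglyMeasurable]
  refine ⟨Eventually.of_forall fun t => ?_, ?_⟩
  · exact (hGi.comp_add_right (t • v)).inner_const v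
  · have : ∀ t : ℝ, ∫ y, ‖inner ℝ (G (y + t • v)) v‖ = ∫ y, ‖inner ℝ (G y) v‖ := fun t =>
      integral_add_right_eq_self (fun y => ‖inner ℝ (G y) v‖) (t • v)
    simp only [this]
    exact integrable_const _

theorem integral_mul_segment_swap {G : E N → E N} (hG : StronglyMeasurable G) (hGi : Integrable G)
    {η : E N → ℝ} (hη : Continuous η) (hc : HasCompactSupport η) (v : E N) :
    ∫ x, η x * ∫ t in (0 : ℝ)..1, inner ℝ (G (x + t • v)) v
      = ∫ t in (0 : ℝ)..1, ∫ x, inner ℝ (G x) v * η (x - t • v) := by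
  simp only [intervalIntegral.integral_of_le zero_le_one, ← integral_const_mul]
  rw [integral_integral_swap]
  · congr 1; funext t
    rw [← integral_add_right_eq_self (fun x => inner ℝ (G x) v * η (x - t • v)) (t • v)]
    congr 1; funext x; simp [mul_comm]
  · obtain ⟨C, hC⟩ := hc.exists_bound_of_continuous hη
    refine ((integrable_inner_translate_prod hG hGi v).swap.bdd_mul (c := C)
      (f := fun z : E N × ℝ => η z.1) ?_ (Eventually.of_forall fun z => hC _))
    exact (hη.comp continuous_fst).aestronglyMeasurable

/-- A weakly differentiable function satisfies the fundamental theorem of calculus along almost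
every segment with a given direction. -/
theorem HasWeakGrad.translate_sub_ae_eq {f : E N → ℝ} {G : E N → E N}
    (h : HasWeakGrad univ f G) (hG : StronglyMeasurable G) (hGi : Integrable G) (v : E N) :
    ∀ᵐ x, f (x + v) - f x = ∫ t in (0 : ℝ)..1, inner ℝ (G (x + t • v)) v := by
  have hf : LocallyIntegrable f volume := locallyIntegrableOn_univ.1 h.locInt
  have hI2 := (integrable_inner_translate_prod hG hGi v).integral_prod_right
  have hfv : LocallyIntegrable (fun x => f (x + v)) volume := by
    intro x
    obtain ⟨s, hs, hsi⟩ := hf (x + v)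
    refine ⟨(fun y => y + v) ⁻¹' s, (continuous_add_const v).continuousAt.preimage_mem_nhds hs, ?_⟩
    exact (measurePreserving_add_right volume v).integrableOn_comp_preimage
      (Homeomorph.addRight v).measurableEmbedding |>.2 hsi
  have key := ae_eq_zero_of_integral_contDiff_smul_eq_zero (μ := volume)
    (f := fun x => f (x + v) - f x - ∫ t in (0 : ℝ)..1, inner ℝ (G (x + t • v)) v) ?_ ?_
  · filter_upwards [key] with x hx using by linarith
  · refine (hfv.sub hf).sub ?_
    simp only [intervalIntegral.integral_of_le zero_le_one]
    exact hI2.locallyIntegrable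
  · intro η hη hc
    have i0 : ∀ {g : E N → ℝ}, LocallyIntegrable g volume → Integrable (fun x => η x * g x) :=
      fun {g} hg => hg.integrable_smul_left_of_hasCompactSupport hη.continuous hc
    have hηm : HasCompactSupport (fun x => η (x - v)) :=
      hc.comp_homeomorph (Homeomorph.subRight v)
    have e1 : ∫ x, η x * f (x + v) = ∫ x, f x * η (x - v) := by
      rw [← integral_add_right_eq_self (fun x => f x * η (x - v)) v]
      congr 1; funext x; simp [mul_comm]
    have e2 := integral_mul_segment_swap hG hGi hη.continuous hc v
    have e3 := h.integral_mul_translate_sub hη hc (-v)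
    simp only [smul_eq_mul, mul_sub]
    rw [integral_sub, integral_sub, e1, e2]
    · simp only [← sub_eq_add_neg, smul_neg, inner_neg_right, neg_mul, integral_neg,
        intervalIntegral.integral_neg, neg_neg] at e3
      simp only [mul_comm (η _) (f _)]
      linarith
    · exact i0 hfv
    · exact i0 hf
    · simpa only [Pi.sub_apply, mul_sub] using i0 (hfv.sub hf)
    · simp only [intervalIntegral.integral_of_le zero_le_one]
      exact i0 hI2.locallyIntegrable

/-- Jensen's inequality for the power `p ≥ 1` and a probability measure. -/
theorem lintegral_enorm_rpow_le {α F : Type*} [MeasurableSpace α] [NormedAddCommGroup F]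
    {ν : Measure α} [IsProbabilityMeasure ν] {f : α → F} (hf : AEStronglyMeasurable f ν) {p : ℝ}
    (hp : 1 ≤ p) : (∫⁻ x, ‖f x‖ₑ ∂ν) ^ p ≤ ∫⁻ x, ‖f x‖ₑ ^ p ∂ν := by
  have := eLpNorm'_le_eLpNorm'_of_exponent_le (μ := ν) zero_lt_one hp hf
  simp only [eLpNorm'_eq_lintegral_enorm, ENNReal.rpow_one, div_one] at this
  calc _ ≤ ((∫⁻ x, ‖f x‖ₑ ^ p ∂ν) ^ (1 / p)) ^ p := by gcongr
    _ = _ := by rw [← ENNReal.rpow_mul, one_div_mul_cancel (by positivity), ENNReal.rpow_one]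

/-- The `L^p` distance between a weakly differentiable function and its translate by `v`, on a set
`S`, is controlled by the gradient on any set that contains the translates of `S` by `t v`,
`0 ≤ t ≤ 1`. -/
theorem HasWeakGrad.lintegral_translate_sub_le {f : E N → ℝ} {G : E N → E N}
    (h : HasWeakGrad univ f G) (hG : StronglyMeasurable G) (hGi : Integrable G) (v : E N)
    {p : ℝ} (hp : 1 ≤ p) {S S' : Set (E N)} (hS : MeasurableSet S) (hS' : MeasurableSet S')
    (hSS : ∀ x ∈ S, ∀ t : ℝ, 0 ≤ t → t ≤ 1 → x + t • v ∈ S') :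
    ∫⁻ x in S, ‖f (x + v) - f x‖ₑ ^ p ≤ ‖v‖ₑ ^ p * ∫⁻ x in S', ‖G x‖ₑ ^ p := by
  have hm : Measurable (fun z : ℝ × E N => ‖G (z.2 + z.1 • v)‖ₑ ^ p) := by
    have : StronglyMeasurable (fun z : ℝ × E N => G (z.2 + z.1 • v)) :=
      hG.comp_measurable (by fun_prop)
    exact this.enorm.pow_const p
  have hpt : ∀ᵐ x ∂(volume.restrict S), ‖f (x + v) - f x‖ₑ ^ p
      ≤ ‖v‖ₑ ^ p * ∫⁻ t in Ioc (0:ℝ) 1, ‖G (x + t • v)‖ₑ ^ p := by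
    filter_upwards [ae_restrict_of_ae (h.translate_sub_ae_eq hG hGi v)] with x hx
    rw [hx, intervalIntegral.integral_of_le zero_le_one]
    have hmx : Measurable (fun t : ℝ => ‖G (x + t • v)‖ₑ) :=
      (hG.comp_measurable (by fun_prop : Measurable fun t : ℝ => x + t • v)).enorm
    have : IsProbabilityMeasure (volume.restrict (Ioc (0:ℝ) 1)) := ⟨by simp⟩
    have hj : (∫⁻ t in Ioc (0:ℝ) 1, ‖G (x + t • v)‖ₑ) ^ p
        ≤ ∫⁻ t in Ioc (0:ℝ) 1, ‖G (x + t • v)‖ₑ ^ p :=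
      lintegral_enorm_rpow_le
        (hG.comp_measurable
          (by fun_prop : Measurable fun t : ℝ => x + t • v)).aestronglyMeasurable hp
    calc ‖∫ t in Ioc (0:ℝ) 1, inner ℝ (G (x + t • v)) v‖ₑ ^ p
        ≤ (∫⁻ t in Ioc (0:ℝ) 1, ‖inner ℝ (G (x + t • v)) v‖ₑ) ^ p := by
          gcongr; exact enorm_integral_le_lintegral_enorm _
      _ ≤ (∫⁻ t in Ioc (0:ℝ) 1, ‖v‖ₑ * ‖G (x + t • v)‖ₑ) ^ p := by
          gcongr with t
          rw [← ofReal_norm, ← ofReal_norm, ← ofReal_norm, ← ENNReal.ofReal_mul (norm_nonneg _)]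
          refine ENNReal.ofReal_le_ofReal ?_
          rw [mul_comm]
          exact norm_inner_le_norm _ _
      _ = ‖v‖ₑ ^ p * (∫⁻ t in Ioc (0:ℝ) 1, ‖G (x + t • v)‖ₑ) ^ p := by
          rw [lintegral_const_mul _ hmx, ENNReal.mul_rpow_of_nonneg _ _ (by positivity)]
      _ ≤ _ := by gcongr
  refine (lintegral_mono_ae hpt).trans ?_
  rw [lintegral_const_mul']
  swap
  · exact ENNReal.rpow_ne_top_of_nonneg (by positivity) enorm_ne_top
  refine mul_le_mul' le_rfl ?_
  rw [lintegral_lintegral_swap]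
  swap
  · exact (hm.comp measurable_swap).aemeasurable
  calc ∫⁻ t in Ioc (0:ℝ) 1, ∫⁻ x in S, ‖G (x + t • v)‖ₑ ^ p
      ≤ ∫⁻ t in Ioc (0:ℝ) 1, ∫⁻ x in S', ‖G x‖ₑ ^ p := by
        refine setLIntegral_mono' measurableSet_Ioc fun t ht => ?_
        rw [← lintegral_indicator hS', ← lintegral_indicator hS,
          ← lintegral_add_right_eq_self (S'.indicator fun x => ‖G x‖ₑ ^ p) (t • v)]
        refine lintegral_mono fun x => ?_
        by_cases hx : x ∈ S
        · rw [indicator_of_mem hx, indicator_of_mem (hSS x hx t ht.1.le ht.2)]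
        · rw [indicator_of_notMem hx]; exact zero_le
    _ = _ := by simp

/-! ### The chain rule -/

theorem HasWeakGrad.integral_translate_sub_mul {f : E N → ℝ} {G : E N → E N}
    (h : HasWeakGrad univ f G) (hG : StronglyMeasurable G) (hGi : Integrable G)
    {η : E N → ℝ} (hη : Continuous η) (hc : HasCompactSupport η) (v : E N) :
    ∫ x, (f (x + v) - f x) * η x = ∫ t in (0 : ℝ)..1, ∫ x, inner ℝ (G x) v * η (x - t • v) := by
  rw [← integral_mul_segment_swap hG hGi hη hc v]
  refine integral_congr_ae ?_
  filter_upwards [h.translate_sub_ae_eq hG hGi v] with x hx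
  rw [hx, mul_comm]

/-- Integration by parts against a test function that is merely continuous, with a difference
quotient in place of the gradient. -/
theorem HasWeakGrad.hasDerivAt_integral_translate_sub_mul {f : E N → ℝ} {G : E N → E N}
    (h : HasWeakGrad univ f G) (hG : StronglyMeasurable G) (hGi : Integrable G)
    {η : E N → ℝ} (hη : Continuous η) (hc : HasCompactSupport η) (v : E N) :
    HasDerivAt (fun t : ℝ => ∫ x, (f (x + t • v) - f x) * η x) (∫ x, inner ℝ (G x) v * η x) 0 := by
  rw [hasDerivAt_iff_isLittleO, Asymptotics.isLittleO_iff]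
  intro ε hε
  set B := ∫ x, ‖G x‖ with hB
  have hB0 : 0 ≤ B := integral_nonneg fun x => norm_nonneg _
  -- the summand `1` only guards against a zero denominator
  set ε' := ε / (‖v‖ * B + 1) with hε'
  have hd : 0 < ‖v‖ * B + 1 := by positivity
  have hε'0 : 0 < ε' := by positivity
  obtain ⟨δ, hδ, hu⟩ := Metric.uniformContinuous_iff.1
    (hη.uniformContinuous_of_tendsto_cocompact hc.is_zero_at_infty) ε' hε'0
  obtain ⟨C, hC⟩ := hc.exists_bound_of_continuous hη
  have hGv : ∀ w : E N, Integrable (fun x => inner ℝ (G x) w) := fun w => hGi.inner_const w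
  have hint : ∀ (w y : E N), Integrable (fun x => inner ℝ (G x) w * η (x - y)) := fun w y =>
    (hGv w).mul_bdd (c := C) (hη.comp (by fun_prop)).aestronglyMeasurable
      (Eventually.of_forall fun x => hC _)
  have hnear : ∀ᶠ t : ℝ in 𝓝 0, ‖t • v‖ < δ := by
    have : ContinuousAt (fun t : ℝ => ‖t • v‖) 0 := by fun_prop
    refine this.eventually_lt continuousAt_const ?_
    simpa using hδ
  filter_upwards [hnear] with t ht
  simp only [zero_smul, add_zero, sub_self, zero_mul, integral_zero, sub_zero, smul_eq_mul]
  rw [h.integral_translate_sub_mul hG hGi hη hc (t • v)]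
  have e1 : t * ∫ x, inner ℝ (G x) v * η x
      = ∫ s in (0 : ℝ)..1, ∫ x, inner ℝ (G x) (t • v) * η x := by
    rw [intervalIntegral.integral_const, ← integral_const_mul]
    simp only [sub_zero, one_smul, inner_smul_right, mul_assoc]
  have hbd : ∀ s : ℝ, s ∈ Ioc (0:ℝ) 1 →
      ‖(∫ x, inner ℝ (G x) (t • v) * η (x - s • t • v)) - ∫ x, inner ℝ (G x) (t • v) * η x‖
        ≤ ε' * (‖t • v‖ * B) := by
    intro s hs
    have h0 := hint (t • v) 0
    simp only [sub_zero] at h0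
    rw [← integral_sub (hint _ _) h0, hB, ← integral_const_mul, ← integral_const_mul]
    refine norm_integral_le_of_norm_le ((hGi.norm.const_mul _).const_mul _)
      (Eventually.of_forall fun x => ?_)
    rw [← mul_sub, norm_mul, mul_comm]
    have h1 : ‖η (x - s • t • v) - η x‖ ≤ ε' := by
      rw [← dist_eq_norm]
      refine (hu ?_).le
      rw [dist_eq_norm, sub_sub_cancel_left, norm_neg, norm_smul]
      refine lt_of_le_of_lt ?_ ht
      rw [Real.norm_of_nonneg hs.1.le]
      exact mul_le_of_le_one_left (norm_nonneg _) hs.2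
    refine mul_le_mul h1 ?_ (norm_nonneg _) hε'0.le
    rw [mul_comm]
    exact norm_inner_le_norm _ _
  have hcont : Continuous fun s : ℝ => ∫ x, inner ℝ (G x) (t • v) * η (x - s • t • v) := by
    refine continuous_of_dominated (bound := fun x => ‖inner ℝ (G x) (t • v)‖ * C)
      (fun s => (hint _ _).aestronglyMeasurable)
      (fun s => Eventually.of_forall fun x => ?_) ((hGv _).norm.mul_const _)
      (Eventually.of_forall fun x => continuous_const.mul (hη.comp (by fun_prop)))
    rw [norm_mul]
    exact mul_le_mul_of_nonneg_left (hC _) (norm_nonneg _)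
  rw [e1, ← intervalIntegral.integral_sub (hcont.intervalIntegrable _ _) (by simp)]
  refine (intervalIntegral.norm_integral_le_of_norm_le_const (C := ε' * (‖t • v‖ * B)) ?_).trans ?_
  · intro s hs
    rw [uIoc_of_le zero_le_one] at hs
    exact hbd s hs
  · rw [norm_smul, sub_zero, abs_one, mul_one]
    have : ε' * (‖v‖ * B) ≤ ε := by
      rw [hε', div_mul_eq_mul_div, div_le_iff₀ hd]
      nlinarith [mul_nonneg (norm_nonneg v) hB0]
    calc ε' * (‖t‖ * ‖v‖ * B) = ε' * (‖v‖ * B) * ‖t‖ := by ring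
      _ ≤ ε * ‖t‖ := by gcongr

/-- A continuously differentiable function is approximated by its linearizations uniformly on a
compact set. -/
theorem exists_uniform_linearization {P : Type*} [NormedAddCommGroup P] [NormedSpace ℝ P]
    {F : P → ℝ} {F' : P → P →L[ℝ] ℝ} {C : Set P} (hC : IsCompact C)
    (hF : ∀ a ∈ C, HasStrictFDerivAt F (F' a) a) (hF' : ContinuousOn F' C) {ε : ℝ} (hε : 0 < ε) :
    ∃ δ > 0, ∀ a ∈ C, ∀ b, dist b a < δ → ‖F b - F a - F' a (b - a)‖ ≤ ε * ‖b - a‖ := by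
  suffices H : ∃ δ > 0, ∀ a ∈ C, a ∈ C → ∀ b, dist b a < δ →
      ‖F b - F a - F' a (b - a)‖ ≤ ε * ‖b - a‖ by
    obtain ⟨δ, hδ, H⟩ := H
    exact ⟨δ, hδ, fun a ha => H a ha ha⟩
  refine hC.induction_on (p := fun S => ∃ δ > 0, ∀ a ∈ S, a ∈ C → ∀ b, dist b a < δ →
      ‖F b - F a - F' a (b - a)‖ ≤ ε * ‖b - a‖) ?_ ?_ ?_ ?_
  · exact ⟨1, one_pos, fun a ha => absurd ha (notMem_empty a)⟩
  · rintro S T hST ⟨δ, hδ, h⟩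
    exact ⟨δ, hδ, fun a ha => h a (hST ha)⟩
  · rintro S T ⟨δ, hδ, h⟩ ⟨δ', hδ', h'⟩
    refine ⟨min δ δ', lt_min hδ hδ', ?_⟩
    rintro a (ha | ha) haC b hb
    · exact h a ha haC b (hb.trans_le (min_le_left _ _))
    · exact h' a ha haC b (hb.trans_le (min_le_right _ _))
  · intro a ha
    have h1 : ∀ᶠ q : P × P in 𝓝 (a, a),
        ‖F q.1 - F q.2 - F' a (q.1 - q.2)‖ ≤ ε / 2 * ‖q.1 - q.2‖ :=
      (Asymptotics.isLittleO_iff.1 (hF a ha).isLittleO) (half_pos hε)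
    have h2 : ∀ᶠ y in 𝓝[C] a, ‖F' y - F' a‖ < ε / 2 := by
      have := (hF' a ha).eventually (Metric.ball_mem_nhds _ (half_pos hε))
      simpa [dist_eq_norm] using this
    obtain ⟨r, hr, hr1⟩ := Metric.eventually_nhds_iff_ball.1 h1
    refine ⟨{y | ‖F' y - F' a‖ < ε / 2} ∩ Metric.ball a (r / 2),
      inter_mem h2 (mem_nhdsWithin_of_mem_nhds (Metric.ball_mem_nhds _ (half_pos hr))),
      r / 2, half_pos hr, ?_⟩
    rintro y ⟨hy1, hy2⟩ - b hb
    have hyb : ((b, y) : P × P) ∈ Metric.ball (a, a) r := by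
      rw [Metric.mem_ball, Prod.dist_eq, max_lt_iff]
      refine ⟨?_, (Metric.mem_ball.1 hy2).trans (half_lt_self hr)⟩
      exact (dist_triangle b y a).trans_lt (by have := Metric.mem_ball.1 hy2; linarith)
    have e := hr1 _ hyb
    simp only [] at e
    have e2 : F b - F y - F' y (b - y) = (F b - F y - F' a (b - y)) - (F' y - F' a) (b - y) := by
      simp
    rw [e2]
    refine (norm_sub_le _ _).trans ?_
    have e3 := ((F' y - F' a).le_opNorm (b - y))
    have hy1' : ‖F' y - F' a‖ < ε / 2 := hy1
    have : ‖F' y - F' a‖ * ‖b - y‖ ≤ ε / 2 * ‖b - y‖ := by gcongr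
    linarith

/-- The chain rule for a continuously differentiable function of two uniformly continuous weakly
differentiable functions with values in a compact set. -/
theorem HasWeakGrad.comp₂ {f g : E N → ℝ} {G G' : E N → E N}
    (hf : HasWeakGrad univ f G) (hG : StronglyMeasurable G) (hGi : Integrable G)
    (hfu : UniformContinuous f)
    (hg : HasWeakGrad univ g G') (hG' : StronglyMeasurable G') (hGi' : Integrable G')
    (hgu : UniformContinuous g)
    {F : ℝ × ℝ → ℝ} {F' : ℝ × ℝ → ℝ × ℝ →L[ℝ] ℝ} {C : Set (ℝ × ℝ)} (hC : IsCompact C)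
    (hmem : ∀ x, (f x, g x) ∈ C) (hF : ∀ a ∈ C, HasStrictFDerivAt F (F' a) a)
    (hF' : ContinuousOn F' C) :
    HasWeakGrad univ (fun x => F (f x, g x))
      (fun x => F' (f x, g x) (1, 0) • G x + F' (f x, g x) (0, 1) • G' x) := by
  have ha : Continuous fun x => (f x, g x) := hfu.continuous.prodMk hgu.continuous
  have hFc : Continuous fun x => F (f x, g x) := by
    rw [continuous_iff_continuousAt]
    intro x
    exact ContinuousAt.comp (f := fun x => (f x, g x)) (hF _ (hmem x)).hasFDerivAt.continuousAt
      ha.continuousAt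
  have hF'c : Continuous fun x => F' (f x, g x) := hF'.comp_continuous ha hmem
  have hF'w : ∀ w : ℝ × ℝ, Continuous fun x => F' (f x, g x) w := fun w =>
    hF'c.clm_apply continuous_const
  obtain ⟨D, hD⟩ := hC.exists_bound_of_continuousOn hF'
  have hI : ∀ w : ℝ × ℝ, ∀ {H : E N → E N}, Integrable H →
      Integrable (fun x => F' (f x, g x) w • H x) := fun w {H} hH =>
    hH.bdd_smul (D * ‖w‖) (hF'w w).aestronglyMeasurable (Eventually.of_forall fun x =>
      ((F' (f x, g x)).le_opNorm w).trans (mul_le_mul_of_nonneg_right (hD _ (hmem x))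
        (norm_nonneg w)))
  refine ⟨hFc.locallyIntegrable.locallyIntegrableOn _,
    ((hI _ hGi).add (hI _ hGi')).locallyIntegrable.locallyIntegrableOn _, ?_⟩
  intro η hη hc _ v
  simp only [Measure.restrict_univ]
  set b₁ : E N → ℝ := fun x => F' (f x, g x) (1, 0) * η x with hb₁
  set b₂ : E N → ℝ := fun x => F' (f x, g x) (0, 1) * η x with hb₂
  have hb₁c : Continuous b₁ := (hF'w _).mul hη.continuous
  have hb₂c : Continuous b₂ := (hF'w _).mul hη.continuous
  have hb₁s : HasCompactSupport b₁ := hc.mul_left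
  have hb₂s : HasCompactSupport b₂ := hc.mul_left
  have ics : ∀ {k θ : E N → ℝ}, Continuous k → Continuous θ → HasCompactSupport θ →
      Integrable (fun x => k x * θ x) := fun {k θ} hk hθ hs =>
    (hk.mul hθ).integrable_of_hasCompactSupport hs.mul_left
  -- the derivative at `0` of `t ↦ ∫ (F (a (x - t v)) - F (a x)) η x`, computed in two ways
  have d₀ : HasDerivAt (fun t : ℝ => ∫ x, (F (f (x + t • (-v)), g (x + t • (-v))) - F (f x, g x))
      * η x) (∫ x, F (f x, g x) * fderiv ℝ η x v) 0 := by
    have := ((hasDerivAt_integral_mul_translate hFc.locallyIntegrable hη hc v).1 0).sub_const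
      (∫ x, F (f x, g x) * η x)
    simp only [zero_smul, add_zero] at this
    refine this.congr_of_eventuallyEq (Eventually.of_forall fun t => ?_)
    simp only [sub_mul]
    rw [integral_sub]
    · congr 1
      rw [← integral_add_right_eq_self _ (t • v)]
      congr 1; funext x; simp
    · exact ics (hFc.comp (by fun_prop : Continuous fun x : E N => x + t • (-v))) hη.continuous hc
    · exact ics hFc hη.continuous hc
  have d₁ := hf.hasDerivAt_integral_translate_sub_mul hG hGi hb₁c hb₁s (-v)
  have d₂ := hg.hasDerivAt_integral_translate_sub_mul hG' hGi' hb₂c hb₂s (-v)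
  -- the error of the linearization of `F` is `o(t)`, as the increments of `f` and `g` are `O(t)` in
  -- `L¹`
  have d₃ : HasDerivAt (fun t : ℝ =>
      (∫ x, (F (f (x + t • (-v)), g (x + t • (-v))) - F (f x, g x)) * η x)
      - ((∫ x, (f (x + t • (-v)) - f x) * b₁ x) + ∫ x, (g (x + t • (-v)) - g x) * b₂ x)) 0 0 := by
    rw [hasDerivAt_iff_isLittleO, Asymptotics.isLittleO_iff]
    intro ε hε
    obtain ⟨M, hM⟩ := hc.exists_bound_of_continuous hη.continuous
    have hM0 : 0 ≤ M := (norm_nonneg _).trans (hM 0)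
    set B := (∫ x, ‖G x‖) + ∫ x, ‖G' x‖ with hB
    have hB0 : 0 ≤ B := add_nonneg (integral_nonneg fun x => norm_nonneg _)
      (integral_nonneg fun x => norm_nonneg _)
    set ε' := ε / (M * (‖v‖ * B) + 1) with hε'
    have hd : 0 < M * (‖v‖ * B) + 1 := by positivity
    have hε'0 : 0 < ε' := by positivity
    obtain ⟨δ, hδ, hlin⟩ := exists_uniform_linearization hC hF hF' hε'0
    obtain ⟨δ', hδ', hu⟩ := Metric.uniformContinuous_iff.1 (hfu.prodMk hgu) δ hδ
    have hnear : ∀ᶠ t : ℝ in 𝓝 0, ‖t • v‖ < δ' := by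
      have : ContinuousAt (fun t : ℝ => ‖t • v‖) 0 := by fun_prop
      refine this.eventually_lt continuousAt_const ?_
      simpa using hδ'
    filter_upwards [hnear] with t ht
    simp only [zero_smul, add_zero, sub_self, zero_mul, integral_zero, sub_zero, smul_zero]
    have hL1 : ∀ {k : E N → ℝ} {H : E N → E N}, HasWeakGrad univ k H → StronglyMeasurable H →
        Integrable H → Continuous k →
        Integrable (fun x => ‖k (x + t • (-v)) - k x‖) ∧
        ∫ x, ‖k (x + t • (-v)) - k x‖ ≤ ‖t • v‖ * ∫ x, ‖H x‖ := by
      intro k H hk hH hHi hkc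
      have h1 := hk.lintegral_translate_sub_le hH hHi (t • (-v)) le_rfl MeasurableSet.univ
        MeasurableSet.univ (fun _ _ _ _ _ => mem_univ _)
      simp only [ENNReal.rpow_one, Measure.restrict_univ] at h1
      have hm : Continuous (fun x => k (x + t • (-v)) - k x) := by fun_prop
      have hfin : ‖t • (-v)‖ₑ * ∫⁻ x, ‖H x‖ₑ < ⊤ :=
        ENNReal.mul_lt_top enorm_lt_top hHi.2
      have hi : Integrable (fun x => k (x + t • (-v)) - k x) :=
        ⟨hm.aestronglyMeasurable, h1.trans_lt hfin⟩
      refine ⟨hi.norm, ?_⟩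
      rw [integral_norm_eq_lintegral_enorm hi.1, integral_norm_eq_lintegral_enorm hHi.1]
      refine (ENNReal.toReal_mono hfin.ne h1).trans ?_
      rw [ENNReal.toReal_mul, toReal_enorm, smul_neg, norm_neg]
    obtain ⟨i₁, l₁⟩ := hL1 hf hG hGi hfu.continuous
    obtain ⟨i₂, l₂⟩ := hL1 hg hG' hGi' hgu.continuous
    have hτ : Continuous fun x : E N => x + t • (-v) := by fun_prop
    have j₀ : Integrable fun x =>
        (F (f (x + t • (-v)), g (x + t • (-v))) - F (f x, g x)) * η x :=
      ics ((hFc.comp hτ).sub hFc) hη.continuous hc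
    have j₁ : Integrable fun x => (f (x + t • (-v)) - f x) * b₁ x :=
      ics ((hfu.continuous.comp hτ).sub hfu.continuous) hb₁c hb₁s
    have j₂ : Integrable fun x => (g (x + t • (-v)) - g x) * b₂ x :=
      ics ((hgu.continuous.comp hτ).sub hgu.continuous) hb₂c hb₂s
    have j₃ : Integrable fun x =>
        (f (x + t • (-v)) - f x) * b₁ x + (g (x + t • (-v)) - g x) * b₂ x := j₁.add j₂
    rw [← integral_add j₁ j₂, ← integral_sub j₀ j₃]
    refine (norm_integral_le_of_norm_le ((i₁.add i₂).const_mul (ε' * M))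
      (Eventually.of_forall fun x => ?_)).trans ?_
    · have hl := hlin _ (hmem x) (f (x + t • (-v)), g (x + t • (-v)))
        (hu (by rw [dist_eq_norm, add_sub_cancel_left, smul_neg, norm_neg]; exact ht))
      have e1 : F' (f x, g x) ((f (x + t • (-v)), g (x + t • (-v))) - (f x, g x))
          = (f (x + t • (-v)) - f x) * F' (f x, g x) (1, 0)
            + (g (x + t • (-v)) - g x) * F' (f x, g x) (0, 1) := by
        rw [← smul_eq_mul, ← smul_eq_mul, ← map_smul, ← map_smul, ← map_add]
        simp
      rw [e1] at hl
      have e2 : (F (f (x + t • (-v)), g (x + t • (-v))) - F (f x, g x)) * η x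
          - ((f (x + t • (-v)) - f x) * b₁ x + (g (x + t • (-v)) - g x) * b₂ x)
          = (F (f (x + t • (-v)), g (x + t • (-v))) - F (f x, g x)
            - ((f (x + t • (-v)) - f x) * F' (f x, g x) (1, 0)
            + (g (x + t • (-v)) - g x) * F' (f x, g x) (0, 1))) * η x := by
        simp only [hb₁, hb₂]; ring
      rw [e2, norm_mul]
      have e3 : ‖(f (x + t • (-v)), g (x + t • (-v))) - (f x, g x)‖
          ≤ ‖f (x + t • (-v)) - f x‖ + ‖g (x + t • (-v)) - g x‖ :=
        max_le (le_add_of_nonneg_right (norm_nonneg _)) (le_add_of_nonneg_left (norm_nonneg _))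
      calc _ ≤ (ε' * (‖f (x + t • (-v)) - f x‖ + ‖g (x + t • (-v)) - g x‖)) * M :=
            mul_le_mul (hl.trans (by gcongr)) (hM x) (norm_nonneg _) (by positivity)
        _ = _ := by simp only [Pi.add_apply]; ring
    · rw [integral_const_mul]
      simp only [Pi.add_apply]
      rw [integral_add i₁ i₂]
      have hfin : ε' * (M * (‖v‖ * B)) ≤ ε := by
        rw [hε', div_mul_eq_mul_div, div_le_iff₀ hd]
        nlinarith [show 0 ≤ M * (‖v‖ * B) by positivity]
      calc _ ≤ ε' * M * (‖t • v‖ * (∫ x, ‖G x‖) + ‖t • v‖ * ∫ x, ‖G' x‖) := by gcongr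
        _ = ε' * (M * (‖v‖ * B)) * ‖t‖ := by rw [norm_smul, hB]; ring
        _ ≤ ε * ‖t‖ := by gcongr
  have key := d₀.unique ((d₃.add (d₁.add d₂)).congr_of_eventuallyEq
    (Eventually.of_forall fun t => by simp))
  rw [key, zero_add, ← integral_add, ← integral_neg]
  · congr 1; funext x
    simp only [hb₁, hb₂, inner_neg_right, inner_add_left, inner_smul_left, RCLike.conj_to_real]
    ring
  · exact (by simpa using integrable_inner_mul hf.locIntGrad hb₁c hb₁s (subset_univ _) (-v))
  · exact (by simpa using integrable_inner_mul hg.locIntGrad hb₂c hb₂s (subset_univ _) (-v))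

/-! ### Localization of weak gradients -/

theorem exists_cutoff {K Ω : Set (E N)} (hK : IsCompact K) (hΩ : IsOpen Ω) (hKΩ : K ⊆ Ω) :
    ∃ χ : E N → ℝ, ContDiff ℝ ∞ χ ∧ HasCompactSupport χ ∧ tsupport χ ⊆ Ω ∧
      (∀ x, χ x ∈ Icc (0 : ℝ) 1) ∧ ∃ U, IsOpen U ∧ K ⊆ U ∧ ∀ x ∈ U, χ x = 1 := by
  obtain ⟨L, hL, hKL, hLΩ⟩ := exists_compact_between hK hΩ hKΩ
  obtain ⟨χ, h1, h0, hχ⟩ := exists_contMDiffMap_one_nhds_of_subset_interior (n := (⊤ : ℕ∞))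
    (modelWithCornersSelf ℝ (E N)) hK.isClosed hKL
  obtain ⟨U, hU, hKU, hU1⟩ := mem_nhdsSet_iff_exists.1 h1
  have hs : tsupport χ ⊆ L := closure_minimal (fun x hx => by
    by_contra hxL; exact hx (h0 x hxL)) hL.isClosed
  exact ⟨χ, χ.contMDiff.contDiff, hL.of_isClosed_subset (isClosed_tsupport _) hs, hs.trans hLΩ,
    hχ, U, hU, hKU, hU1⟩

theorem HasWeakGrad.congr_grad {Ω : Set (E N)} {f : E N → ℝ}
    {G G' : E N → E N} (h : HasWeakGrad Ω f G) (hG : G =ᵐ[volume.restrict Ω] G') :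
    HasWeakGrad Ω f G' where
  locInt := h.locInt
  locIntGrad := by
    intro x hx
    obtain ⟨s, hs, hi⟩ := h.locIntGrad x hx
    refine ⟨s ∩ Ω, inter_mem hs self_mem_nhdsWithin, ?_⟩
    exact (hi.mono_set inter_subset_left).congr
      (ae_mono (Measure.restrict_mono inter_subset_right le_rfl) hG)
  integral_eq η hη hc hs v := by
    rw [h.integral_eq η hη hc hs v]
    congr 1
    refine integral_congr_ae ?_
    filter_upwards [hG] with x hx
    rw [hx]

theorem HasWeakGrad.mono {Ω Ω' : Set (E N)} (hΩ' : MeasurableSet Ω') (hΩ : Ω ⊆ Ω')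
    {f : E N → ℝ} {G : E N → E N} (h : HasWeakGrad Ω' f G) : HasWeakGrad Ω f G where
  locInt := h.locInt.mono_set hΩ
  locIntGrad := h.locIntGrad.mono_set hΩ
  integral_eq η hη hc hs v := by
    have e := h.integral_eq η hη hc (hs.trans hΩ) v
    have h0 : ∀ x, x ∉ Ω → η x = 0 := fun x hx =>
      image_eq_zero_of_notMem_tsupport fun hx' => hx (hs hx')
    have h1 : ∀ x, x ∉ Ω → fderiv ℝ η x = 0 := fun x hx => by
      by_contra hne
      exact hx (hs (support_fderiv_subset ℝ hne))
    rw [setIntegral_eq_of_subset_of_forall_sdiff_eq_zero hΩ' hΩ (fun x hx => by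
        simp [h1 x hx.2]),
      setIntegral_eq_of_subset_of_forall_sdiff_eq_zero hΩ' hΩ (fun x hx => by
        simp [h0 x hx.2])] at e
    exact e

theorem HasWeakGrad.ae_eq_of_eqOn {Ω U : Set (E N)} (hU : IsOpen U) (hUΩ : U ⊆ Ω)
    {f f' : E N → ℝ} {G G' : E N → E N} (h : HasWeakGrad Ω f G) (h' : HasWeakGrad Ω f' G')
    (hf : ∀ x ∈ U, f x = f' x) : ∀ᵐ x, x ∈ U → G x = G' x := by
  filter_upwards [(h.add (h'.smul (-1))).ae_eq_zero_of_eqOn hU hUΩ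
    (fun x hx => by simp [hf x hx])] with x hx hxU
  have := hx hxU
  simp only [Pi.add_apply, neg_smul, one_smul] at this
  exact sub_eq_zero.1 (by rw [sub_eq_add_neg]; exact this)

/-- The integral of a translate does not depend on the translation, so it has zero derivative. -/
theorem hasWeakGrad_const (c : ℝ) : HasWeakGrad (univ : Set (E N)) (fun _ => c) 0 where
  locInt := (locallyIntegrable_const c).locallyIntegrableOn _
  locIntGrad := locallyIntegrable_zero.locallyIntegrableOn _
  integral_eq η hη hc _ v := by
    have h1 := (hasDerivAt_integral_mul_translate (locallyIntegrable_const c) hη hc v).1 0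
    have h2 : (fun t : ℝ => ∫ x, c * η (x + t • v)) = fun _ => ∫ x, c * η x := by
      funext t
      exact integral_add_right_eq_self (fun x => c * η x) (t • v)
    rw [h2] at h1
    have h3 := h1.unique (hasDerivAt_const _ _)
    simpa using h3

/-- The product rule for a smooth cutoff function. The product, extended by zero, is weakly
differentiable on the whole space. -/
theorem HasWeakGrad.cutoff_mul {Ω : Set (E N)} {f : E N → ℝ} {G : E N → E N}
    (h : HasWeakGrad Ω f G) {χ : E N → ℝ} (hχ : ContDiff ℝ ∞ χ) (hχc : HasCompactSupport χ)
    (hχΩ : tsupport χ ⊆ Ω) :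
    Integrable (fun x => χ x • G x + f x • gradient χ x) ∧
    HasWeakGrad univ (fun x => χ x * f x) (fun x => χ x • G x + f x • gradient χ x) := by
  have hg : ∀ x w, inner ℝ (gradient χ x) w = fderiv ℝ χ x w := fun x w => by
    rw [← toDual_gradient, InnerProductSpace.toDual_apply_apply]
  have hgc : Continuous (gradient χ) :=
    (InnerProductSpace.toDual ℝ (E N)).symm.continuous.comp (hχ.continuous_fderiv (by simp))
  have hgs : tsupport (gradient χ) ⊆ tsupport χ := by
    refine closure_minimal (fun x hx => ?_) (isClosed_tsupport χ)
    refine support_fderiv_subset ℝ fun h0 => hx ?_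
    rw [gradient, h0, map_zero]
  have i1 : Integrable (fun x => χ x • G x) :=
    integrable_smul_of_tsupport h.locIntGrad hχ.continuous hχc hχΩ
  have i2 : Integrable (fun x => f x • gradient χ x) := by
    have h1 : IntegrableOn f (tsupport χ) volume := h.locInt.integrableOn_compact_subset hχΩ hχc
    have h2 : IntegrableOn (fun x => f x • gradient χ x) (tsupport χ) volume := by
      have hgcs : HasCompactSupport (gradient χ) :=
        hχc.of_isClosed_subset (isClosed_tsupport _) hgs
      obtain ⟨C, hC⟩ := hgcs.exists_bound_of_continuous hgc
      exact h1.smul_bdd C hgc.aestronglyMeasurable (Eventually.of_forall hC)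
    refine (integrableOn_iff_integrable_of_support_subset ?_).1 h2
    intro x hx
    refine hgs (subset_tsupport _ fun h0 => ?_)
    simp [h0] at hx
  have i3 : Integrable (fun x => χ x * f x) := by
    simpa using integrable_smul_of_tsupport h.locInt hχ.continuous hχc hχΩ
  refine ⟨i1.add i2, i3.locallyIntegrable.locallyIntegrableOn _,
    (i1.add i2).locallyIntegrable.locallyIntegrableOn _, ?_⟩
  intro η hη hc _ v
  have hs : tsupport (fun x => χ x * η x) ⊆ tsupport χ :=
    closure_mono fun x hx => left_ne_zero_of_mul hx
  have e := h.integral_eq (fun x => χ x * η x) (hχ.mul hη) hc.mul_left (hs.trans hχΩ) v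
  have hd : ∀ x, fderiv ℝ (fun x => χ x * η x) x v = χ x * fderiv ℝ η x v
      + η x * fderiv ℝ χ x v := by
    intro x
    rw [fderiv_fun_mul (hχ.differentiable (by simp) x) (hη.differentiable (by simp) x)]
    simp
  have hz : ∀ x, x ∉ Ω → χ x = 0 := fun x hx =>
    image_eq_zero_of_notMem_tsupport fun hx' => hx (hχΩ hx')
  have hz' : ∀ x, x ∉ Ω → fderiv ℝ χ x = 0 := fun x hx => by
    by_contra hne
    exact hx (hχΩ (support_fderiv_subset ℝ hne))
  rw [setIntegral_eq_integral_of_forall_compl_eq_zero (fun x hx => by simp [hd, hz x hx, hz' x hx]),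
    setIntegral_eq_integral_of_forall_compl_eq_zero (fun x hx => by simp [hz x hx])] at e
  simp only [Measure.restrict_univ]
  obtain ⟨C, hC⟩ := hc.exists_bound_of_continuous hη.continuous
  obtain ⟨C', hC'⟩ := (hc.fderiv_apply (𝕜 := ℝ) v).exists_bound_of_continuous
    ((hη.continuous_fderiv (by simp)).clm_apply continuous_const)
  have j1 : Integrable (fun x => χ x * f x * fderiv ℝ η x v) :=
    i3.mul_bdd (c := C') ((hη.continuous_fderiv (by simp)).clm_apply
      continuous_const).aestronglyMeasurable (Eventually.of_forall hC')
  have j2 : Integrable (fun x => inner ℝ (f x • gradient χ x) v * η x) :=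
    (i2.inner_const v).mul_bdd (c := C) hη.continuous.aestronglyMeasurable
      (Eventually.of_forall hC)
  have j3 : Integrable (fun x => inner ℝ (χ x • G x) v * η x) :=
    (i1.inner_const v).mul_bdd (c := C) hη.continuous.aestronglyMeasurable
      (Eventually.of_forall hC)
  have e1 : ∫ x, f x * fderiv ℝ (fun x => χ x * η x) x v
      = (∫ x, χ x * f x * fderiv ℝ η x v) + ∫ x, inner ℝ (f x • gradient χ x) v * η x := by
    rw [← integral_add j1 j2]
    congr 1; funext x
    rw [hd, inner_smul_left, hg]
    simp only [RCLike.conj_to_real]; ring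
  have e2 : ∫ x, inner ℝ (G x) v * (χ x * η x) = ∫ x, inner ℝ (χ x • G x) v * η x := by
    congr 1; funext x
    rw [inner_smul_left]
    simp only [RCLike.conj_to_real]; ring
  have e3 : ∫ x, inner ℝ (χ x • G x + f x • gradient χ x) v * η x
      = (∫ x, inner ℝ (χ x • G x) v * η x) + ∫ x, inner ℝ (f x • gradient χ x) v * η x := by
    rw [← integral_add j3 j2]
    congr 1; funext x
    rw [inner_add_left, add_mul]
  rw [e1, e2] at e
  rw [e3]
  linarith

/-- A test function in `Ω`, extended by zero, is weakly differentiable on the whole space, with a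
gradient that vanishes off its support. -/
theorem IsTestFunction.exists_grad_univ {Ω : Set (E N)} (hΩ : IsOpen Ω) {p : ℝ}
    {f : E N → ℝ} (hf : IsTestFunction Ω p f) :
    ∃ G : E N → E N, StronglyMeasurable G ∧ Integrable G ∧ HasWeakGrad univ f G ∧
      MemLp G (ENNReal.ofReal p) volume ∧ G =ᵐ[volume.restrict Ω] weakGrad Ω f ∧
      ∀ x, x ∉ tsupport f → G x = 0 := by
  obtain ⟨χ, hχ, hχc, hχΩ, -, U, hU, hKU, hU1⟩ :=
    exists_cutoff hf.hasCompactSupport hΩ hf.tsupport_subset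
  obtain ⟨hi, hw⟩ := hf.hasWeakGrad.cutoff_mul hχ hχc hχΩ
  have e : (fun x => χ x * f x) = f := by
    funext x
    by_cases hx : x ∈ tsupport f
    · rw [hU1 x (hKU hx), one_mul]
    · rw [image_eq_zero_of_notMem_tsupport hx, mul_zero]
  rw [e] at hw
  set G₀ : E N → E N := fun x => χ x • weakGrad Ω f x + f x • gradient χ x
  set G := (tsupport f).indicator (hi.1.mk G₀) with hG
  have hoff := hw.ae_eq_zero_of_eqOn (U := (tsupport f)ᶜ) (isClosed_tsupport f).isOpen_compl
    (subset_univ _) (fun x hx => image_eq_zero_of_notMem_tsupport hx)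
  have hGG : G₀ =ᵐ[volume] G := by
    filter_upwards [hoff, hi.1.ae_eq_mk] with x hx hx'
    by_cases hxs : x ∈ tsupport f
    · rw [hG, indicator_of_mem hxs, ← hx']
    · rw [hG, indicator_of_notMem hxs, hx hxs]
  have hw' : HasWeakGrad univ f G := hw.congr_grad (by simpa using hGG)
  have hΩG : G =ᵐ[volume.restrict Ω] weakGrad Ω f :=
    (hw'.mono MeasurableSet.univ (subset_univ Ω)).ae_eq hΩ hf.hasWeakGrad
  refine ⟨G, hi.1.stronglyMeasurable_mk.indicator (isClosed_tsupport f).measurableSet,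
    hi.congr hGG, hw', ?_, hΩG, fun x hx => indicator_of_notMem hx _⟩
  have h1 : MemLp G (ENNReal.ofReal p) (volume.restrict Ω) :=
    (hf.memLp_weakGrad hΩ).ae_eq hΩG.symm
  have h2 : Ω.indicator G = G := by
    rw [indicator_eq_self]
    intro x hx
    by_contra hxΩ
    exact hx (indicator_of_notMem (fun h => hxΩ (hf.tsupport_subset h)) _)
  rw [← h2]
  exact (memLp_indicator_iff_restrict hΩ.measurableSet).2 h1

/-- Near a compact subset of `Ω`, a positive continuous weakly differentiable function on `Ω`
coincides with one on the whole space that is bounded and bounded away from zero. -/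
theorem HasWeakGrad.exists_positive_extension {Ω K : Set (E N)} (hΩ : IsOpen Ω) {u : E N → ℝ}
    {G : E N → E N} (h : HasWeakGrad Ω u G) (hu : ContinuousOn u Ω) (hpos : ∀ x ∈ Ω, 0 < u x)
    (hK : IsCompact K) (hKΩ : K ⊆ Ω) :
    ∃ (w : E N → ℝ) (H : E N → E N), UniformContinuous w ∧ (∃ c > 0, ∃ C, ∀ x, w x ∈ Icc c C) ∧
      StronglyMeasurable H ∧ Integrable H ∧ HasWeakGrad univ w H ∧
      ∃ U, IsOpen U ∧ K ⊆ U ∧ U ⊆ Ω ∧ (∀ x ∈ U, w x = u x) ∧ ∀ᵐ x, x ∈ U → H x = G x := by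
  obtain ⟨χ, hχ, hχc, hχΩ, hχ1, U, hU, hKU, hU1⟩ := exists_cutoff hK hΩ hKΩ
  have h1 : HasWeakGrad Ω (fun x => u x - 1) G := by
    have := h.add ((hasWeakGrad_const (-1)).mono MeasurableSet.univ (subset_univ Ω))
    rw [add_zero] at this
    exact this
  obtain ⟨hi, hw⟩ := h1.cutoff_mul hχ hχc hχΩ
  have h2 := hw.add (hasWeakGrad_const 1)
  -- `w = χ u + (1 - χ)` interpolates between `u` and the constant `1`
  set w : E N → ℝ := (fun x => χ x * (u x - 1)) + fun _ => 1 with hwdef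
  have hw1 : ∀ x, w x = χ x * (u x - 1) + 1 := fun x => by simp [hwdef]
  set H₀ := fun x => χ x • G x + (u x - 1) • gradient χ x
  have hk : Continuous fun x => χ x * (u x - 1) := by
    refine continuous_of_tsupport fun x hx => ?_
    have hxΩ : x ∈ Ω := hχΩ (closure_mono (fun y hy => left_ne_zero_of_mul hy) hx)
    exact hχ.continuous.continuousAt.mul
      ((hu.continuousAt (hΩ.mem_nhds hxΩ)).sub continuousAt_const)
  have hks : HasCompactSupport fun x => χ x * (u x - 1) := hχc.mul_right
  have hwu : UniformContinuous w := by
    have : w = fun x => χ x * (u x - 1) + 1 := funext hw1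
    rw [this]
    exact (hk.uniformContinuous_of_tendsto_cocompact hks.is_zero_at_infty).add
      uniformContinuous_const
  have hwpos : ∀ x, 0 < w x := by
    intro x
    rw [hw1]
    by_cases hx : x ∈ tsupport χ
    · have := hpos x (hχΩ hx)
      obtain ⟨h0, h1⟩ := hχ1 x
      rcases h0.eq_or_lt with h0 | h0
      · rw [← h0]; norm_num
      · nlinarith [mul_pos h0 this]
    · rw [image_eq_zero_of_notMem_tsupport hx]; norm_num
  have hoff : ∀ x, x ∉ tsupport χ → w x = 1 := fun x hx => by
    rw [hw1, image_eq_zero_of_notMem_tsupport hx]; norm_num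
  obtain ⟨C, hC⟩ := hχc.isCompact.exists_bound_of_continuousOn hwu.continuous.continuousOn
  obtain ⟨c, hc, hcl⟩ : ∃ c > 0, ∀ x ∈ tsupport χ, c ≤ w x := by
    rcases (tsupport χ).eq_empty_or_nonempty with he | hne
    · exact ⟨1, one_pos, fun x hx => by simp [he] at hx⟩
    · obtain ⟨x₀, -, hx₀⟩ := hχc.isCompact.exists_isMinOn hne hwu.continuous.continuousOn
      exact ⟨w x₀, hwpos x₀, fun x hx => hx₀ hx⟩
  have hw2 : HasWeakGrad univ w (hi.1.mk _) :=
    h2.congr_grad (by simpa using hi.1.ae_eq_mk)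
  have hUw : ∀ x ∈ U ∩ Ω, w x = u x := fun x hx => by rw [hw1, hU1 x hx.1]; ring
  refine ⟨w, hi.1.mk _, hwu, ⟨min c 1, lt_min hc one_pos, max C 1, fun x => ?_⟩,
    hi.1.stronglyMeasurable_mk, hi.congr hi.1.ae_eq_mk, hw2, U ∩ Ω, hU.inter hΩ,
    subset_inter hKU hKΩ, inter_subset_right, hUw, ?_⟩
  · by_cases hx : x ∈ tsupport χ
    · exact ⟨(min_le_left _ _).trans (hcl x hx),
        ((le_abs_self _).trans (hC x hx)).trans (le_max_left _ _)⟩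
    · rw [hoff x hx]
      exact ⟨min_le_right _ _, le_max_right _ _⟩
  · exact HasWeakGrad.ae_eq_of_eqOn (hU.inter hΩ) inter_subset_right
      (hw2.mono MeasurableSet.univ (subset_univ Ω)) h hUw

/-! ### Local Poincaré inequalities -/

theorem enorm_rpow_eq_ofReal {p : ℝ} (hp : 0 ≤ p) (a : ℝ) :
    ‖a‖ₑ ^ p = ENNReal.ofReal (|a| ^ p) := by
  rw [Real.enorm_eq_ofReal_abs, ENNReal.ofReal_rpow_of_nonneg (abs_nonneg _) hp]

/-- The double integral of `|f x - f y|^p` over a ball, by integration over the translations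
`v = x - y`. -/
theorem HasWeakGrad.lintegral_lintegral_sub_le {f : E N → ℝ} {G : E N → E N}
    (h : HasWeakGrad univ f G) (hG : StronglyMeasurable G) (hGi : Integrable G)
    (hf : Continuous f) {p : ℝ} (hp : 1 ≤ p) (c : E N) (r : ℝ) :
    ∫⁻ y in Metric.ball c r, ∫⁻ x in Metric.ball c r, ‖f x - f y‖ₑ ^ p
      ≤ volume (Metric.ball (0 : E N) (2 * r)) * ENNReal.ofReal (2 * r) ^ p
        * ∫⁻ x in Metric.ball c r, ‖G x‖ₑ ^ p := by
  set B := Metric.ball c r with hB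
  have hBm : MeasurableSet B := measurableSet_ball
  have e1 : ∀ y, ∫⁻ x in B, ‖f x - f y‖ₑ ^ p
      = ∫⁻ v, B.indicator (fun x => ‖f x - f y‖ₑ ^ p) (v + y) := fun y => by
    rw [lintegral_add_right_eq_self (B.indicator fun x => ‖f x - f y‖ₑ ^ p) y,
      lintegral_indicator hBm]
  have e2 : ∀ v, ∫⁻ y in B, B.indicator (fun x => ‖f x - f y‖ₑ ^ p) (v + y)
      = ∫⁻ y in B ∩ {y | v + y ∈ B}, ‖f (y + v) - f y‖ₑ ^ p := fun v => by
    have hm : MeasurableSet {y | v + y ∈ B} := hBm.preimage (measurable_const_add v)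
    rw [inter_comm, ← Measure.restrict_restrict hm, ← lintegral_indicator hm]
    refine lintegral_congr fun y => ?_
    by_cases hy : v + y ∈ B
    · rw [indicator_of_mem hy, indicator_of_mem (show y ∈ {y | v + y ∈ B} from hy), add_comm v y]
    · rw [indicator_of_notMem hy, indicator_of_notMem (show y ∉ {y | v + y ∈ B} from hy)]
  simp only [e1]
  rw [lintegral_lintegral_swap]
  swap
  · have hm : Measurable (fun z : E N × E N => ‖f (z.2 + z.1) - f z.1‖ₑ ^ p) := by
      have : Continuous fun z : E N × E N => f (z.2 + z.1) - f z.1 := by fun_prop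
      exact this.measurable.enorm.pow_const p
    have hs : MeasurableSet {z : E N × E N | z.2 + z.1 ∈ B} :=
      hBm.preimage (measurable_snd.add measurable_fst)
    exact (hm.indicator hs).aemeasurable
  simp only [e2]
  have e3 : ∀ v, ∫⁻ y in B ∩ {y | v + y ∈ B}, ‖f (y + v) - f y‖ₑ ^ p
      ≤ (Metric.ball (0 : E N) (2 * r)).indicator
        (fun _ => ENNReal.ofReal (2 * r) ^ p * ∫⁻ x in B, ‖G x‖ₑ ^ p) v := by
    intro v
    have hm : MeasurableSet {y | v + y ∈ B} := hBm.preimage (measurable_const_add v)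
    by_cases hv : v ∈ Metric.ball (0 : E N) (2 * r)
    · rw [indicator_of_mem hv]
      refine (h.lintegral_translate_sub_le hG hGi v hp (hBm.inter hm) hBm ?_).trans ?_
      · rintro x ⟨hx, hx'⟩ t ht0 ht1
        have := (convex_ball c r) hx hx' (sub_nonneg.2 ht1) ht0 (by ring)
        convert this using 1
        module
      · refine mul_le_mul' (ENNReal.rpow_le_rpow ?_ (by positivity)) le_rfl
        rw [← ofReal_norm]
        exact ENNReal.ofReal_le_ofReal (mem_ball_zero_iff.1 hv).le
    · rw [indicator_of_notMem hv]
      have : B ∩ {y | v + y ∈ B} = ∅ := by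
        rw [eq_empty_iff_forall_notMem]
        rintro y ⟨hy, hy'⟩
        refine hv (mem_ball_zero_iff.2 ?_)
        have h1 := Metric.mem_ball.1 hy
        have h2 := Metric.mem_ball.1 (show v + y ∈ Metric.ball c r from hy')
        calc ‖v‖ = dist (v + y) y := by simp [dist_eq_norm]
          _ ≤ dist (v + y) c + dist y c := dist_triangle_right _ _ _
          _ < 2 * r := by linarith
      rw [this]; simp
  refine (lintegral_mono e3).trans ?_
  rw [lintegral_indicator measurableSet_ball, setLIntegral_const, mul_comm, mul_assoc]

/-- A Poincaré inequality on a ball: the gradient on the ball and the function on a subset `S`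
control the function on the ball. -/
theorem HasWeakGrad.measure_mul_lintegral_ball_le {f : E N → ℝ} {G : E N → E N}
    (h : HasWeakGrad univ f G) (hG : StronglyMeasurable G) (hGi : Integrable G)
    (hf : Continuous f) {p : ℝ} (hp : 1 ≤ p) (c : E N) (r : ℝ) {S : Set (E N)}
    (hS : S ⊆ Metric.ball c r) :
    volume S * ∫⁻ x in Metric.ball c r, ‖f x‖ₑ ^ p
      ≤ 2 ^ (p - 1) * (volume (Metric.ball (0 : E N) (2 * r)) * ENNReal.ofReal (2 * r) ^ p
        * (∫⁻ x in Metric.ball c r, ‖G x‖ₑ ^ p)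
        + volume (Metric.ball c r) * ∫⁻ x in S, ‖f x‖ₑ ^ p) := by
  have hm : ∀ y, Measurable (fun x => ‖f x - f y‖ₑ ^ p) := fun y =>
    (hf.sub continuous_const).measurable.enorm.pow_const p
  calc volume S * ∫⁻ x in Metric.ball c r, ‖f x‖ₑ ^ p
      = ∫⁻ y in S, ∫⁻ x in Metric.ball c r, ‖f x‖ₑ ^ p := by rw [setLIntegral_const, mul_comm]
    _ ≤ ∫⁻ y in S, 2 ^ (p - 1) * ((∫⁻ x in Metric.ball c r, ‖f x - f y‖ₑ ^ p)
          + volume (Metric.ball c r) * ‖f y‖ₑ ^ p) := by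
        refine lintegral_mono fun y => ?_
        calc ∫⁻ x in Metric.ball c r, ‖f x‖ₑ ^ p
            ≤ ∫⁻ x in Metric.ball c r, 2 ^ (p - 1) * (‖f x - f y‖ₑ ^ p + ‖f y‖ₑ ^ p) := by
              refine lintegral_mono fun x => ?_
              refine le_trans (ENNReal.rpow_le_rpow ?_ (by positivity))
                (ENNReal.rpow_add_le_mul_rpow_add_rpow _ _ hp)
              calc ‖f x‖ₑ = ‖f x - f y + f y‖ₑ := by simp
                _ ≤ _ := enorm_add_le _ _
          _ = _ := by
              rw [lintegral_const_mul _ ((hm y).add_const _), lintegral_add_left (hm y),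
                setLIntegral_const, mul_comm (volume _)]
    _ = 2 ^ (p - 1) * ((∫⁻ y in S, ∫⁻ x in Metric.ball c r, ‖f x - f y‖ₑ ^ p)
          + volume (Metric.ball c r) * ∫⁻ x in S, ‖f x‖ₑ ^ p) := by
        have hmf : Measurable fun y => ‖f y‖ₑ ^ p := hf.measurable.enorm.pow_const p
        rw [lintegral_const_mul' _ _ (ENNReal.rpow_ne_top_of_nonneg (by linarith) (by simp)),
          lintegral_add_right _ (hmf.const_mul _), lintegral_const_mul _ hmf]
    _ ≤ _ := by
        refine mul_le_mul' le_rfl (add_le_add_left ((lintegral_mono_set hS).trans ?_) _)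
        exact h.lintegral_lintegral_sub_le hG hGi hf hp c r

section Admissible

variable {Ω : Set (E N)} {p : ℝ} {A : E N → Matrix (Fin N) (Fin N) ℝ} {V : E N → ℝ}

theorem energy_nonneg (φ : E N → ℝ) : 0 ≤ energy Ω p A (posPot V) φ :=
  integral_nonneg fun _ => add_nonneg (Real.rpow_nonneg (matNorm_nonneg _ _) _)
    (mul_nonneg (posPot_nonneg _ _) (Real.rpow_nonneg (abs_nonneg _) _))

theorem ofReal_energy (h : IsAdmissible Ω p A V) {φ : E N → ℝ} (hφ : IsTestFunction Ω p φ) :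
    ENNReal.ofReal (energy Ω p A (posPot V) φ) = ∫⁻ x in Ω,
      ENNReal.ofReal (matNorm (A x) (weakGrad Ω φ x) ^ p + posPot V x * |φ x| ^ p) :=
  ofReal_integral_eq_lintegral_ofReal (integrable_energy h hφ) (Eventually.of_forall fun _ =>
    add_nonneg (Real.rpow_nonneg (matNorm_nonneg _ _) _)
    (mul_nonneg (posPot_nonneg _ _) (Real.rpow_nonneg (abs_nonneg _) _)))

/-- By local ellipticity, the energy controls the gradient on compact sets. -/
theorem IsAdmissible.exists_lintegral_grad_le (h : IsAdmissible Ω p A V) {K : Set (E N)}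
    (hK : IsCompact K) (hKΩ : K ⊆ Ω) :
    ∃ C : ℝ, 0 < C ∧ ∀ φ, IsTestFunction Ω p φ → ∀ G : E N → E N,
      G =ᵐ[volume.restrict Ω] weakGrad Ω φ →
      ∫⁻ x in K, ‖G x‖ₑ ^ p
        ≤ ENNReal.ofReal C * ENNReal.ofReal (energy Ω p A (posPot V) φ) := by
  obtain ⟨c, hc, hell⟩ := h.locElliptic K hK hKΩ
  refine ⟨(Real.sqrt c)⁻¹ ^ p, by positivity, fun φ hφ G hG => ?_⟩
  rw [ofReal_energy h hφ]
  have hG' : G =ᵐ[volume.restrict K] weakGrad Ω φ :=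
    ae_mono (Measure.restrict_mono hKΩ le_rfl) hG
  calc ∫⁻ x in K, ‖G x‖ₑ ^ p
      ≤ ∫⁻ x in K, ENNReal.ofReal ((Real.sqrt c)⁻¹ ^ p) * ENNReal.ofReal
          (matNorm (A x) (weakGrad Ω φ x) ^ p + posPot V x * |φ x| ^ p) := by
        refine lintegral_mono_ae ?_
        filter_upwards [hell, hG'] with x hx hGx
        rw [hGx, ← ofReal_norm, ENNReal.ofReal_rpow_of_nonneg (norm_nonneg _) h.pos.le,
          ← ENNReal.ofReal_mul (by positivity)]
        refine ENNReal.ofReal_le_ofReal ?_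
        have h1 : ‖weakGrad Ω φ x‖ ≤ (Real.sqrt c)⁻¹ * matNorm (A x) (weakGrad Ω φ x) := by
          rw [inv_mul_eq_div, le_div_iff₀ (Real.sqrt_pos.2 hc)]
          refine Real.le_sqrt_of_sq_le ?_
          rw [mul_pow, Real.sq_sqrt hc.le, mul_comm]
          exact hx _
        calc ‖weakGrad Ω φ x‖ ^ p ≤ ((Real.sqrt c)⁻¹ * matNorm (A x) (weakGrad Ω φ x)) ^ p :=
              Real.rpow_le_rpow (norm_nonneg _) h1 h.pos.le
          _ = (Real.sqrt c)⁻¹ ^ p * matNorm (A x) (weakGrad Ω φ x) ^ p :=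
              Real.mul_rpow (by positivity) (matNorm_nonneg _ _)
          _ ≤ _ := by
              gcongr
              exact le_add_of_nonneg_right (mul_nonneg (posPot_nonneg _ _)
                (Real.rpow_nonneg (abs_nonneg _) _))
    _ = ENNReal.ofReal ((Real.sqrt c)⁻¹ ^ p) * ∫⁻ x in K, ENNReal.ofReal
          (matNorm (A x) (weakGrad Ω φ x) ^ p + posPot V x * |φ x| ^ p) :=
        lintegral_const_mul' _ _ ENNReal.ofReal_ne_top
    _ ≤ _ := by
        gcongr

theorem IsAdmissible.integrable_mul_rpow (h : IsAdmissible Ω p A V) {g : E N → ℝ}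
    (hg : LocallyIntegrableOn g Ω volume) {φ : E N → ℝ} (hφ : IsTestFunction Ω p φ) :
    Integrable (fun x => |g x| * |φ x| ^ p) (volume.restrict Ω) := by
  have hsupp : Function.support (fun x => |φ x| ^ p) ⊆ Function.support φ := by
    intro x hx h0
    simp [h0, Real.zero_rpow h.pos.ne'] at hx
  have := integrable_smul_of_tsupport (η := fun x => |φ x| ^ p) (H := fun x => |g x|) hg.norm
    (hφ.continuous.abs.rpow_const fun x => Or.inr h.pos.le)
    (hφ.hasCompactSupport.mono hsupp)
    ((closure_mono hsupp).trans hφ.tsupport_subset)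
  refine this.integrableOn.congr (Eventually.of_forall fun x => ?_)
  simp [mul_comm]

/-- The set `S` is controlled by the energy: `∫_S |φ|^p ≤ C Q(φ)` for all test functions `φ`. -/
def IsControlled (Ω : Set (E N)) (p : ℝ) (A : E N → Matrix (Fin N) (Fin N) ℝ) (V : E N → ℝ)
    (S : Set (E N)) : Prop :=
  ∃ C : ℝ, 0 < C ∧ ∀ φ, IsTestFunction Ω p φ →
    ∫⁻ x in S, ‖φ x‖ₑ ^ p ≤ ENNReal.ofReal C * ENNReal.ofReal (energy Ω p A (posPot V) φ)

theorem IsControlled.mono {S T : Set (E N)} (hT : IsControlled Ω p A V T) (hST : S ⊆ T) :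
    IsControlled Ω p A V S := by
  obtain ⟨C, hC, h⟩ := hT
  exact ⟨C, hC, fun φ hφ => (lintegral_mono_set hST).trans (h φ hφ)⟩

theorem IsControlled.union {S T : Set (E N)} (hS : IsControlled Ω p A V S)
    (hT : IsControlled Ω p A V T) : IsControlled Ω p A V (S ∪ T) := by
  obtain ⟨C, hC, h⟩ := hS
  obtain ⟨D, hD, h'⟩ := hT
  refine ⟨C + D, by positivity, fun φ hφ => (lintegral_union_le _ _ _).trans ?_⟩
  rw [ENNReal.ofReal_add hC.le hD.le, add_mul]
  exact add_le_add (h φ hφ) (h' φ hφ)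

/-- Control propagates from a subset of positive measure to a ball. -/
theorem IsControlled.ball (h : IsAdmissible Ω p A V) {S : Set (E N)} (hS : IsControlled Ω p A V S)
    {c : E N} {r : ℝ} (hSB : S ⊆ Metric.ball c r) (hS0 : volume S ≠ 0)
    (hB : Metric.closedBall c r ⊆ Ω) : IsControlled Ω p A V (Metric.ball c r) := by
  obtain ⟨C, hC, hCS⟩ := hS
  obtain ⟨D, hD, hDG⟩ := h.exists_lintegral_grad_le (isCompact_closedBall c r) hB
  have hfin : volume S ≠ ⊤ := ((measure_mono hSB).trans_lt measure_ball_lt_top).ne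
  set M : ℝ≥0∞ := (volume S)⁻¹ * (2 ^ (p - 1) * (volume (Metric.ball (0 : E N) (2 * r))
    * ENNReal.ofReal (2 * r) ^ p * ENNReal.ofReal D + volume (Metric.ball c r) * ENNReal.ofReal C))
    with hM
  have hMfin : M ≠ ⊤ := by
    have h2 : (2 : ℝ≥0∞) ^ (p - 1) ≠ ⊤ :=
      ENNReal.rpow_ne_top_of_nonneg (by linarith [h.one_lt]) (by simp)
    have h3 : ENNReal.ofReal (2 * r) ^ p ≠ ⊤ :=
      ENNReal.rpow_ne_top_of_nonneg h.pos.le ENNReal.ofReal_ne_top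
    refine ENNReal.mul_ne_top (ENNReal.inv_ne_top.2 hS0) (ENNReal.mul_ne_top h2
      (ENNReal.add_ne_top.2 ⟨ENNReal.mul_ne_top (ENNReal.mul_ne_top measure_ball_lt_top.ne h3)
        ENNReal.ofReal_ne_top, ENNReal.mul_ne_top measure_ball_lt_top.ne ENNReal.ofReal_ne_top⟩))
  -- the summand `1` makes the constant positive
  refine ⟨M.toReal + 1, by positivity, fun φ hφ => ?_⟩
  obtain ⟨G, hGm, hGi, hG, -, hGw, -⟩ := hφ.exists_grad_univ h.isOpen
  have key := hG.measure_mul_lintegral_ball_le hGm hGi hφ.continuous h.one_lt.le c r hSB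
  have h1 := (lintegral_mono_set Metric.ball_subset_closedBall).trans (hDG φ hφ G hGw)
  have h2 := hCS φ hφ
  set Q := ENNReal.ofReal (energy Ω p A (posPot V) φ)
  calc ∫⁻ x in Metric.ball c r, ‖φ x‖ₑ ^ p
      = (volume S)⁻¹ * (volume S * ∫⁻ x in Metric.ball c r, ‖φ x‖ₑ ^ p) := by
        rw [← mul_assoc, ENNReal.inv_mul_cancel hS0 hfin, one_mul]
    _ ≤ (volume S)⁻¹ * (2 ^ (p - 1) * (volume (Metric.ball (0 : E N) (2 * r))
        * ENNReal.ofReal (2 * r) ^ p * (ENNReal.ofReal D * Q)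
        + volume (Metric.ball c r) * (ENNReal.ofReal C * Q))) := by
        refine mul_le_mul' le_rfl (key.trans ?_)
        gcongr
    _ = M * Q := by rw [hM]; ring
    _ ≤ _ := by
        gcongr
        rw [ENNReal.ofReal_add ENNReal.toReal_nonneg zero_le_one, ENNReal.ofReal_toReal hMfin]
        exact le_self_add

/-- A nonzero Hardy-weight makes some set of positive measure controlled. -/
theorem IsSubcritical.exists_isControlled (h : IsAdmissible Ω p A V)
    (hsub : IsSubcritical Ω p A (posPot V)) :
    ∃ (x : E N) (r : ℝ) (S : Set (E N)), x ∈ Ω ∧ 0 < r ∧ Metric.closedBall x r ⊆ Ω ∧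
      S ⊆ Metric.ball x r ∧ volume S ≠ 0 ∧ IsControlled Ω p A V S := by
  obtain ⟨g, ⟨hgl, C, hC, hg⟩, hne⟩ := hsub
  have hgm := hgl.aestronglyMeasurable
  set g₁ := hgm.mk g with hg₁
  have hgg : g =ᵐ[volume.restrict Ω] g₁ := hgm.ae_eq_mk
  have hg₁m : Measurable g₁ := hgm.stronglyMeasurable_mk.measurable
  have hne0 : volume {x | x ∈ Ω ∧ g₁ x ≠ 0} ≠ 0 := by
    intro h0
    refine hne (hgg.trans ?_)
    rw [EventuallyEq, ae_restrict_iff' h.isOpen.measurableSet, ae_iff]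
    simpa using h0
  -- near some point the weight is nonzero on a set of positive measure, and then also bounded below
  -- by some `1 / (n + 1)` on such a set
  obtain ⟨x, ⟨hxΩ, -⟩, hx⟩ : ∃ x ∈ {x | x ∈ Ω ∧ g₁ x ≠ 0},
      ∀ U ∈ 𝓝[{x | x ∈ Ω ∧ g₁ x ≠ 0}] x, volume U ≠ 0 := by
    by_contra! hcon
    exact hne0 (measure_null_of_locally_null _ hcon)
  obtain ⟨r, hr, hrΩ⟩ := Metric.nhds_basis_closedBall.mem_iff.1 (h.isOpen.mem_nhds hxΩ)
  have hpos := hx _ (inter_mem_nhdsWithin _ (Metric.ball_mem_nhds x hr))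
  obtain ⟨n, hn⟩ : ∃ n : ℕ, volume (Metric.ball x r ∩ {y | 1 / ((n : ℝ) + 1) ≤ |g₁ y|}) ≠ 0 := by
    by_contra! hcon
    refine hpos (measure_mono_null ?_ (measure_iUnion_null hcon))
    rintro y ⟨⟨-, hy⟩, hyB⟩
    obtain ⟨n, hn⟩ := exists_nat_one_div_lt (abs_pos.2 hy)
    exact mem_iUnion.2 ⟨n, hyB, hn.le⟩
  refine ⟨x, r, _, hxΩ, hr, hrΩ, inter_subset_left, hn, ((n : ℝ) + 1) * C, by positivity, ?_⟩
  intro φ hφ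
  set S := Metric.ball x r ∩ {y | 1 / ((n : ℝ) + 1) ≤ |g₁ y|} with hS
  have hSm : MeasurableSet S :=
    measurableSet_ball.inter (measurableSet_le measurable_const hg₁m.norm)
  have hSΩ : S ⊆ Ω := inter_subset_left.trans (Metric.ball_subset_closedBall.trans hrΩ)
  have hi := h.integrable_mul_rpow hgl hφ
  calc ∫⁻ y in S, ‖φ y‖ₑ ^ p
      ≤ ∫⁻ y in S, ENNReal.ofReal ((n : ℝ) + 1) * ENNReal.ofReal (|g y| * |φ y| ^ p) := by
        refine lintegral_mono_ae ?_
        filter_upwards [ae_restrict_mem hSm, ae_mono (Measure.restrict_mono hSΩ le_rfl) hgg]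
          with y hy hgy
        rw [enorm_rpow_eq_ofReal h.pos.le, ← ENNReal.ofReal_mul (by positivity)]
        refine ENNReal.ofReal_le_ofReal ?_
        rw [← mul_assoc]
        refine le_mul_of_one_le_left (Real.rpow_nonneg (abs_nonneg _) _) ?_
        have h1 : 1 / ((n : ℝ) + 1) ≤ |g₁ y| := hy.2
        rw [div_le_iff₀ (by positivity)] at h1
        rw [hgy]; linarith
    _ ≤ ∫⁻ y in Ω, ENNReal.ofReal ((n : ℝ) + 1) * ENNReal.ofReal (|g y| * |φ y| ^ p) :=
        lintegral_mono_set hSΩ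
    _ = ENNReal.ofReal ((n : ℝ) + 1) * ENNReal.ofReal (∫ y in Ω, |g y| * |φ y| ^ p) := by
        rw [lintegral_const_mul' _ _ ENNReal.ofReal_ne_top, ofReal_integral_eq_lintegral_ofReal hi]
        exact Eventually.of_forall fun y => by positivity
    _ ≤ ENNReal.ofReal ((n : ℝ) + 1) * ENNReal.ofReal (C * energy Ω p A (posPot V) φ) := by
        gcongr
        exact hg φ hφ
    _ = _ := by rw [ENNReal.ofReal_mul hC.le, ENNReal.ofReal_mul (by positivity), mul_assoc]

/-- In the subcritical case, the energy controls the `L^p` norm on compact subsets of `Ω`: control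
spreads through the connected set `Ω` by the Poincaré inequality. -/
theorem IsSubcritical.isControlled (h : IsAdmissible Ω p A V)
    (hsub : IsSubcritical Ω p A (posPot V)) {K : Set (E N)} (hK : IsCompact K) (hKΩ : K ⊆ Ω) :
    IsControlled Ω p A V K := by
  -- the set of points with a controlled neighbourhood is open and closed in `Ω`
  set U : Set (E N) := {x | x ∈ Ω ∧ ∃ r > 0, IsControlled Ω p A V (Metric.ball x r)} with hU
  have hUo : IsOpen U := by
    rw [Metric.isOpen_iff]
    rintro x ⟨hx, r, hr, hc⟩
    obtain ⟨s, hs, hsΩ⟩ := Metric.isOpen_iff.1 h.isOpen x hx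
    refine ⟨min r s, lt_min hr hs, fun y hy => ⟨hsΩ (Metric.ball_subset_ball (min_le_right _ _) hy),
      r - dist y x, sub_pos.2 ((Metric.mem_ball.1 hy).trans_le (min_le_left _ _)), ?_⟩⟩
    exact hc.mono (Metric.ball_subset_ball' (by linarith))
  have hΩU : Ω ⊆ U := by
    refine h.isConnected.isPreconnected.subset_of_closure_inter_subset hUo ?_ ?_
    · obtain ⟨x, r, S, hx, hr, hrΩ, hSB, hS0, hS⟩ := hsub.exists_isControlled h
      exact ⟨x, hx, hx, r, hr, hS.ball h hSB hS0 hrΩ⟩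
    · rintro x ⟨hx, hxΩ⟩
      obtain ⟨r, hr, hrΩ⟩ := Metric.nhds_basis_closedBall.mem_iff.1 (h.isOpen.mem_nhds hxΩ)
      obtain ⟨y, ⟨-, s, hs, hc⟩, hy⟩ := Metric.mem_closure_iff.1 hx r hr
      refine ⟨hxΩ, r, hr, (hc.mono inter_subset_right).ball h
        (S := Metric.ball x r ∩ Metric.ball y s) inter_subset_left ?_ hrΩ⟩
      exact ((Metric.isOpen_ball.inter Metric.isOpen_ball).measure_pos volume
        ⟨y, by rwa [Metric.mem_ball, dist_comm], Metric.mem_ball_self hs⟩).ne'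
  refine hK.induction_on (p := IsControlled Ω p A V) ?_ (fun S T hST hT => hT.mono hST)
    (fun S T hS hT => hS.union hT) ?_
  · exact ⟨1, one_pos, fun φ _ => by simp⟩
  · intro x hx
    obtain ⟨-, r, hr, hc⟩ := hΩU (hKΩ hx)
    exact ⟨_, mem_nhdsWithin_of_mem_nhds (Metric.ball_mem_nhds x hr), hc⟩

end Admissible

/-! ### Representation of the Beppo-Levi space by functions -/

theorem exists_compact_exhaustion {Ω : Set (E N)} (hΩ : IsOpen Ω) :
    ∃ K : ℕ → Set (E N), (∀ n, IsCompact (K n)) ∧ (∀ n, K n ⊆ Ω) ∧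
      ∀ L, IsCompact L → L ⊆ Ω → ∃ n, L ⊆ K n := by
  have hl : LocallyCompactSpace Ω := hΩ.locallyCompactSpace
  let c := CompactExhaustion.choice Ω
  refine ⟨fun n => Subtype.val '' c n, fun n => (c.isCompact n).image continuous_subtype_val,
    fun n => by rintro _ ⟨y, -, rfl⟩; exact y.2, fun L hL hLΩ => ?_⟩
  obtain ⟨n, hn⟩ := c.exists_superset_of_isCompact
    (Topology.IsInducing.subtypeVal.isCompact_preimage' hL (by simpa using hLΩ))
  exact ⟨n, fun x hx => ⟨⟨x, hLΩ hx⟩, hn hx, rfl⟩⟩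

section Admissible

variable {Ω : Set (E N)} {p : ℝ} {A : E N → Matrix (Fin N) (Fin N) ℝ} {V : E N → ℝ}

/-- A measure whose `L^p` norm is dominated by the Beppo-Levi norm, and which dominates Lebesgue
measure on every compact subset of `Ω` up to a constant. The Beppo-Levi space is realized inside
`L^p` of such a measure. -/
structure IsEnergyMeasure (Ω : Set (E N)) (p : ℝ) (A : E N → Matrix (Fin N) (Fin N) ℝ)
    (V : E N → ℝ) (μ : Measure (E N)) : Prop where
  lintegral_le : ∀ φ, IsTestFunction Ω p φ →
    ∫⁻ x, ‖φ x‖ₑ ^ p ∂μ ≤ ENNReal.ofReal (energy Ω p A (posPot V) φ)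
  restrict_le : ∀ K : Set (E N), IsCompact K → K ⊆ Ω →
    ∃ C : ℝ≥0∞, C ≠ 0 ∧ C ≠ ⊤ ∧ volume.restrict K ≤ C • μ

/-- Such a measure is a weighted sum of the restrictions of Lebesgue measure to an exhaustion of `Ω`
by compact sets. -/
theorem IsSubcritical.exists_isEnergyMeasure (h : IsAdmissible Ω p A V)
    (hsub : IsSubcritical Ω p A (posPot V)) : ∃ μ, IsEnergyMeasure Ω p A V μ := by
  obtain ⟨K, hK, hKΩ, hKex⟩ := exists_compact_exhaustion h.isOpen
  choose C hC hCK using fun n => hsub.isControlled h (hK n) (hKΩ n)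
  set a : ℕ → ℝ≥0∞ := fun n => (ENNReal.ofReal (C n))⁻¹ * 2⁻¹ ^ (n + 1) with ha
  have hC0 : ∀ n, ENNReal.ofReal (C n) ≠ 0 := fun n => by simpa using hC n
  have ha0 : ∀ n, a n ≠ 0 := fun n =>
    mul_ne_zero (ENNReal.inv_ne_zero.2 ENNReal.ofReal_ne_top) (pow_ne_zero _ (by simp))
  have hat : ∀ n, a n ≠ ⊤ := fun n =>
    ENNReal.mul_ne_top (ENNReal.inv_ne_top.2 (hC0 n)) (ENNReal.pow_ne_top (by simp))
  refine ⟨Measure.sum fun n => a n • volume.restrict (K n), fun φ hφ => ?_, fun L hL hLΩ => ?_⟩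
  · rw [lintegral_sum_measure]
    set Q := ENNReal.ofReal (energy Ω p A (posPot V) φ)
    calc ∑' n, ∫⁻ x, ‖φ x‖ₑ ^ p ∂(a n • volume.restrict (K n))
        ≤ ∑' n : ℕ, 2⁻¹ ^ (n + 1) * Q := by
          refine ENNReal.tsum_le_tsum fun n => ?_
          rw [lintegral_smul_measure, smul_eq_mul]
          calc a n * ∫⁻ x in K n, ‖φ x‖ₑ ^ p ≤ a n * (ENNReal.ofReal (C n) * Q) := by
                gcongr; exact hCK n φ hφ
            _ = ((ENNReal.ofReal (C n))⁻¹ * ENNReal.ofReal (C n)) * (2⁻¹ ^ (n + 1) * Q) := by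
                rw [ha]; ring
            _ = _ := by rw [ENNReal.inv_mul_cancel (hC0 n) ENNReal.ofReal_ne_top, one_mul]
      _ = Q := by
          rw [ENNReal.tsum_mul_right, ENNReal.tsum_geometric_add_one, ENNReal.one_sub_inv_two,
            inv_inv, ENNReal.inv_mul_cancel (by simp) (by simp), one_mul]
  · obtain ⟨n, hn⟩ := hKex L hL hLΩ
    refine ⟨(a n)⁻¹, ENNReal.inv_ne_zero.2 (hat n), ENNReal.inv_ne_top.2 (ha0 n), ?_⟩
    calc volume.restrict L ≤ volume.restrict (K n) := Measure.restrict_mono hn le_rfl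
      _ = (a n)⁻¹ • a n • volume.restrict (K n) := by
          rw [smul_smul, ENNReal.inv_mul_cancel (ha0 n) (hat n), one_smul]
      _ ≤ _ := by
          refine Measure.le_iff.2 fun s hs => ?_
          simp only [Measure.smul_apply, smul_eq_mul]
          refine mul_le_mul' le_rfl ?_
          exact Measure.le_sum (fun n => a n • volume.restrict (K n)) n s

theorem ae_restrict_of_forall_compact (hΩ : IsOpen Ω) {P : E N → Prop}
    (hP : ∀ K : Set (E N), IsCompact K → K ⊆ Ω → ∀ᵐ x ∂(volume.restrict K), P x) :
    ∀ᵐ x ∂(volume.restrict Ω), P x := by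
  obtain ⟨K, hK, hKΩ, hKex⟩ := exists_compact_exhaustion hΩ
  have hU : Ω = ⋃ n, K n := by
    refine subset_antisymm (fun x hx => ?_) (iUnion_subset hKΩ)
    obtain ⟨n, hn⟩ := hKex {x} isCompact_singleton (singleton_subset_iff.2 hx)
    exact mem_iUnion.2 ⟨n, hn rfl⟩
  rw [hU, ae_restrict_iUnion_iff]
  exact fun n => hP _ (hK n) (hKΩ n)

theorem IsEnergyMeasure.ae_of_ae {μ : Measure (E N)} (hμ : IsEnergyMeasure Ω p A V μ)
    (hΩ : IsOpen Ω) {P : E N → Prop} (hP : ∀ᵐ x ∂μ, P x) : ∀ᵐ x ∂(volume.restrict Ω), P x :=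
  ae_restrict_of_forall_compact hΩ fun K hK hKΩ => by
    obtain ⟨C, -, -, hC⟩ := hμ.restrict_le K hK hKΩ
    exact ae_mono hC (Measure.ae_smul_measure hP C)

theorem IsEnergyMeasure.eLpNorm_restrict_tendsto {μ : Measure (E N)}
    (hμ : IsEnergyMeasure Ω p A V μ) {K : Set (E N)} (hK : IsCompact K) (hKΩ : K ⊆ Ω)
    {f : ℕ → E N → ℝ} {q : ℝ≥0∞} (hf : Tendsto (fun n => eLpNorm (f n) q μ) atTop (𝓝 0)) :
    Tendsto (fun n => eLpNorm (f n) q (volume.restrict K)) atTop (𝓝 0) := by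
  obtain ⟨C, hC0, hCt, hC⟩ := hμ.restrict_le K hK hKΩ
  refine tendsto_of_tendsto_of_tendsto_of_le_of_le tendsto_const_nhds (h := fun n =>
    C ^ (1 / q).toReal * eLpNorm (f n) q μ) ?_ (fun n => zero_le) (fun n => ?_)
  · have := ENNReal.Tendsto.const_mul (a := C ^ (1 / q).toReal) hf
      (Or.inr (ENNReal.rpow_ne_top_of_nonneg ENNReal.toReal_nonneg hCt))
    simpa using this
  · refine (eLpNorm_mono_measure _ hC).trans ?_
    rw [eLpNorm_smul_measure_of_ne_zero hC0, smul_eq_mul]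

theorem IsAdmissible.fact_one_le (h : IsAdmissible Ω p A V) : Fact (1 ≤ ENNReal.ofReal p) :=
  ⟨by simpa using h.one_lt.le⟩

theorem eLpNorm_ofReal_rpow (hp : 0 < p) (f : E N → ℝ) (μ : Measure (E N)) :
    eLpNorm f (ENNReal.ofReal p) μ ^ p = ∫⁻ x, ‖f x‖ₑ ^ p ∂μ := by
  rw [eLpNorm_eq_lintegral_rpow_enorm_toReal (by simpa using hp) (by simp),
    ENNReal.toReal_ofReal hp.le, ← ENNReal.rpow_mul, one_div_mul_cancel hp.ne', ENNReal.rpow_one]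

theorem EnergySpace.enorm_rpow {h : IsAdmissible Ω p A V} (φ : EnergySpace h) :
    ‖φ‖ₑ ^ p = ENNReal.ofReal (energy Ω p A (posPot V) φ.fn) := by
  rw [← ofReal_norm, EnergySpace.norm_def, beppoLeviNorm,
    ENNReal.ofReal_rpow_of_nonneg (Real.rpow_nonneg (energy_nonneg _) _) h.pos.le,
    ← Real.rpow_mul (energy_nonneg _), one_div_mul_cancel h.pos.ne', Real.rpow_one]

theorem IsEnergyMeasure.eLpNorm_le {μ : Measure (E N)} (hμ : IsEnergyMeasure Ω p A V μ)
    {h : IsAdmissible Ω p A V} (φ : EnergySpace h) :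
    eLpNorm φ.fn (ENNReal.ofReal p) μ ≤ ‖φ‖ₑ := by
  have h1 := hμ.lintegral_le φ.fn φ.isTestFunction
  rw [← eLpNorm_ofReal_rpow h.pos, ← φ.enorm_rpow] at h1
  exact (ENNReal.rpow_le_rpow_iff h.pos).1 h1

theorem IsEnergyMeasure.memLp {μ : Measure (E N)} (hμ : IsEnergyMeasure Ω p A V μ)
    {h : IsAdmissible Ω p A V} (φ : EnergySpace h) : MemLp φ.fn (ENNReal.ofReal p) μ :=
  ⟨φ.isTestFunction.continuous.aestronglyMeasurable, (hμ.eLpNorm_le φ).trans_lt enorm_lt_top⟩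

theorem BeppoLevi.exists_seq {h : IsAdmissible Ω p A V} (x : BeppoLevi h) :
    ∃ φ : ℕ → EnergySpace h, Tendsto (fun n => (φ n : BeppoLevi h)) atTop (𝓝 x) := by
  obtain ⟨y, hy, hyx⟩ := mem_closure_iff_seq_limit.1
    (UniformSpace.Completion.denseRange_coe (α := EnergySpace h) x)
  choose φ hφ using hy
  exact ⟨φ, by simpa only [hφ] using hyx⟩

/-- The continuous inclusion of the Beppo-Levi space into `L^p` of an energy measure. -/
theorem IsEnergyMeasure.exists_inclusion {μ : Measure (E N)} (hμ : IsEnergyMeasure Ω p A V μ)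
    (h : IsAdmissible Ω p A V) [Fact (1 ≤ ENNReal.ofReal p)] :
    ∃ ι : BeppoLevi h →L[ℝ] Lp ℝ (ENNReal.ofReal p) μ,
      ∀ φ : EnergySpace h, ι φ = (hμ.memLp φ).toLp φ.fn := by
  let f : EnergySpace h →ₗ[ℝ] Lp ℝ (ENNReal.ofReal p) μ :=
    { toFun := fun φ => (hμ.memLp φ).toLp φ.fn
      map_add' := fun φ ψ => MemLp.toLp_add (hμ.memLp φ) (hμ.memLp ψ)
      map_smul' := fun c φ => MemLp.toLp_const_smul c (hμ.memLp φ) }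
  refine ⟨f.extendOfNorm (UniformSpace.Completion.toComplL (𝕜 := ℝ)
    (E := EnergySpace h)).toLinearMap, fun φ => ?_⟩
  refine LinearMap.extendOfNorm_eq (f := f) UniformSpace.Completion.denseRange_coe
    ⟨1, fun ψ => ?_⟩ φ
  change ‖(hμ.memLp ψ).toLp ψ.fn‖ ≤ 1 * ‖(ψ : BeppoLevi h)‖
  rw [one_mul, UniformSpace.Completion.norm_coe, Lp.norm_toLp, ← toReal_enorm]
  exact ENNReal.toReal_mono enorm_ne_top (hμ.eLpNorm_le ψ)

theorem IsEnergyMeasure.tendsto_eLpNorm {μ : Measure (E N)} (hμ : IsEnergyMeasure Ω p A V μ)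
    {h : IsAdmissible Ω p A V} [Fact (1 ≤ ENNReal.ofReal p)]
    {ι : BeppoLevi h →L[ℝ] Lp ℝ (ENNReal.ofReal p) μ}
    (hι : ∀ φ : EnergySpace h, ι φ = (hμ.memLp φ).toLp φ.fn) {φ : ℕ → EnergySpace h}
    {x : BeppoLevi h} (hφ : Tendsto (fun n => (φ n : BeppoLevi h)) atTop (𝓝 x)) :
    Tendsto (fun n => eLpNorm ((φ n).fn - ⇑(ι x)) (ENNReal.ofReal p) μ) atTop (𝓝 0) := by
  have h1 := (ι.continuous.tendsto x).comp hφ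
  have h2 := (Lp.tendsto_Lp_iff_tendsto_eLpNorm' _ _).1 h1
  refine h2.congr fun n => eLpNorm_congr_ae ?_
  simp only [Function.comp, hι]
  exact (hμ.memLp (φ n)).coeFn_toLp.sub EventuallyEq.rfl

/-- The inclusion into `L^p` of an energy measure yields the unique representing function. -/
theorem IsEnergyMeasure.represents {μ : Measure (E N)} (hμ : IsEnergyMeasure Ω p A V μ)
    {h : IsAdmissible Ω p A V} [Fact (1 ≤ ENNReal.ofReal p)]
    {ι : BeppoLevi h →L[ℝ] Lp ℝ (ENNReal.ofReal p) μ}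
    (hι : ∀ φ : EnergySpace h, ι φ = (hμ.memLp φ).toLp φ.fn) (x : BeppoLevi h) :
    Represents x ⇑(ι x) ∧ ∀ f, Represents x f → f =ᵐ[volume.restrict Ω] ⇑(ι x) := by
  constructor
  · obtain ⟨φ, hφ⟩ := x.exists_seq
    exact ⟨(Lp.stronglyMeasurable _).aestronglyMeasurable, φ, hφ, fun K hK hKΩ =>
      hμ.eLpNorm_restrict_tendsto hK hKΩ (hμ.tendsto_eLpNorm hι hφ)⟩
  · rintro f ⟨hf, φ, hφ, hφf⟩
    refine ae_restrict_of_forall_compact h.isOpen fun K hK hKΩ => ?_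
    have h1 := hμ.eLpNorm_restrict_tendsto hK hKΩ (hμ.tendsto_eLpNorm hι hφ)
    have h2 := hφf K hK hKΩ
    have hfK : AEStronglyMeasurable f (volume.restrict K) :=
      hf.mono_measure (Measure.restrict_mono hKΩ le_rfl)
    have hp0 : ENNReal.ofReal p ≠ 0 := by simpa using h.pos
    have m1 := tendstoInMeasure_of_tendsto_eLpNorm hp0
      (fun n => (φ n).isTestFunction.continuous.aestronglyMeasurable)
      (Lp.stronglyMeasurable _).aestronglyMeasurable h1
    have m2 := tendstoInMeasure_of_tendsto_eLpNorm hp0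
      (fun n => (φ n).isTestFunction.continuous.aestronglyMeasurable) hfK h2
    exact tendstoInMeasure_ae_unique m2 m1

theorem BeppoLevi.fn_spec (h : IsAdmissible Ω p A V) (hsub : IsSubcritical Ω p A (posPot V))
    (x : BeppoLevi h) : Represents x (BeppoLevi.fn x) ∧
      ∀ f, Represents x f → f =ᵐ[volume.restrict Ω] BeppoLevi.fn x := by
  obtain ⟨μ, hμ⟩ := hsub.exists_isEnergyMeasure h
  have := h.fact_one_le
  obtain ⟨ι, hι⟩ := hμ.exists_inclusion h
  obtain ⟨h1, h2⟩ := hμ.represents hι x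
  have hx : ∃ f, Represents x f := ⟨_, h1⟩
  have h3 : Represents x (BeppoLevi.fn x) := by
    unfold BeppoLevi.fn
    rw [dif_pos hx]
    exact hx.choose_spec
  exact ⟨h3, fun f hf => (h2 f hf).trans (h2 _ h3).symm⟩

theorem BeppoLevi.fn_sub (h : IsAdmissible Ω p A V) (hsub : IsSubcritical Ω p A (posPot V))
    (x y : BeppoLevi h) : BeppoLevi.fn (x - y) =ᵐ[volume.restrict Ω]
      BeppoLevi.fn x - BeppoLevi.fn y := by
  obtain ⟨μ, hμ⟩ := hsub.exists_isEnergyMeasure h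
  have := h.fact_one_le
  obtain ⟨ι, hι⟩ := hμ.exists_inclusion h
  have key : ∀ z : BeppoLevi h, BeppoLevi.fn z =ᵐ[volume.restrict Ω] ⇑(ι z) := fun z =>
    (hμ.represents hι z).2 _ (BeppoLevi.fn_spec h hsub z).1
  have h1 : ⇑(ι (x - y)) =ᵐ[volume.restrict Ω] ⇑(ι x) - ⇑(ι y) := by
    rw [map_sub]
    exact hμ.ae_of_ae h.isOpen (Lp.coeFn_sub (ι x) (ι y))
  exact (key _).trans (h1.trans ((key x).symm.sub (key y).symm))

theorem BeppoLevi.fn_coe (h : IsAdmissible Ω p A V) (hsub : IsSubcritical Ω p A (posPot V))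
    (φ : EnergySpace h) : BeppoLevi.fn (φ : BeppoLevi h) =ᵐ[volume.restrict Ω] φ.fn :=
  ((BeppoLevi.fn_spec h hsub φ).2 _ ⟨φ.isTestFunction.continuous.aestronglyMeasurable,
    fun _ => φ, tendsto_const_nhds, fun K _ _ => by simp⟩).symm

/-- A weighted `L^p` inequality for test functions extends to the Beppo-Levi space, by Fatou's
lemma. -/
theorem BeppoLevi.lintegral_le (h : IsAdmissible Ω p A V) (hsub : IsSubcritical Ω p A (posPot V))
    {w : E N → ℝ} (hw : AEStronglyMeasurable w (volume.restrict Ω)) {C : ℝ≥0∞} (hCt : C ≠ ⊤)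
    (hC : ∀ φ, IsTestFunction Ω p φ →
      ∫⁻ y in Ω, ‖w y‖ₑ * ‖φ y‖ₑ ^ p ≤ C * ENNReal.ofReal (energy Ω p A (posPot V) φ))
    (x : BeppoLevi h) : ∫⁻ y in Ω, ‖w y‖ₑ * ‖BeppoLevi.fn x y‖ₑ ^ p ≤ C * ‖x‖ₑ ^ p := by
  obtain ⟨μ, hμ⟩ := hsub.exists_isEnergyMeasure h
  have := h.fact_one_le
  obtain ⟨ι, hι⟩ := hμ.exists_inclusion h
  obtain ⟨φ, hφ⟩ := x.exists_seq
  have hp0 : ENNReal.ofReal p ≠ 0 := by simpa using h.pos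
  have hm := tendstoInMeasure_of_tendsto_eLpNorm hp0
    (fun n => (φ n).isTestFunction.continuous.aestronglyMeasurable)
    (Lp.stronglyMeasurable (ι x)).aestronglyMeasurable (hμ.tendsto_eLpNorm hι hφ)
  obtain ⟨ns, hns, hae⟩ := hm.exists_seq_tendsto_ae
  have hle : ∀ᵐ y ∂(volume.restrict Ω), ‖w y‖ₑ * ‖BeppoLevi.fn x y‖ₑ ^ p
      ≤ liminf (fun i => ‖w y‖ₑ * ‖(φ (ns i)).fn y‖ₑ ^ p) atTop := by
    filter_upwards [hμ.ae_of_ae h.isOpen hae,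
      (hμ.represents hι x).2 _ (BeppoLevi.fn_spec h hsub x).1] with y hy hy'
    rw [hy']
    refine (Tendsto.liminf_eq ?_).ge
    refine ENNReal.Tendsto.const_mul ?_ (Or.inr enorm_ne_top)
    exact ((ENNReal.continuous_rpow_const (y := p)).tendsto _).comp
      ((continuous_enorm.tendsto _).comp hy)
  refine (lintegral_mono_ae hle).trans ?_
  refine (lintegral_liminf_le' fun i => hw.enorm.mul
    ((φ (ns i)).isTestFunction.continuous.measurable.enorm.pow_const p).aemeasurable).trans ?_
  have hlim : Tendsto (fun i => C * ‖φ (ns i)‖ₑ ^ p) atTop (𝓝 (C * ‖x‖ₑ ^ p)) := by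
    refine ENNReal.Tendsto.const_mul ?_ (Or.inr hCt)
    refine ((ENNReal.continuous_rpow_const (y := p)).tendsto _).comp ?_
    have := (continuous_enorm.tendsto x).comp (hφ.comp hns.tendsto_atTop)
    refine this.congr fun i => ?_
    simp only [Function.comp, ← ofReal_norm, UniformSpace.Completion.norm_coe]
  rw [← hlim.liminf_eq]
  refine liminf_le_liminf (Eventually.of_forall fun i => ?_)
  have := hC _ (φ (ns i)).isTestFunction
  rwa [← EnergySpace.enorm_rpow] at this

end Admissible

/-! ### Compactness of the inclusion into `L^p` on compact sets -/

theorem integrableOn_ball_translate {f : E N → ℝ} (hf : Continuous f) (x : E N) (r : ℝ) :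
    IntegrableOn (fun v => f (x + v)) (Metric.ball (0 : E N) r) volume :=
  ((hf.comp (continuous_const_add x)).locallyIntegrable.integrableOn_isCompact
    (isCompact_closedBall 0 r)).mono_set Metric.ball_subset_closedBall

/-- The normalized Lebesgue measure on a ball, in the form in which averages are defined. -/
theorem isProbabilityMeasure_ball (r : ℝ) (hr : 0 < r) : IsProbabilityMeasure
    ((volume.restrict (Metric.ball (0 : E N) r) univ)⁻¹ •
      volume.restrict (Metric.ball (0 : E N) r)) := by
  refine ⟨?_⟩
  rw [Measure.smul_apply, smul_eq_mul, Measure.restrict_apply_univ]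
  exact ENNReal.inv_mul_cancel (Metric.measure_ball_pos _ _ hr).ne' measure_ball_lt_top.ne

/-- The `L^p` distance between a weakly differentiable function and its averages over balls of
radius `r` is at most `r` times the norm of the gradient. -/
theorem HasWeakGrad.lintegral_sub_average_le {f : E N → ℝ} {G : E N → E N}
    (h : HasWeakGrad univ f G) (hG : StronglyMeasurable G) (hGi : Integrable G)
    (hf : Continuous f) {p : ℝ} (hp : 1 ≤ p) {K L : Set (E N)} (hK : MeasurableSet K)
    (hL : MeasurableSet L) {r : ℝ} (hr : 0 < r) (hKL : ∀ x ∈ K, Metric.ball x r ⊆ L) :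
    ∫⁻ x in K, ‖f x - ⨍ v in Metric.ball (0 : E N) r, f (x + v)‖ₑ ^ p
      ≤ ENNReal.ofReal r ^ p * ∫⁻ x in L, ‖G x‖ₑ ^ p := by
  have hν := isProbabilityMeasure_ball (N := N) r hr
  set ν := (volume.restrict (Metric.ball (0 : E N) r) univ)⁻¹ •
      volume.restrict (Metric.ball (0 : E N) r) with hνdef
  have hball : ∀ᵐ v ∂ν, v ∈ Metric.ball (0 : E N) r :=
    Measure.ae_smul_measure (ae_restrict_mem measurableSet_ball) _
  have hpt : ∀ x, ‖f x - ⨍ v in Metric.ball (0 : E N) r, f (x + v)‖ₑ ^ p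
      ≤ ∫⁻ v, ‖f (x + v) - f x‖ₑ ^ p ∂ν := by
    intro x
    have hi : Integrable (fun v => f (x + v)) ν :=
      (integrableOn_ball_translate hf x r).smul_measure (ENNReal.inv_ne_top.2 (by
        rw [Measure.restrict_apply_univ]; exact (Metric.measure_ball_pos _ _ hr).ne'))
    have e1 : f x - ⨍ v in Metric.ball (0 : E N) r, f (x + v) = ∫ v, (f x - f (x + v)) ∂ν := by
      rw [integral_sub (integrable_const _) hi]
      rw [integral_const, probReal_univ, one_smul]
      rfl
    rw [e1]
    refine (ENNReal.rpow_le_rpow (enorm_integral_le_lintegral_enorm _) (by positivity)).trans ?_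
    refine (lintegral_enorm_rpow_le ((integrable_const _).sub hi).1 hp).trans ?_
    refine lintegral_mono fun v => ?_
    simp only [Pi.sub_apply]
    rw [enorm_sub_rev]
  refine (lintegral_mono hpt).trans ?_
  rw [lintegral_lintegral_swap]
  swap
  · have : Continuous fun z : E N × E N => f (z.1 + z.2) - f z.1 := by fun_prop
    exact (this.measurable.enorm.pow_const p).aemeasurable
  calc ∫⁻ v, (∫⁻ x in K, ‖f (x + v) - f x‖ₑ ^ p) ∂ν
      ≤ ∫⁻ _, ENNReal.ofReal r ^ p * (∫⁻ x in L, ‖G x‖ₑ ^ p) ∂ν := by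
        refine lintegral_mono_ae ?_
        filter_upwards [hball] with v hv
        have hvr : ‖v‖ < r := mem_ball_zero_iff.1 hv
        refine (h.lintegral_translate_sub_le hG hGi v hp hK hL ?_).trans ?_
        · intro x hx t ht0 ht1
          refine hKL x hx ?_
          rw [mem_ball_iff_norm, add_sub_cancel_left, norm_smul, Real.norm_of_nonneg ht0]
          exact (mul_le_of_le_one_left (norm_nonneg _) ht1).trans_lt hvr
        · refine mul_le_mul' (ENNReal.rpow_le_rpow ?_ (by positivity)) le_rfl
          rw [← ofReal_norm]
          exact ENNReal.ofReal_le_ofReal hvr.le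
    _ = _ := by simp

theorem enorm_average_rpow_le {f : E N → ℝ} (hf : Continuous f) {p : ℝ} (hp : 1 ≤ p)
    {L : Set (E N)} {r : ℝ} (hr : 0 < r) {x : E N} (hL : Metric.ball x r ⊆ L) :
    ‖⨍ v in Metric.ball (0 : E N) r, f (x + v)‖ₑ ^ p
      ≤ (volume (Metric.ball (0 : E N) r))⁻¹ * ∫⁻ y in L, ‖f y‖ₑ ^ p := by
  have hν := isProbabilityMeasure_ball (N := N) r hr
  have hm : Continuous fun v => f (x + v) := hf.comp (continuous_const_add x)
  refine (ENNReal.rpow_le_rpow (enorm_integral_le_lintegral_enorm _) (by positivity)).trans ?_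
  refine (lintegral_enorm_rpow_le hm.aestronglyMeasurable hp).trans ?_
  rw [lintegral_smul_measure, Measure.restrict_apply_univ, smul_eq_mul]
  refine mul_le_mul' le_rfl (le_trans (le_of_eq ?_) (lintegral_mono_set hL))
  rw [← lintegral_indicator measurableSet_ball, ← lintegral_indicator measurableSet_ball,
    ← lintegral_add_left_eq_self ((Metric.ball x r).indicator fun y => ‖f y‖ₑ ^ p) x]
  congr 1; funext v
  by_cases hv : v ∈ Metric.ball (0 : E N) r
  · rw [indicator_of_mem hv, indicator_of_mem]
    simpa [mem_ball_iff_norm] using hv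
  · rw [indicator_of_notMem hv, indicator_of_notMem]
    simpa [mem_ball_iff_norm] using hv

section Admissible

variable {Ω : Set (E N)} {p : ℝ} {A : E N → Matrix (Fin N) (Fin N) ℝ} {V : E N → ℝ}

/-- If the energy controls `L`, then it controls the averages over balls in `L`. -/
theorem enorm_average_le (h : IsAdmissible Ω p A V) {L : Set (E N)}
    {C : ℝ} (hC : ∀ φ, IsTestFunction Ω p φ →
      ∫⁻ x in L, ‖φ x‖ₑ ^ p ≤ ENNReal.ofReal C * ENNReal.ofReal (energy Ω p A (posPot V) φ))
    {r : ℝ} (hr : 0 < r) {x : E N} (hxL : Metric.ball x r ⊆ L) (φ : EnergySpace h) :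
    ‖⨍ v in Metric.ball (0 : E N) r, φ.fn (x + v)‖ₑ
      ≤ ((volume (Metric.ball (0 : E N) r))⁻¹ * ENNReal.ofReal C) ^ (1 / p) * ‖φ‖ₑ := by
  rw [← ENNReal.rpow_le_rpow_iff h.pos, ENNReal.mul_rpow_of_nonneg _ _ h.pos.le,
    ← ENNReal.rpow_mul, one_div_mul_cancel h.pos.ne', ENNReal.rpow_one, φ.enorm_rpow, mul_assoc]
  exact (enorm_average_rpow_le φ.isTestFunction.continuous h.one_lt.le hr hxL).trans
    (mul_le_mul' le_rfl (hC _ φ.isTestFunction))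

/-- The average over a ball is a continuous linear functional on the Beppo-Levi space. -/
theorem BeppoLevi.exists_average (h : IsAdmissible Ω p A V) {L : Set (E N)}
    (hL : IsControlled Ω p A V L) {r : ℝ} (hr : 0 < r) {x : E N} (hxL : Metric.ball x r ⊆ L) :
    ∃ l : BeppoLevi h →L[ℝ] ℝ, ∀ φ : EnergySpace h,
      l φ = ⨍ v in Metric.ball (0 : E N) r, φ.fn (x + v) := by
  obtain ⟨C, hC0, hC⟩ := hL
  have hi : ∀ φ : EnergySpace h, Integrable (fun v => φ.fn (x + v))
      ((volume.restrict (Metric.ball (0 : E N) r) univ)⁻¹ •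
        volume.restrict (Metric.ball (0 : E N) r)) := fun φ =>
    (integrableOn_ball_translate φ.isTestFunction.continuous x r).smul_measure
      (ENNReal.inv_ne_top.2 (by
        rw [Measure.restrict_apply_univ]; exact (Metric.measure_ball_pos _ _ hr).ne'))
  let f : EnergySpace h →ₗ[ℝ] ℝ :=
    { toFun := fun φ => ⨍ v in Metric.ball (0 : E N) r, φ.fn (x + v)
      map_add' := fun φ ψ => integral_add (hi φ) (hi ψ)
      map_smul' := fun c φ => integral_const_mul c _ }
  set D : ℝ≥0∞ := ((volume (Metric.ball (0 : E N) r))⁻¹ * ENNReal.ofReal C) ^ (1 / p) with hD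
  have hDt : D ≠ ⊤ := ENNReal.rpow_ne_top_of_nonneg (by have := h.pos; positivity)
    (ENNReal.mul_ne_top (ENNReal.inv_ne_top.2 (Metric.measure_ball_pos _ _ hr).ne')
      ENNReal.ofReal_ne_top)
  refine ⟨f.extendOfNorm (UniformSpace.Completion.toComplL (𝕜 := ℝ)
    (E := EnergySpace h)).toLinearMap, fun φ => ?_⟩
  refine LinearMap.extendOfNorm_eq (f := f) UniformSpace.Completion.denseRange_coe
    ⟨D.toReal, fun ψ => ?_⟩ φ
  change ‖⨍ v in Metric.ball (0 : E N) r, ψ.fn (x + v)‖ ≤ D.toReal * ‖(ψ : BeppoLevi h)‖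
  rw [UniformSpace.Completion.norm_coe, ← toReal_enorm, ← toReal_enorm, ← ENNReal.toReal_mul]
  exact ENNReal.toReal_mono (ENNReal.mul_ne_top hDt enorm_ne_top) (enorm_average_le h hC hr hxL ψ)

/-- A weakly null sequence of test functions is null in `L^p` of compact sets. -/
theorem EnergySpace.tendsto_lintegral_zero (h : IsAdmissible Ω p A V)
    (hsub : IsSubcritical Ω p A (posPot V)) {φ : ℕ → EnergySpace h} {M : ℝ}
    (hM : ∀ n, ‖φ n‖ ≤ M)
    (hφ : ∀ l : BeppoLevi h →L[ℝ] ℝ, Tendsto (fun n => l (φ n)) atTop (𝓝 0))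
    {K : Set (E N)} (hK : IsCompact K) (hKΩ : K ⊆ Ω) :
    Tendsto (fun n => ∫⁻ x in K, ‖(φ n).fn x‖ₑ ^ p) atTop (𝓝 0) := by
  have hp := h.one_lt.le
  obtain ⟨δ, hδ, hδΩ⟩ := hK.exists_cthickening_subset_open h.isOpen hKΩ
  set L := Metric.cthickening δ K with hLdef
  have hL : IsCompact L := hK.cthickening
  have hball : ∀ r ≤ δ, ∀ x ∈ K, Metric.ball x r ⊆ L := fun r hr x hx =>
    (Metric.ball_subset_ball hr).trans ((Metric.ball_subset_thickening hx δ).trans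
      (Metric.thickening_subset_cthickening δ K))
  have hcon := hsub.isControlled h hL hδΩ
  obtain ⟨C, hC0, hC⟩ := hcon
  obtain ⟨D, hD0, hD⟩ := h.exists_lintegral_grad_le hL hδΩ
  have hMe : ∀ n, ‖φ n‖ₑ ≤ ENNReal.ofReal M := fun n => by
    rw [← ofReal_norm]; exact ENNReal.ofReal_le_ofReal (hM n)
  have hMp : ENNReal.ofReal M ^ p ≠ ⊤ := ENNReal.rpow_ne_top_of_nonneg h.pos.le
    ENNReal.ofReal_ne_top
  have h2p : (2 : ℝ≥0∞) ^ (p - 1) ≠ ⊤ := ENNReal.rpow_ne_top_of_nonneg (by linarith) (by simp)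
  -- the averages over small balls tend to zero in `L^p(K)`
  have havg : ∀ r, 0 < r → r ≤ δ → Tendsto (fun n => ∫⁻ x in K,
      ‖⨍ v in Metric.ball (0 : E N) r, (φ n).fn (x + v)‖ₑ ^ p) atTop (𝓝 0) := by
    intro r hr hrδ
    set B : ℝ≥0∞ := (((volume (Metric.ball (0 : E N) r))⁻¹ * ENNReal.ofReal C) ^ (1 / p)
      * ENNReal.ofReal M) ^ p with hB
    have hBt : B ≠ ⊤ := by
      refine ENNReal.rpow_ne_top_of_nonneg h.pos.le (ENNReal.mul_ne_top
        (ENNReal.rpow_ne_top_of_nonneg (by have := h.pos; positivity) (ENNReal.mul_ne_top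
          (ENNReal.inv_ne_top.2 (Metric.measure_ball_pos _ _ hr).ne') ENNReal.ofReal_ne_top))
        ENNReal.ofReal_ne_top)
    have hdom := tendsto_lintegral_of_dominated_convergence' (μ := volume.restrict K)
      (F := fun n x => ‖⨍ v in Metric.ball (0 : E N) r, (φ n).fn (x + v)‖ₑ ^ p)
      (f := fun _ => 0) (fun _ => B) ?_ ?_ ?_ ?_
    · simpa using hdom
    · intro n
      have hc : Continuous fun z : E N × E N => (φ n).fn (z.1 + z.2) :=
        (φ n).isTestFunction.continuous.comp continuous_add
      have hs : StronglyMeasurable fun x => ⨍ v in Metric.ball (0 : E N) r, (φ n).fn (x + v) :=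
        StronglyMeasurable.integral_prod_right (f := fun x v => (φ n).fn (x + v))
          hc.stronglyMeasurable
      exact (hs.enorm.pow_const p).aemeasurable
    · intro n
      filter_upwards [ae_restrict_mem hK.measurableSet] with x hx
      refine ENNReal.rpow_le_rpow ((enorm_average_le h hC hr (hball r hrδ x hx) (φ n)).trans ?_)
        h.pos.le
      gcongr
      exact hMe n
    · rw [setLIntegral_const]
      exact ENNReal.mul_ne_top hBt hK.measure_lt_top.ne
    · filter_upwards [ae_restrict_mem hK.measurableSet] with x hx
      obtain ⟨l, hl⟩ := BeppoLevi.exists_average h ⟨C, hC0, hC⟩ hr (hball r hrδ x hx)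
      have h1 := hφ l
      simp only [hl] at h1
      have h2 := ((ENNReal.continuous_rpow_const (y := p)).tendsto _).comp
        ((continuous_enorm.tendsto _).comp h1)
      rw [enorm_zero, ENNReal.zero_rpow_of_pos h.pos] at h2
      exact h2
  -- the distance to the averages is small in `L^p(K)`, uniformly in `n`, if `r` is small
  have hsmall : Tendsto (fun r : ℝ => 2 ^ (p - 1) * (ENNReal.ofReal r ^ p *
      (ENNReal.ofReal D * ENNReal.ofReal M ^ p))) (𝓝 0) (𝓝 0) := by
    have h1 : Tendsto (fun r : ℝ => ENNReal.ofReal r ^ p) (𝓝 0) (𝓝 0) := by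
      have := ((ENNReal.continuous_rpow_const (y := p)).comp ENNReal.continuous_ofReal).tendsto 0
      simpa [Function.comp_def, ENNReal.zero_rpow_of_pos h.pos] using this
    have h2 := ENNReal.Tendsto.const_mul (a := (2 : ℝ≥0∞) ^ (p - 1))
      (ENNReal.Tendsto.mul_const (b := ENNReal.ofReal D * ENNReal.ofReal M ^ p) h1
        (Or.inr (ENNReal.mul_ne_top ENNReal.ofReal_ne_top hMp))) (Or.inr h2p)
    simpa using h2
  rw [ENNReal.tendsto_nhds_zero]
  intro ε hε
  have hε2 : 0 < ε / 2 := ENNReal.half_pos hε.ne'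
  obtain ⟨r, hrs, hr0, hrδ⟩ : ∃ r : ℝ, 2 ^ (p - 1) * (ENNReal.ofReal r ^ p *
      (ENNReal.ofReal D * ENNReal.ofReal M ^ p)) ≤ ε / 2 ∧ 0 < r ∧ r ≤ δ := by
    have h1 := (hsmall.mono_left (nhdsWithin_le_nhds (s := Ioi 0))).eventually
      (Iic_mem_nhds hε2)
    have h2 : ∀ᶠ r : ℝ in 𝓝[>] 0, r ∈ Ioc 0 δ := Ioc_mem_nhdsGT hδ
    obtain ⟨r, hr1, hr2⟩ := (h1.and h2).exists
    exact ⟨r, hr1, hr2.1, hr2.2⟩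
  have hlim := ENNReal.Tendsto.const_mul (a := (2 : ℝ≥0∞) ^ (p - 1)) (havg r hr0 hrδ) (Or.inr h2p)
  rw [mul_zero] at hlim
  filter_upwards [hlim.eventually (Iic_mem_nhds hε2)] with n hn
  obtain ⟨G, hGm, hGi, hG, -, hGw, -⟩ := (φ n).isTestFunction.exists_grad_univ h.isOpen
  have hφc := (φ n).isTestFunction.continuous
  have herr := hG.lintegral_sub_average_le hGm hGi hφc hp hK.measurableSet hL.measurableSet
    hr0 (hball r hrδ)
  have hGD := hD _ (φ n).isTestFunction G hGw
  rw [← EnergySpace.enorm_rpow] at hGD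
  have hc : Continuous fun z : E N × E N => (φ n).fn (z.1 + z.2) := hφc.comp continuous_add
  have hs : StronglyMeasurable fun x => ⨍ v in Metric.ball (0 : E N) r, (φ n).fn (x + v) :=
    StronglyMeasurable.integral_prod_right (f := fun x v => (φ n).fn (x + v)) hc.stronglyMeasurable
  have hsm : Measurable fun x =>
      ‖(φ n).fn x - ⨍ v in Metric.ball (0 : E N) r, (φ n).fn (x + v)‖ₑ ^ p :=
    (hφc.stronglyMeasurable.sub hs).enorm.pow_const p
  calc ∫⁻ x in K, ‖(φ n).fn x‖ₑ ^ p
      ≤ ∫⁻ x in K, 2 ^ (p - 1) *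
          (‖(φ n).fn x - ⨍ v in Metric.ball (0 : E N) r, (φ n).fn (x + v)‖ₑ ^ p
            + ‖⨍ v in Metric.ball (0 : E N) r, (φ n).fn (x + v)‖ₑ ^ p) := by
        refine lintegral_mono fun x => ?_
        refine le_trans (ENNReal.rpow_le_rpow ?_ h.pos.le)
          (ENNReal.rpow_add_le_mul_rpow_add_rpow _ _ hp)
        calc ‖(φ n).fn x‖ₑ = ‖(φ n).fn x - (⨍ v in Metric.ball (0 : E N) r, (φ n).fn (x + v))
                + ⨍ v in Metric.ball (0 : E N) r, (φ n).fn (x + v)‖ₑ := by simp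
          _ ≤ _ := enorm_add_le _ _
    _ = 2 ^ (p - 1) *
          (∫⁻ x in K, ‖(φ n).fn x - ⨍ v in Metric.ball (0 : E N) r, (φ n).fn (x + v)‖ₑ ^ p)
        + 2 ^ (p - 1) * ∫⁻ x in K,
          ‖⨍ v in Metric.ball (0 : E N) r, (φ n).fn (x + v)‖ₑ ^ p := by
        rw [lintegral_const_mul' _ _ h2p, lintegral_add_left hsm, mul_add]
    _ ≤ ε / 2 + ε / 2 := by
        refine add_le_add (le_trans ?_ hrs) hn
        refine mul_le_mul' le_rfl (herr.trans (mul_le_mul' le_rfl (hGD.trans ?_)))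
        exact mul_le_mul' le_rfl (ENNReal.rpow_le_rpow (hMe n) h.pos.le)
    _ = ε := ENNReal.add_halves ε

/-- Weakly convergent sequences are bounded, by the uniform boundedness principle. -/
theorem exists_norm_le_of_tendsto_weakly {X : Type*} [NormedAddCommGroup X] [NormedSpace ℝ X]
    {x : ℕ → X} {x₀ : X} (hx : ∀ l : X →L[ℝ] ℝ, Tendsto (fun n => l (x n)) atTop (𝓝 (l x₀))) :
    ∃ M : ℝ, ∀ n, ‖x n‖ ≤ M := by
  obtain ⟨M, hM⟩ := banach_steinhaus (E := StrongDual ℝ X)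
    (g := fun n => NormedSpace.inclusionInDoubleDual ℝ X (x n)) (fun l => by
      obtain ⟨C, hC⟩ := (hx l).norm.bddAbove_range
      exact ⟨C, fun n => hC ⟨n, rfl⟩⟩)
  refine ⟨M, fun n => ?_⟩
  rw [← (NormedSpace.inclusionInDoubleDualLi ℝ (E := X)).norm_map (x n)]
  exact hM n

/-- A weakly null sequence in the Beppo-Levi space is null in `L^p` of compact sets. -/
theorem BeppoLevi.tendsto_lintegral_zero (h : IsAdmissible Ω p A V)
    (hsub : IsSubcritical Ω p A (posPot V)) {y : ℕ → BeppoLevi h} {M : ℝ} (hM : ∀ n, ‖y n‖ ≤ M)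
    (hy : ∀ l : BeppoLevi h →L[ℝ] ℝ, Tendsto (fun n => l (y n)) atTop (𝓝 0))
    {K : Set (E N)} (hK : IsCompact K) (hKΩ : K ⊆ Ω) :
    Tendsto (fun n => ∫⁻ x in K, ‖BeppoLevi.fn (y n) x‖ₑ ^ p) atTop (𝓝 0) := by
  have hp := h.one_lt.le
  -- test functions at vanishing distance from the sequence form a weakly null sequence, too
  have hclose : ∀ n : ℕ, ∃ φ : EnergySpace h, ‖y n - φ‖ < 1 / ((n : ℝ) + 1) := fun n => by
    obtain ⟨_, ⟨φ, rfl⟩, hφ⟩ := Metric.mem_closure_iff.1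
      (UniformSpace.Completion.denseRange_coe (α := EnergySpace h) (y n)) (1 / ((n : ℝ) + 1))
      Nat.one_div_pos_of_nat
    exact ⟨φ, by rwa [dist_eq_norm] at hφ⟩
  choose φ hφ using hclose
  have hnull : Tendsto (fun n => y n - φ n) atTop (𝓝 (0 : BeppoLevi h)) :=
    squeeze_zero_norm (fun n => (hφ n).le) tendsto_one_div_add_atTop_nhds_zero_nat
  have hφM : ∀ n, ‖φ n‖ ≤ M + 1 := fun n => by
    rw [← UniformSpace.Completion.norm_coe]
    calc ‖(φ n : BeppoLevi h)‖ = ‖y n - (y n - φ n)‖ := by rw [sub_sub_cancel]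
      _ ≤ ‖y n‖ + ‖y n - φ n‖ := norm_sub_le _ _
      _ ≤ M + 1 := add_le_add (hM n) ((hφ n).le.trans (by
          rw [div_le_one (by positivity)]; linarith [(Nat.cast_nonneg n : (0:ℝ) ≤ n)]))
  have hφ0 : ∀ l : BeppoLevi h →L[ℝ] ℝ, Tendsto (fun n => l (φ n)) atTop (𝓝 0) := fun l => by
    have h1 := (hy l).sub ((l.continuous.tendsto 0).comp hnull)
    simpa using h1
  have h1 := EnergySpace.tendsto_lintegral_zero h hsub hφM hφ0 hK hKΩ
  obtain ⟨C, hC0, hC⟩ := hsub.isControlled h hK hKΩ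
  have hw : ∀ f : E N → ℝ, ∫⁻ x in Ω, ‖K.indicator (1 : E N → ℝ) x‖ₑ * ‖f x‖ₑ ^ p
      = ∫⁻ x in K, ‖f x‖ₑ ^ p := fun f => by
    rw [← inter_eq_self_of_subset_left hKΩ, ← Measure.restrict_restrict hK.measurableSet,
      inter_eq_self_of_subset_left hKΩ, ← lintegral_indicator hK.measurableSet]
    congr 1; funext x
    by_cases hx : x ∈ K <;> simp [hx]
  have h2 : ∀ n, ∫⁻ x in K, ‖BeppoLevi.fn (y n - (φ n : BeppoLevi h)) x‖ₑ ^ p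
      ≤ ENNReal.ofReal C * ‖y n - φ n‖ₑ ^ p := fun n => by
    rw [← hw]
    refine BeppoLevi.lintegral_le h hsub
      (stronglyMeasurable_one.indicator hK.measurableSet).aestronglyMeasurable
      ENNReal.ofReal_ne_top (fun ψ hψ => ?_) _
    rw [hw]
    exact hC ψ hψ
  have h3 : Tendsto (fun n => ENNReal.ofReal C * ‖y n - φ n‖ₑ ^ p) atTop (𝓝 0) := by
    have := ENNReal.Tendsto.const_mul (a := ENNReal.ofReal C)
      (((ENNReal.continuous_rpow_const (y := p)).tendsto _).comp
      ((continuous_enorm.tendsto _).comp hnull)) (Or.inr ENNReal.ofReal_ne_top)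
    simpa [ENNReal.zero_rpow_of_pos h.pos] using this
  have h2p : (2 : ℝ≥0∞) ^ (p - 1) ≠ ⊤ := ENNReal.rpow_ne_top_of_nonneg (by linarith) (by simp)
  have h4 := ENNReal.Tendsto.const_mul (a := (2 : ℝ≥0∞) ^ (p - 1)) (h3.add h1) (Or.inr h2p)
  rw [add_zero, mul_zero] at h4
  refine tendsto_of_tendsto_of_tendsto_of_le_of_le tendsto_const_nhds h4 (fun n => zero_le)
    fun n => ?_
  have hae : ∀ᵐ x ∂(volume.restrict K), ‖BeppoLevi.fn (y n) x‖ₑ ^ p ≤ 2 ^ (p - 1) *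
      (‖BeppoLevi.fn (y n - (φ n : BeppoLevi h)) x‖ₑ ^ p + ‖(φ n).fn x‖ₑ ^ p) := by
    filter_upwards [ae_mono (Measure.restrict_mono hKΩ le_rfl)
      (BeppoLevi.fn_sub h hsub (y n) (φ n)),
      ae_mono (Measure.restrict_mono hKΩ le_rfl) (BeppoLevi.fn_coe h hsub (φ n))] with x hx hx'
    refine le_trans (ENNReal.rpow_le_rpow ?_ h.pos.le)
      (ENNReal.rpow_add_le_mul_rpow_add_rpow _ _ hp)
    rw [hx, Pi.sub_apply, hx']
    calc ‖BeppoLevi.fn (y n) x‖ₑ = ‖BeppoLevi.fn (y n) x - (φ n).fn x + (φ n).fn x‖ₑ := by simp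
      _ ≤ _ := enorm_add_le _ _
  refine (lintegral_mono_ae hae).trans ?_
  rw [lintegral_const_mul' _ _ h2p, lintegral_add_right _
    ((φ n).isTestFunction.continuous.measurable.enorm.pow_const p)]
  exact mul_le_mul' le_rfl (add_le_add (h2 n) le_rfl)

end Admissible

/-! ### Functions of a test function and a positive solution -/

section Admissible

variable {Ω : Set (E N)} {p : ℝ} {A : E N → Matrix (Fin N) (Fin N) ℝ} {V : E N → ℝ}

theorem MemW1pLoc.hasWeakGrad {u : E N → ℝ} (hu : MemW1pLoc Ω p u) :
    HasWeakGrad Ω u (weakGrad Ω u) := by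
  obtain ⟨G, hG, -⟩ := hu
  exact hasWeakGrad_weakGrad ⟨G, hG⟩

theorem MemW1pLoc.memLp_weakGrad (hΩ : IsOpen Ω) {u : E N → ℝ} (hu : MemW1pLoc Ω p u)
    {K : Set (E N)} (hK : IsCompact K) (hKΩ : K ⊆ Ω) :
    MemLp (weakGrad Ω u) (ENNReal.ofReal p) (volume.restrict K) := by
  obtain ⟨G, hG, hL⟩ := hu
  exact (hL K hK hKΩ).2.ae_eq
    (ae_mono (Measure.restrict_mono hKΩ le_rfl) (hG.weakGrad_ae_eq hΩ).symm)

theorem IsTestFunction.uniformContinuous {φ : E N → ℝ} (hφ : IsTestFunction Ω p φ) :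
    UniformContinuous φ :=
  hφ.continuous.uniformContinuous_of_tendsto_cocompact hφ.hasCompactSupport.is_zero_at_infty

theorem fderiv_apply_fst_snd {F : ℝ × ℝ → ℝ} {a : ℝ × ℝ} (hF : DifferentiableAt ℝ F a)
    {F₁ F₂ : ℝ} (h₁ : HasDerivAt (fun s => F (s, a.2)) F₁ a.1)
    (h₂ : HasDerivAt (fun t => F (a.1, t)) F₂ a.2) :
    fderiv ℝ F a (1, 0) = F₁ ∧ fderiv ℝ F a (0, 1) = F₂ := by
  constructor
  · have h : HasDerivAt (fun s : ℝ => (s, a.2)) ((1 : ℝ), (0 : ℝ)) a.1 :=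
      (hasDerivAt_id _).prodMk (hasDerivAt_const _ _)
    exact (HasFDerivAt.comp_hasDerivAt a.1 (f := fun s : ℝ => (s, a.2)) hF.hasFDerivAt h).unique h₁
  · have h : HasDerivAt (fun t : ℝ => (a.1, t)) ((0 : ℝ), (1 : ℝ)) a.2 :=
      (hasDerivAt_const _ _).prodMk (hasDerivAt_id _)
    exact (HasFDerivAt.comp_hasDerivAt a.2 (f := fun t : ℝ => (a.1, t)) hF.hasFDerivAt h).unique h₂

/-- If `F(0, t) = 0`, then `F(φ, u)` is a test function for every test function `φ` and every
positive function `u ∈ W^{1,p}_loc(Ω) ∩ C(Ω)`. It is set to zero off the support of `φ`, as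
nothing is known about `u` outside `Ω`. -/
theorem IsTestFunction.comp₂ (hΩ : IsOpen Ω) {φ u : E N → ℝ} (hφ : IsTestFunction Ω p φ)
    (hu : MemW1pLoc Ω p u) (huc : ContinuousOn u Ω) (hpos : ∀ x ∈ Ω, 0 < u x)
    {F : ℝ × ℝ → ℝ} {F₁ F₂ : ℝ → ℝ → ℝ} (hF : ∀ s t : ℝ, 0 < t → ContDiffAt ℝ 1 F (s, t))
    (hF0 : ∀ t : ℝ, 0 < t → F (0, t) = 0)
    (hF₁ : ∀ s t : ℝ, 0 < t → HasDerivAt (fun s => F (s, t)) (F₁ s t) s)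
    (hF₂ : ∀ s t : ℝ, 0 < t → HasDerivAt (fun t => F (s, t)) (F₂ s t) t) :
    ∃ ψ : E N → ℝ, IsTestFunction Ω p ψ ∧ (∀ x ∈ tsupport φ, ψ x = F (φ x, u x)) ∧
      (∀ x, x ∉ tsupport φ → ψ x = 0) ∧
      (∀ᵐ x ∂(volume.restrict Ω), x ∈ tsupport φ →
        weakGrad Ω ψ x = F₁ (φ x) (u x) • weakGrad Ω φ x + F₂ (φ x) (u x) • weakGrad Ω u x) ∧
      (∀ᵐ x ∂(volume.restrict Ω), x ∉ tsupport φ → weakGrad Ω ψ x = 0) := by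
  have hK : IsCompact (tsupport φ) := hφ.hasCompactSupport
  obtain ⟨w, H, hwu, ⟨c, hc, C, hcC⟩, hHm, hHi, hw, U, hU, hKU, hUΩ, hwU, hHU⟩ :=
    hu.hasWeakGrad.exists_positive_extension hΩ huc hpos hK hφ.tsupport_subset
  obtain ⟨G, hGm, hGi, hG, hGp, hGw, hGoff⟩ := hφ.exists_grad_univ hΩ
  obtain ⟨M, hM⟩ := hφ.hasCompactSupport.exists_bound_of_continuous hφ.continuous
  set D : Set (ℝ × ℝ) := Icc (-M) M ×ˢ Icc c C with hD
  have hDc : IsCompact D := isCompact_Icc.prod isCompact_Icc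
  have hDpos : ∀ a ∈ D, 0 < a.2 := fun a ha => hc.trans_le ha.2.1
  have hmem : ∀ x, (φ x, w x) ∈ D := fun x => ⟨abs_le.1 (hM x), hcC x⟩
  have hFD : ContinuousOn (fderiv ℝ F) D := fun a ha =>
    ((hF a.1 a.2 (hDpos a ha)).continuousAt_fderiv one_ne_zero).continuousWithinAt
  have hψg := hG.comp₂ hGm hGi hφ.uniformContinuous hw hHm hHi hwu hDc hmem
    (fun a ha => (hF a.1 a.2 (hDpos a ha)).hasStrictFDerivAt one_ne_zero) hFD
  have hval : ∀ x, fderiv ℝ F (φ x, w x) (1, 0) = F₁ (φ x) (w x) ∧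
      fderiv ℝ F (φ x, w x) (0, 1) = F₂ (φ x) (w x) := fun x =>
    fderiv_apply_fst_snd ((hF _ _ (hDpos _ (hmem x))).differentiableAt one_ne_zero)
      (hF₁ _ _ (hDpos _ (hmem x))) (hF₂ _ _ (hDpos _ (hmem x)))
  set ψ : E N → ℝ := fun x => F (φ x, w x) with hψ
  set Gψ : E N → E N := fun x => fderiv ℝ F (φ x, w x) (1, 0) • G x
    + fderiv ℝ F (φ x, w x) (0, 1) • H x with hGψ
  have hψc : Continuous ψ := by
    rw [continuous_iff_continuousAt]
    intro x
    exact ContinuousAt.comp (f := fun x => (φ x, w x)) (hF _ _ (hDpos _ (hmem x))).continuousAt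
      (hφ.continuous.prodMk hwu.continuous).continuousAt
  have hψ0 : ∀ x, x ∉ tsupport φ → ψ x = 0 := fun x hx => by
    rw [hψ]
    simp only [image_eq_zero_of_notMem_tsupport hx]
    exact hF0 _ (hDpos _ (hmem x))
  have hψsub : tsupport ψ ⊆ tsupport φ := closure_minimal (fun x hx => by
    by_contra h0; exact hx (hψ0 x h0)) (isClosed_tsupport φ)
  have hψs : HasCompactSupport ψ := hK.of_isClosed_subset (isClosed_tsupport _) hψsub
  have hψΩ : HasWeakGrad Ω ψ Gψ := hψg.mono MeasurableSet.univ (subset_univ Ω)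
  have hψoff : ∀ᵐ x, x ∈ (tsupport φ)ᶜ → Gψ x = 0 :=
    hψg.ae_eq_zero_of_eqOn (isClosed_tsupport φ).isOpen_compl (subset_univ _) hψ0
  have hψL : MemLp Gψ (ENNReal.ofReal p) (volume.restrict Ω) := by
    obtain ⟨B, hB⟩ := hDc.exists_bound_of_continuousOn hFD
    have hB' : ∀ (x : E N) (z : ℝ × ℝ), ‖z‖ ≤ 1 → ‖fderiv ℝ F (φ x, w x) z‖ ≤ B := fun x z hz =>
      ((fderiv ℝ F (φ x, w x)).le_opNorm z).trans ((mul_le_of_le_one_right (norm_nonneg _) hz).trans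
        (hB _ (hmem x)))
    have hcont : ∀ z, Continuous fun x => fderiv ℝ F (φ x, w x) z := fun z =>
      (hFD.comp_continuous (hφ.continuous.prodMk hwu.continuous) hmem).clm_apply continuous_const
    have h1 : MemLp (fun x => fderiv ℝ F (φ x, w x) (1, 0) • G x) (ENNReal.ofReal p)
        (volume.restrict (tsupport φ)) := by
      refine (hGp.mono_measure Measure.restrict_le_self).of_le_mul (c := B)
        ((hcont _).aestronglyMeasurable.smul hGm.aestronglyMeasurable)
        (Eventually.of_forall fun x => ?_)
      rw [norm_smul]
      exact mul_le_mul_of_nonneg_right (hB' x _ (by simp [Prod.norm_def])) (norm_nonneg _)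
    have hHK : H =ᵐ[volume.restrict (tsupport φ)] weakGrad Ω u := by
      rw [EventuallyEq, ae_restrict_iff' (isClosed_tsupport φ).measurableSet]
      filter_upwards [hHU] with x hx hxK using hx (hKU hxK)
    have h2 : MemLp (fun x => fderiv ℝ F (φ x, w x) (0, 1) • H x) (ENNReal.ofReal p)
        (volume.restrict (tsupport φ)) := by
      refine ((hu.memLp_weakGrad hΩ hK hφ.tsupport_subset).ae_eq hHK.symm).of_le_mul (c := B)
        ((hcont _).aestronglyMeasurable.smul hHm.aestronglyMeasurable)
        (Eventually.of_forall fun x => ?_)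
      rw [norm_smul]
      exact mul_le_mul_of_nonneg_right (hB' x _ (by simp [Prod.norm_def])) (norm_nonneg _)
    have h3 := (memLp_indicator_iff_restrict (isClosed_tsupport φ).measurableSet).2 (h1.add h2)
    refine (h3.mono_measure Measure.restrict_le_self).ae_eq ?_
    refine ae_restrict_of_ae ?_
    filter_upwards [hψoff] with x hx
    by_cases hxK : x ∈ tsupport φ
    · rw [indicator_of_mem hxK]; rfl
    · rw [indicator_of_notMem hxK, hx hxK]
  have hwg := hψΩ.weakGrad_ae_eq hΩ
  refine ⟨ψ, ⟨hψc, hψs, hψsub.trans hφ.tsupport_subset,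
    hψc.memLp_of_hasCompactSupport hψs, Gψ, hψΩ, hψL⟩, fun x hx => ?_, hψ0, ?_, ?_⟩
  · simp only [hψ, hwU x (hKU hx)]
  · filter_upwards [hwg, hGw, ae_restrict_of_ae hHU] with x hx hGx hHx hxK
    rw [hx, ← hGx, ← hHx (hKU hxK)]
    simp only [hGψ]
    rw [(hval x).1, (hval x).2, hwU x (hKU hxK)]
  · filter_upwards [hwg, ae_restrict_of_ae hψoff] with x hx hx' hxK
    rw [hx, hx' hxK]

/-! ### The Caccioppoli inequality -/

theorem matNorm_sq {M : Matrix (Fin N) (Fin N) ℝ} (hpos : ∀ ξ : E N, 0 ≤ matInner M ξ ξ)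
    (ξ : E N) : matNorm M ξ ^ 2 = matInner M ξ ξ := Real.sq_sqrt (hpos ξ)

theorem abs_matInner_le {M : Matrix (Fin N) (Fin N) ℝ} (hM : M.IsSymm)
    (hpos : ∀ ξ : E N, 0 ≤ matInner M ξ ξ) (ξ ζ : E N) :
    |matInner M ξ ζ| ≤ matNorm M ξ * matNorm M ζ := by
  have hd := discrim_le_zero (a := matInner M ζ ζ) (b := 2 * matInner M ξ ζ)
    (c := matInner M ξ ξ) (fun t => by rw [← matInner_add_smul M hM]; exact hpos _)
  refine abs_le_of_sq_le_sq ?_ (mul_nonneg (matNorm_nonneg _ _) (matNorm_nonneg _ _))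
  rw [mul_pow, matNorm_sq hpos, matNorm_sq hpos]
  unfold discrim at hd
  nlinarith

theorem matInner_smul_add_smul (M : Matrix (Fin N) (Fin N) ℝ) (a b : ℝ) (ξ ζ ζ' : E N) :
    matInner M ξ (a • ζ + b • ζ') = a * matInner M ξ ζ + b * matInner M ξ ζ' := by
  simp only [matInner, Finset.mul_sum, ← Finset.sum_add_distrib]
  refine Finset.sum_congr rfl fun i _ => Finset.sum_congr rfl fun j _ => ?_
  simp only [PiLp.add_apply, PiLp.smul_apply, smul_eq_mul]
  ring

theorem IsAdmissible.aemeasurable_matInner (h : IsAdmissible Ω p A V) {X Y : E N → E N}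
    (hX : AEMeasurable X (volume.restrict Ω)) (hY : AEMeasurable Y (volume.restrict Ω)) :
    AEMeasurable (fun x => matInner (A x) (X x) (Y x)) (volume.restrict Ω) := by
  have hc : ∀ {Z : E N → E N}, AEMeasurable Z (volume.restrict Ω) → ∀ i,
      AEMeasurable (fun x => Z x i) (volume.restrict Ω) := fun {Z} hZ i =>
    (EuclideanSpace.proj (𝕜 := ℝ) i).continuous.measurable.comp_aemeasurable hZ
  unfold matInner
  refine Finset.aemeasurable_fun_sum _ fun i _ => Finset.aemeasurable_fun_sum _ fun j _ => ?_
  exact (((h.measurable i j).aemeasurable).mul (hc hX i)).mul (hc hY j)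

theorem IsAdmissible.aemeasurable_matNorm (h : IsAdmissible Ω p A V) {X : E N → E N}
    (hX : AEMeasurable X (volume.restrict Ω)) :
    AEMeasurable (fun x => matNorm (A x) (X x)) (volume.restrict Ω) :=
  Real.continuous_sqrt.measurable.comp_aemeasurable (h.aemeasurable_matInner hX hX)

/-- Young's inequality, in the crude form that suffices to absorb the first term. -/
theorem rpow_sub_one_mul_le {p : ℝ} (hp : 1 < p) {δ a b : ℝ} (hδ : 0 < δ) (ha : 0 ≤ a)
    (hb : 0 ≤ b) : a ^ (p - 1) * b ≤ δ * a ^ p + δ ^ (1 - p) * b ^ p := by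
  rcases le_total b (δ * a) with hab | hab
  · have h1 : a ^ (p - 1) * b ≤ δ * a ^ p := by
      calc a ^ (p - 1) * b ≤ a ^ (p - 1) * (δ * a) := by gcongr
        _ = δ * (a ^ (p - 1) * a) := by ring
        _ = δ * a ^ p := by
          rw [← Real.rpow_add_one' ha (by linarith), sub_add_cancel]
    have : 0 ≤ δ ^ (1 - p) * b ^ p := by positivity
    linarith
  · have h2 : a ≤ δ⁻¹ * b := by rwa [inv_mul_eq_div, le_div_iff₀ hδ, mul_comm]
    have h1 : a ^ (p - 1) * b ≤ δ ^ (1 - p) * b ^ p := by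
      calc a ^ (p - 1) * b ≤ (δ⁻¹ * b) ^ (p - 1) * b := by gcongr
        _ = δ ^ (1 - p) * (b ^ (p - 1) * b) := by
          rw [Real.mul_rpow (by positivity) hb, Real.inv_rpow hδ.le, ← Real.rpow_neg hδ.le,
            neg_sub]
          ring
        _ = δ ^ (1 - p) * b ^ p := by
          rw [← Real.rpow_add_one' hb (by linarith), sub_add_cancel]
    have : 0 ≤ δ * a ^ p := by positivity
    linarith

theorem integrable_ratio_rpow (h : IsAdmissible Ω p A V) {u : E N → ℝ}
    (hu : IsPositiveSolution Ω p A (posPot V) u) {φ : E N → ℝ} (hφ : IsTestFunction Ω p φ) :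
    Integrable (fun x => (|φ x| / u x * matNorm (A x) (weakGrad Ω u x)) ^ p)
      (volume.restrict Ω) := by
  have hp := h.pos
  have hK : IsCompact (tsupport φ) := hφ.hasCompactSupport
  have hKΩ := hφ.tsupport_subset
  have hKm := (isClosed_tsupport φ).measurableSet
  have hU := (hu.memW1pLoc.hasWeakGrad.locIntGrad.aestronglyMeasurable).aemeasurable
  have hm : AEMeasurable (fun x => (|φ x| / u x * matNorm (A x) (weakGrad Ω u x)) ^ p)
      (volume.restrict Ω) :=
    ((hφ.continuous.abs.measurable.aemeasurable.div (hu.continuousOn.aemeasurable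
      h.isOpen.measurableSet)).mul (h.aemeasurable_matNorm hU)).pow_const p
  obtain ⟨C, hC⟩ := h.locBdd _ hK hKΩ
  obtain ⟨B, hB⟩ := hK.exists_bound_of_continuousOn (f := fun x => |φ x| / u x)
    (hφ.continuous.abs.continuousOn.div (hu.continuousOn.mono hKΩ)
      fun x hx => (hu.pos x (hKΩ hx)).ne')
  have i1 := ((hu.memW1pLoc.memLp_weakGrad h.isOpen hK hKΩ).integrable_norm_rpow
      (by simpa using hp) (by simp)).const_mul ((|B| * Real.sqrt ((N : ℝ) * N * |C|)) ^ p)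
  rw [ENNReal.toReal_ofReal hp.le] at i1
  have i2 : IntegrableOn (fun x => (|φ x| / u x * matNorm (A x) (weakGrad Ω u x)) ^ p)
      (tsupport φ) volume := by
    refine i1.mono' (hm.mono_measure (Measure.restrict_mono hKΩ le_rfl)).aestronglyMeasurable ?_
    filter_upwards [hC, ae_restrict_mem hKm] with x hx hxK
    have h0 : 0 ≤ |φ x| / u x := div_nonneg (abs_nonneg _) (hu.pos x (hKΩ hxK)).le
    rw [Real.norm_of_nonneg (Real.rpow_nonneg (mul_nonneg h0 (matNorm_nonneg _ _)) _),
      ← Real.mul_rpow (by positivity) (norm_nonneg _)]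
    refine Real.rpow_le_rpow (mul_nonneg h0 (matNorm_nonneg _ _)) ?_ hp.le
    rw [mul_assoc]
    exact mul_le_mul (((le_abs_self _).trans (hB x hxK)).trans (le_abs_self B)) (matNorm_le hx _)
      (matNorm_nonneg _ _) (abs_nonneg _)
  refine ((integrableOn_iff_integrable_of_support_subset ?_).1 i2).integrableOn
  intro x hx
  refine subset_tsupport φ fun h0 => hx ?_
  simp [h0, Real.zero_rpow hp.ne']

/-- Testing the equation for `u` with `|φ|^p u^{1-p}` bounds `(|φ| / u) |∇u|_A` in `L^p` by the
energy of `φ`, with a constant that depends only on `p`. -/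
theorem IsPositiveSolution.integral_ratio_le (h : IsAdmissible Ω p A V) {u : E N → ℝ}
    (hu : IsPositiveSolution Ω p A (posPot V) u) {φ : E N → ℝ} (hφ : IsTestFunction Ω p φ) :
    ∫ x in Ω, (|φ x| / u x * matNorm (A x) (weakGrad Ω u x)) ^ p
      ≤ 2 / (p - 1) * (p * ((p - 1) / (2 * p)) ^ (1 - p) + 1) * energy Ω p A (posPot V) φ := by
  have hp := h.pos
  have hp1 := h.one_lt
  have hKΩ := hφ.tsupport_subset
  have hφp : ContDiff ℝ 1 fun s : ℝ => |s| ^ p := contDiff_norm_rpow hp1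
  obtain ⟨ψ, hψ, hψK, hψoff, hψg, hψg0⟩ := hφ.comp₂ h.isOpen hu.memW1pLoc hu.continuousOn hu.pos
    (F := fun a => |a.1| ^ p * a.2 ^ (1 - p))
    (F₁ := fun s t => p * |s| ^ (p - 2) * s * t ^ (1 - p))
    (F₂ := fun s t => |s| ^ p * ((1 - p) * t ^ (-p)))
    (fun s t ht => (hφp.contDiffAt.comp (s, t) contDiffAt_fst).mul
      (contDiffAt_snd.rpow_const_of_ne ht.ne'))
    (fun t ht => by simp [Real.zero_rpow hp.ne'])
    (fun s t ht => (hasDerivAt_abs_rpow s hp1).mul_const (t ^ (1 - p)))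
    (fun s t ht => by
      have := (Real.hasDerivAt_rpow_const (p := 1 - p) (Or.inl ht.ne')).const_mul (|s| ^ p)
      rwa [show 1 - p - 1 = -p by ring] at this)
  set W := posPot V with hW
  set a : E N → ℝ := fun x => |φ x| / u x * matNorm (A x) (weakGrad Ω u x) with ha
  set b : E N → ℝ := fun x => matNorm (A x) (weakGrad Ω φ x) with hb
  set I : E N → ℝ := fun x => matNorm (A x) (weakGrad Ω u x) ^ (p - 2) *
        matInner (A x) (weakGrad Ω u x) (weakGrad Ω ψ x)
      + W x * |u x| ^ (p - 2) * u x * ψ x with hI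
  have hweak : ∫ x in Ω, I x = 0 := hu.weak_eq ψ hψ
  -- the test function turns the equation into an identity for `a ^ p`
  have hid : ∀ᵐ x ∂(volume.restrict Ω), 0 ≤ a x ∧
      ∃ X : ℝ, |X| ≤ p * (a x ^ (p - 1) * b x) ∧
        I x = X - (p - 1) * a x ^ p + W x * |φ x| ^ p := by
    filter_upwards [hψg, hψg0, h.symm, h.ae_nonneg, ae_restrict_mem h.isOpen.measurableSet]
      with x hx hx0 hsx hnx hxΩ
    have hux := hu.pos x hxΩ
    have hr : 0 ≤ |φ x| / u x := div_nonneg (abs_nonneg _) hux.le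
    refine ⟨mul_nonneg hr (matNorm_nonneg _ _), ?_⟩
    by_cases hxK : x ∈ tsupport φ
    swap
    · have h0 : φ x = 0 := image_eq_zero_of_notMem_tsupport hxK
      refine ⟨0, ?_, ?_⟩
      · simp only [abs_zero, ha, h0, zero_div, zero_mul, hb]
        exact mul_nonneg hp.le (mul_nonneg (Real.rpow_nonneg le_rfl _) (matNorm_nonneg _ _))
      · simp only [hI, ha, hx0 hxK, hψoff x hxK, h0]
        simp [matInner, Real.zero_rpow hp.ne']
    set m := matNorm (A x) (weakGrad Ω u x) with hm
    have hm0 : 0 ≤ m := matNorm_nonneg _ _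
    have hψx := hψK x hxK
    simp only at hψx
    refine ⟨m ^ (p - 2) * (p * |φ x| ^ (p - 2) * φ x * u x ^ (1 - p)) *
      matInner (A x) (weakGrad Ω u x) (weakGrad Ω φ x), ?_, ?_⟩
    · have e1 : ∀ {y : ℝ}, 0 ≤ y → y ^ (p - 2) * y = y ^ (p - 1) := fun {y} hy => by
        rw [← Real.rpow_add_one' hy (by linarith)]; ring_nf
      have e2 : u x ^ (1 - p) = (u x ^ (p - 1))⁻¹ := by
        rw [← Real.rpow_neg hux.le, neg_sub]
      calc _ = m ^ (p - 2) * (p * (|φ x| ^ (p - 2) * |φ x|) * u x ^ (1 - p)) *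
            |matInner (A x) (weakGrad Ω u x) (weakGrad Ω φ x)| := by
            simp only [abs_mul, abs_of_pos hp, abs_of_nonneg (Real.rpow_nonneg hm0 _),
              abs_of_nonneg (Real.rpow_nonneg (abs_nonneg (φ x)) _),
              abs_of_nonneg (Real.rpow_nonneg hux.le _)]
            ring
        _ ≤ m ^ (p - 2) * (p * (|φ x| ^ (p - 2) * |φ x|) * u x ^ (1 - p)) * (m * b x) := by
            refine mul_le_mul_of_nonneg_left (abs_matInner_le hsx hnx _ _) ?_
            have := Real.rpow_nonneg hux.le (1 - p)
            positivity
        _ = p * ((|φ x| ^ (p - 2) * |φ x|) * u x ^ (1 - p) * (m ^ (p - 2) * m) * b x) := by ring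
        _ = p * (a x ^ (p - 1) * b x) := by
            rw [e1 hm0, e1 (abs_nonneg _), ha]
            simp only
            rw [Real.mul_rpow hr hm0, Real.div_rpow (abs_nonneg _) hux.le, e2, div_eq_mul_inv]
    · have e3 : m ^ (p - 2) * m ^ 2 = m ^ p := by
        rw [← Real.rpow_natCast, ← Real.rpow_add' hm0 (by simpa using hp.ne')]
        norm_num
      have e4 : a x ^ p = |φ x| ^ p * u x ^ (-p) * m ^ p := by
        rw [ha]
        simp only
        rw [Real.mul_rpow hr hm0, Real.div_rpow (abs_nonneg _) hux.le, Real.rpow_neg hux.le,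
          div_eq_mul_inv]
      have e5 : |u x| ^ (p - 2) * u x * u x ^ (1 - p) = 1 := by
        rw [abs_of_pos hux, ← Real.rpow_add_one hux.ne', ← Real.rpow_add hux,
          show p - 2 + 1 + (1 - p) = 0 by ring, Real.rpow_zero]
      simp only [hI]
      rw [hx hxK, matInner_smul_add_smul, ← matNorm_sq hnx, hψx, e4, ← e3]
      linear_combination (W x * |φ x| ^ p) * e5
  have iE := integrable_energy h hφ
  have ia := integrable_ratio_rpow h hu hφ
  have hUm := (hu.memW1pLoc.hasWeakGrad.locIntGrad.aestronglyMeasurable).aemeasurable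
  have hum : AEMeasurable u (volume.restrict Ω) :=
    hu.continuousOn.aemeasurable h.isOpen.measurableSet
  have hWm : AEMeasurable W (volume.restrict Ω) :=
    aemeasurable_const.max h.morrey.1.aestronglyMeasurable.aemeasurable
  have hE0 : ∀ x, 0 ≤ b x ^ p ∧ 0 ≤ W x * |φ x| ^ p := fun x =>
    ⟨Real.rpow_nonneg (matNorm_nonneg _ _) _,
      mul_nonneg (posPot_nonneg _ _) (Real.rpow_nonneg (abs_nonneg _) _)⟩
  have hIm : AEMeasurable I (volume.restrict Ω) :=
    (((h.aemeasurable_matNorm hUm).pow_const _).mul (h.aemeasurable_matInner hUm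
      (hψ.memLp_weakGrad h.isOpen).aestronglyMeasurable.aemeasurable)).add
      (((hWm.mul (hum.norm.pow_const _)).mul hum).mul hψ.continuous.measurable.aemeasurable)
  have iI : Integrable I (volume.restrict Ω) := by
    refine ((ia.const_mul (2 * p)).add (iE.const_mul (p + 1))).mono' hIm.aestronglyMeasurable ?_
    filter_upwards [hid] with x ⟨ha0, X, hX, hIx⟩
    have hy := rpow_sub_one_mul_le hp1 one_pos ha0 (matNorm_nonneg (A x) (weakGrad Ω φ x))
    rw [Real.one_rpow, one_mul, one_mul] at hy
    have hy' : p * (a x ^ (p - 1) * b x) ≤ p * (a x ^ p + b x ^ p) :=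
      mul_le_mul_of_nonneg_left hy hp.le
    obtain ⟨h1, h2⟩ := hE0 x
    have h3 : 0 ≤ a x ^ p := Real.rpow_nonneg ha0 _
    have h4 := abs_le.1 hX
    simp only [Pi.add_apply]
    change ‖I x‖ ≤ 2 * p * a x ^ p + (p + 1) * (b x ^ p + W x * |φ x| ^ p)
    rw [Real.norm_eq_abs, abs_le, hIx]
    constructor <;> nlinarith [mul_nonneg hp.le h2, mul_nonneg hp.le h1, mul_nonneg hp.le h3]
  set D : ℝ := p * ((p - 1) / (2 * p)) ^ (1 - p) with hD
  have hδ : 0 < (p - 1) / (2 * p) := div_pos (by linarith) (by linarith)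
  have hD0 : 0 ≤ D := by positivity
  -- Young's inequality with `δ = (p - 1) / (2 p)` leaves half of the good term `(p - 1) a ^ p`
  have hmain : ∀ᵐ x ∂(volume.restrict Ω), a x ^ p ≤
      2 / (p - 1) * ((D + 1) * (b x ^ p + W x * |φ x| ^ p) - I x) := by
    filter_upwards [hid] with x ⟨ha0, X, hX, hIx⟩
    have hy := mul_le_mul_of_nonneg_left
      (rpow_sub_one_mul_le hp1 hδ ha0 (matNorm_nonneg (A x) (weakGrad Ω φ x))) hp.le
    have e : p * ((p - 1) / (2 * p) * a x ^ p + ((p - 1) / (2 * p)) ^ (1 - p) * b x ^ p)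
        = (p - 1) / 2 * a x ^ p + D * b x ^ p := by
      rw [hD]; field_simp
    rw [e] at hy
    obtain ⟨h1, h2⟩ := hE0 x
    have h4 := (abs_le.1 hX).2
    rw [div_mul_eq_mul_div, le_div_iff₀ (by linarith)]
    nlinarith [mul_nonneg hD0 h2]
  calc ∫ x in Ω, a x ^ p
      ≤ ∫ x in Ω, 2 / (p - 1) * ((D + 1) * (b x ^ p + W x * |φ x| ^ p) - I x) :=
        integral_mono_ae ia (((iE.const_mul (D + 1)).sub iI).const_mul _) hmain
    _ = 2 / (p - 1) * (D + 1) * energy Ω p A W φ := by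
        rw [integral_const_mul, integral_sub (iE.const_mul (D + 1)) iI, hweak, integral_const_mul,
          sub_zero, mul_assoc]
        rfl

end Admissible

/-! ### Truncation and the capacity inequality -/

/-- An even smooth function that vanishes on `[-1, 1]` and equals `1` off `(-2, 2)`. -/
def evenStep (r : ℝ) : ℝ := Real.smoothTransition (r - 1) + Real.smoothTransition (-r - 1)

theorem contDiff_evenStep : ContDiff ℝ 1 evenStep := by
  have h : ContDiff ℝ 1 Real.smoothTransition := Real.smoothTransition.contDiff (n := 1)
  exact (h.comp (contDiff_id.sub contDiff_const)).add (h.comp (contDiff_neg.sub contDiff_const))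

theorem evenStep_eq_zero {r : ℝ} (hr : |r| ≤ 1) : evenStep r = 0 := by
  obtain ⟨h1, h2⟩ := abs_le.1 hr
  rw [evenStep, Real.smoothTransition.zero_of_nonpos (by linarith),
    Real.smoothTransition.zero_of_nonpos (by linarith), add_zero]

theorem evenStep_eq_one {r : ℝ} (hr : 2 ≤ |r|) : evenStep r = 1 := by
  rcases le_abs.1 hr with h | h
  · rw [evenStep, Real.smoothTransition.one_of_one_le (by linarith),
      Real.smoothTransition.zero_of_nonpos (by linarith), add_zero]
  · rw [evenStep, Real.smoothTransition.zero_of_nonpos (by linarith),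
      Real.smoothTransition.one_of_one_le (by linarith), zero_add]

theorem evenStep_mem (r : ℝ) : evenStep r ∈ Icc (0 : ℝ) 1 := by
  refine ⟨add_nonneg (Real.smoothTransition.nonneg _) (Real.smoothTransition.nonneg _), ?_⟩
  rcases le_total 0 r with h | h
  · rw [evenStep, Real.smoothTransition.zero_of_nonpos (x := -r - 1) (by linarith), add_zero]
    exact Real.smoothTransition.le_one _
  · rw [evenStep, Real.smoothTransition.zero_of_nonpos (x := r - 1) (by linarith), zero_add]
    exact Real.smoothTransition.le_one _

theorem deriv_evenStep_eq_zero {r : ℝ} (hr : |r| < 1 ∨ 2 < |r|) : deriv evenStep r = 0 := by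
  rcases hr with hr | hr
  · have : evenStep =ᶠ[𝓝 r] fun _ => 0 :=
      (continuous_abs.continuousAt.eventually_lt continuousAt_const hr).mono
        fun y hy => evenStep_eq_zero hy.le
    rw [this.deriv_eq, deriv_const]
  · have : evenStep =ᶠ[𝓝 r] fun _ => 1 :=
      (continuousAt_const.eventually_lt continuous_abs.continuousAt hr).mono
        fun y hy => evenStep_eq_one hy.le
    rw [this.deriv_eq, deriv_const]

theorem exists_abs_deriv_evenStep_le : ∃ B : ℝ, 0 ≤ B ∧ ∀ r, |deriv evenStep r| ≤ B := by
  have hc : Continuous (deriv evenStep) := contDiff_evenStep.continuous_deriv le_rfl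
  obtain ⟨B, hB⟩ := (isCompact_Icc (a := (-2 : ℝ)) (b := 2)).exists_bound_of_continuousOn
    hc.continuousOn
  refine ⟨|B|, abs_nonneg B, fun r => ?_⟩
  by_cases hr : |r| ≤ 2
  · exact (hB r (abs_le.1 hr)).trans (le_abs_self B)
  · rw [deriv_evenStep_eq_zero (Or.inr (not_le.1 hr)), abs_zero]
    exact abs_nonneg B

section Admissible

variable {Ω : Set (E N)} {p : ℝ} {A : E N → Matrix (Fin N) (Fin N) ℝ} {V : E N → ℝ}

/-- The truncation of `φ` at the level `l u`: a test function with values between `0` and `u`,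
equal to `u` where `|φ| ≥ 2 l u` and to `0` where `|φ| ≤ l u`. Its energy density is controlled by
those of `φ` and `u` on `{l u ≤ |φ| ≤ 2 l u}`, and by that of `u` on `{l u ≤ |φ|}`. -/
theorem IsPositiveSolution.exists_truncation (h : IsAdmissible Ω p A V) {u : E N → ℝ}
    (hu : IsPositiveSolution Ω p A (posPot V) u) {φ : E N → ℝ} (hφ : IsTestFunction Ω p φ)
    {B : ℝ} (hB0 : 0 ≤ B) (hB : ∀ r, |deriv evenStep r| ≤ B) {l : ℝ} (hl : 0 < l) :
    ∃ ψ : E N → ℝ, IsTestFunction Ω p ψ ∧ (∀ x ∈ Ω, 2 * l ≤ |φ x| / u x → u x ≤ ψ x) ∧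
      ∀ᵐ x ∂(volume.restrict Ω),
        matNorm (A x) (weakGrad Ω ψ x) ^ p + posPot V x * |ψ x| ^ p ≤
          (if l ≤ |φ x| / u x ∧ |φ x| / u x ≤ 2 * l then
            l⁻¹ ^ p * ((B * (matNorm (A x) (weakGrad Ω φ x)) +
              (B + 1) * (|φ x| / u x * matNorm (A x) (weakGrad Ω u x))) ^ p
              + posPot V x * |φ x| ^ p) else 0) +
          (if l ≤ |φ x| / u x then
            matNorm (A x) (weakGrad Ω u x) ^ p + posPot V x * u x ^ p else 0) := by
  have hp := h.pos
  have hS := contDiff_evenStep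
  have hSd : ∀ r, HasDerivAt evenStep (deriv evenStep r) r := fun r =>
    (hS.differentiable one_ne_zero r).hasDerivAt
  -- `ψ = u χ(φ / (l u))`, where `χ` is the even step function
  obtain ⟨ψ, hψ, hψK, hψoff, hψg, hψg0⟩ := hφ.comp₂ h.isOpen hu.memW1pLoc hu.continuousOn hu.pos
    (F := fun a => a.2 * evenStep (a.1 / (l * a.2)))
    (F₁ := fun s t => l⁻¹ * deriv evenStep (s / (l * t)))
    (F₂ := fun s t => evenStep (s / (l * t)) - s / (l * t) * deriv evenStep (s / (l * t)))
    (fun s t ht => contDiffAt_snd.mul (hS.contDiffAt.comp (s, t) (contDiffAt_fst.div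
      (contDiffAt_const.mul contDiffAt_snd) (mul_pos hl ht).ne')))
    (fun t ht => by simp [evenStep_eq_zero])
    (fun s t ht => by
      have h1 : HasDerivAt (fun s : ℝ => s / (l * t)) (1 / (l * t)) s :=
        (hasDerivAt_id s).div_const _
      have h2 := ((hSd (s / (l * t))).comp s h1).const_mul t
      refine h2.congr_deriv ?_
      field_simp)
    (fun s t ht => by
      have h1 : HasDerivAt (fun t : ℝ => s / (l * t)) (-(s * l) / (l * t) ^ 2) t := by
        have := (hasDerivAt_const t s).div ((hasDerivAt_id t).const_mul l) (mul_pos hl ht).ne'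
        exact this.congr_deriv (by simp)
      have h2 := (hasDerivAt_id t).mul ((hSd (s / (l * t))).comp t h1)
      refine h2.congr_deriv ?_
      simp only [id, one_mul, Function.comp]
      field_simp
      ring)
  refine ⟨ψ, hψ, ?_, ?_⟩
  · intro x hxΩ hx
    have hux := hu.pos x hxΩ
    have hxK : x ∈ tsupport φ := by
      by_contra h0
      rw [image_eq_zero_of_notMem_tsupport h0] at hx
      simp at hx; linarith
    rw [hψK x hxK]
    simp only
    rw [evenStep_eq_one, mul_one]
    rw [abs_div, abs_of_pos (mul_pos hl hux), le_div_iff₀ (mul_pos hl hux)]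
    rw [le_div_iff₀ hux] at hx
    linarith
  · filter_upwards [hψg, hψg0, h.symm, h.ae_nonneg, ae_restrict_mem h.isOpen.measurableSet]
      with x hx hx0 hsx hnx hxΩ
    have hux := hu.pos x hxΩ
    have hW := posPot_nonneg V x
    set W := posPot V x
    set s := |φ x| / u x with hs
    have hs0 : 0 ≤ s := div_nonneg (abs_nonneg _) hux.le
    set m := matNorm (A x) (weakGrad Ω u x)
    set b := matNorm (A x) (weakGrad Ω φ x)
    have hm : 0 ≤ m := matNorm_nonneg _ _
    have hb : 0 ≤ b := matNorm_nonneg _ _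
    by_cases hxK : x ∈ tsupport φ
    swap
    · have h0 : φ x = 0 := image_eq_zero_of_notMem_tsupport hxK
      have hs00 : s = 0 := by rw [hs, h0]; simp
      rw [hx0 hxK, hψoff x hxK, hs00, if_neg (fun hc => by linarith [hc.1]), if_neg (by linarith)]
      simp [matNorm, Real.zero_rpow hp.ne']
    set r := φ x / (l * u x) with hr
    have hrs : |r| * l = s := by
      rw [hr, abs_div, abs_of_pos (mul_pos hl hux), hs]; field_simp
    have hψx : ψ x = u x * evenStep r := hψK x hxK
    obtain ⟨hS0, hS1⟩ := evenStep_mem r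
    have hψabs : |ψ x| = u x * evenStep r := by
      rw [hψx, abs_of_nonneg (mul_nonneg hux.le hS0)]
    have hgrad : matNorm (A x) (weakGrad Ω ψ x)
        ≤ l⁻¹ * |deriv evenStep r| * b + (evenStep r + |r| * |deriv evenStep r|) * m := by
      rw [hx hxK]
      refine (matNorm_add_le hsx hnx _ _).trans ?_
      rw [matNorm_smul, matNorm_smul, abs_mul, abs_of_pos (inv_pos.2 hl)]
      refine add_le_add le_rfl (mul_le_mul_of_nonneg_right ?_ hm)
      refine (abs_sub _ _).trans ?_
      rw [abs_of_nonneg hS0, abs_mul]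
    have hφs : |φ x| = s * u x := by rw [hs]; field_simp
    have hR0 : 0 ≤ m ^ p + W * u x ^ p := by positivity
    rcases lt_or_ge s l with hsl | hsl
    · have hr1 : |r| < 1 := by
        by_contra hc
        nlinarith [not_lt.1 hc]
      rw [evenStep_eq_zero hr1.le, deriv_evenStep_eq_zero (Or.inl hr1)] at hgrad
      rw [evenStep_eq_zero hr1.le] at hψabs
      have hg0 : matNorm (A x) (weakGrad Ω ψ x) = 0 :=
        le_antisymm (by simpa using hgrad) (matNorm_nonneg _ _)
      rw [hg0, hψabs, if_neg (fun hc => by linarith [hc.1]), if_neg (by linarith)]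
      simp [Real.zero_rpow hp.ne']
    rcases le_or_gt s (2 * l) with hsl2 | hsl2
    · rw [if_pos ⟨hsl, hsl2⟩, if_pos hsl]
      have h1 : matNorm (A x) (weakGrad Ω ψ x) ≤ l⁻¹ * (B * b + (B + 1) * (s * m)) := by
        refine hgrad.trans ?_
        have hd := hB r
        have e1 : |r| = l⁻¹ * s := by rw [← hrs]; field_simp
        have e2 : 1 ≤ l⁻¹ * s := by rwa [inv_mul_eq_div, le_div_iff₀ hl, one_mul]
        have hli : 0 ≤ l⁻¹ := (inv_pos.2 hl).le
        calc l⁻¹ * |deriv evenStep r| * b + (evenStep r + |r| * |deriv evenStep r|) * m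
            ≤ l⁻¹ * B * b + (l⁻¹ * s + l⁻¹ * s * B) * m := by
              rw [e1]
              gcongr
              exact hS1.trans e2
          _ = _ := by ring
      have h2 : |ψ x| ≤ l⁻¹ * |φ x| := by
        rw [hψabs, hφs, ← mul_assoc, inv_mul_eq_div, mul_comm]
        refine mul_le_mul_of_nonneg_right (hS1.trans ?_) hux.le
        rwa [le_div_iff₀ hl, one_mul]
      have hli : 0 ≤ l⁻¹ := (inv_pos.2 hl).le
      have h3 : matNorm (A x) (weakGrad Ω ψ x) ^ p
          ≤ l⁻¹ ^ p * (B * b + (B + 1) * (s * m)) ^ p := by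
        rw [← Real.mul_rpow hli (by positivity)]
        exact Real.rpow_le_rpow (matNorm_nonneg _ _) h1 hp.le
      have h4 : W * |ψ x| ^ p ≤ l⁻¹ ^ p * (W * |φ x| ^ p) := by
        calc W * |ψ x| ^ p ≤ W * (l⁻¹ * |φ x|) ^ p := by gcongr
          _ = _ := by rw [Real.mul_rpow hli (abs_nonneg _)]; ring
      rw [mul_add]
      linarith
    · have hr2 : 2 < |r| := by
        by_contra hc
        nlinarith [not_lt.1 hc]
      rw [evenStep_eq_one hr2.le, deriv_evenStep_eq_zero (Or.inr hr2)] at hgrad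
      rw [evenStep_eq_one hr2.le, mul_one] at hψabs
      rw [if_neg (fun hc => by linarith [hc.2]), if_pos hsl, zero_add, hψabs]
      simp only [abs_zero, mul_zero, zero_mul, add_zero, zero_add, one_mul] at hgrad
      gcongr
      exact matNorm_nonneg _ _

theorem IsHardyWeight.exists_lintegral_le (h : IsAdmissible Ω p A V) {g : E N → ℝ}
    (hg : IsHardyWeight Ω p A (posPot V) g) : ∃ C : ℝ, 0 < C ∧ ∀ φ, IsTestFunction Ω p φ →
      ∫⁻ x in Ω, ENNReal.ofReal (|g x| * |φ x| ^ p)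
        ≤ ENNReal.ofReal C * ENNReal.ofReal (energy Ω p A (posPot V) φ) := by
  obtain ⟨hgl, C, hC, hle⟩ := hg
  refine ⟨C, hC, fun φ hφ => ?_⟩
  rw [← ofReal_integral_eq_lintegral_ofReal (h.integrable_mul_rpow hgl hφ)
    (Eventually.of_forall fun x => by positivity), ← ENNReal.ofReal_mul hC.le]
  exact ENNReal.ofReal_le_ofReal (hle φ hφ)

/-- The Hardy norm bounds `∫_F |g| u^p` by the energy of any competitor for the capacity of `F`.
Sets of zero capacity, which the norm ignores, are null for a Hardy-weight. -/
theorem IsHardyWeight.lintegral_le_hardyNorm_mul (h : IsAdmissible Ω p A V) {g u : E N → ℝ}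
    (hg : IsHardyWeight Ω p A (posPot V) g) (hpos : ∀ x ∈ Ω, 0 < u x) {F : Set (E N)}
    (hF : IsCompact F) (hFΩ : F ⊆ Ω) {ψ : E N → ℝ} (hψ : IsTestFunction Ω p ψ)
    (hψF : ∀ x ∈ F, u x ≤ ψ x) :
    ∫⁻ x in F, ENNReal.ofReal (|g x| * |u x| ^ p)
      ≤ hardyNorm Ω p A (posPot V) u g * ENNReal.ofReal (energy Ω p A (posPot V) ψ) := by
  set S := energy Ω p A (posPot V) '' {φ | IsTestFunction Ω p φ ∧ ∀ x ∈ F, u x ≤ φ x} with hS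
  have hcap : capacity Ω p A (posPot V) u F = sInf S := rfl
  have hbdd : BddBelow S := ⟨0, by rintro _ ⟨φ, -, rfl⟩; exact energy_nonneg φ⟩
  have hne : S.Nonempty := ⟨_, ψ, ⟨hψ, hψF⟩, rfl⟩
  have hcap0 : 0 ≤ sInf S := Real.sInf_nonneg (by rintro _ ⟨φ, -, rfl⟩; exact energy_nonneg φ)
  by_cases hz : capacity Ω p A (posPot V) u F = 0
  · obtain ⟨C, hC, hle⟩ := hg.exists_lintegral_le h
    suffices H : ∫⁻ x in F, ENNReal.ofReal (|g x| * |u x| ^ p) = 0 by rw [H]; exact zero_le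
    refine le_antisymm ?_ zero_le
    have key : ∀ e ∈ S, ∫⁻ x in F, ENNReal.ofReal (|g x| * |u x| ^ p) ≤ ENNReal.ofReal (C * e) := by
      rintro _ ⟨φ, ⟨hφ, hφF⟩, rfl⟩
      rw [ENNReal.ofReal_mul hC.le]
      refine le_trans ?_ (hle φ hφ)
      refine le_trans ?_ (lintegral_mono_set hFΩ)
      refine setLIntegral_mono' hF.measurableSet fun x hx => ENNReal.ofReal_le_ofReal ?_
      have h1 : |u x| ≤ |φ x| := by
        rw [abs_of_pos (hpos x (hFΩ hx))]
        exact (hφF x hx).trans (le_abs_self _)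
      have := h.pos.le
      gcongr
    refine ENNReal.le_of_forall_pos_le_add fun ε hε _ => ?_
    obtain ⟨e, heS, he⟩ := exists_lt_of_csInf_lt hne (show sInf S < ε / C by
      rw [← hcap, hz]; exact div_pos hε hC)
    rw [zero_add]
    refine (key e heS).trans ?_
    rw [← ENNReal.ofReal_coe_nnreal]
    refine ENNReal.ofReal_le_ofReal ?_
    rw [lt_div_iff₀ hC] at he
    linarith
  · have h1 : (∫⁻ x in F, ENNReal.ofReal (|g x| * |u x| ^ p))
        / ENNReal.ofReal (capacity Ω p A (posPot V) u F) ≤ hardyNorm Ω p A (posPot V) u g :=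
      le_iSup_of_le F (le_iSup_of_le hF (le_iSup_of_le hFΩ (le_iSup_of_le hz le_rfl)))
    have h2 : ENNReal.ofReal (capacity Ω p A (posPot V) u F) ≠ 0 := by
      rw [Ne, ENNReal.ofReal_eq_zero, not_le]
      exact lt_of_le_of_ne hcap0 (Ne.symm hz)
    rw [ENNReal.div_le_iff h2 ENNReal.ofReal_ne_top] at h1
    refine h1.trans (mul_le_mul' le_rfl (ENNReal.ofReal_le_ofReal ?_))
    exact csInf_le hbdd ⟨ψ, ⟨hψ, hψF⟩, rfl⟩

end Admissible

/-! ### The capacity inequality of Maz'ya type -/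

section LayerCake

variable {α : Type*} {mα : MeasurableSpace α}

/-- The integrand is at most `2ᵖ / t ≤ 2ᵖ / s` and vanishes off `[s, 2 s]`. -/
theorem lintegral_rpow_mul_shell_le {p : ℝ} (s : ℝ) :
    ∫⁻ t in Ioi (0 : ℝ), ENNReal.ofReal (t ^ (p - 1)) *
      (if t / 2 ≤ s ∧ s ≤ t then ENNReal.ofReal ((t / 2)⁻¹ ^ p) else 0)
      ≤ ENNReal.ofReal (2 ^ p) := by
  rcases le_or_gt s 0 with hs | hs
  · refine le_trans (le_of_eq ?_) zero_le
    refine (setLIntegral_congr_fun (g := fun _ => 0) measurableSet_Ioi fun t ht => ?_).trans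
      lintegral_zero
    rw [mem_Ioi] at ht
    simp only
    rw [if_neg (fun hc => by linarith [hc.1]), mul_zero]
  · calc ∫⁻ t in Ioi (0 : ℝ), ENNReal.ofReal (t ^ (p - 1)) *
          (if t / 2 ≤ s ∧ s ≤ t then ENNReal.ofReal ((t / 2)⁻¹ ^ p) else 0)
        ≤ ∫⁻ t in Ioi (0 : ℝ), (Icc s (2 * s)).indicator
            (fun _ => ENNReal.ofReal (2 ^ p * s⁻¹)) t := by
          refine setLIntegral_mono' measurableSet_Ioi fun t ht => ?_
          rw [mem_Ioi] at ht
          by_cases hts : t / 2 ≤ s ∧ s ≤ t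
          · rw [if_pos hts, indicator_of_mem (show t ∈ Icc s (2 * s) from
              ⟨hts.2, by linarith [hts.1]⟩), ← ENNReal.ofReal_mul (by positivity)]
            refine ENNReal.ofReal_le_ofReal ?_
            rw [inv_div, Real.div_rpow two_pos.le ht.le, Real.rpow_sub_one ht.ne']
            have h1 : 0 < t ^ p := Real.rpow_pos_of_pos ht p
            calc t ^ p / t * (2 ^ p / t ^ p) = 2 ^ p * t⁻¹ := by field_simp
              _ ≤ 2 ^ p * s⁻¹ := by have := hts.2; gcongr
          · rw [if_neg hts, mul_zero]; exact zero_le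
      _ ≤ ∫⁻ t, (Icc s (2 * s)).indicator (fun _ => ENNReal.ofReal (2 ^ p * s⁻¹)) t :=
          setLIntegral_le_lintegral _ _
      _ = ENNReal.ofReal (2 ^ p) := by
          rw [lintegral_indicator measurableSet_Icc, setLIntegral_const, Real.volume_Icc,
            ← ENNReal.ofReal_mul (by positivity)]
          congr 1
          field_simp
          ring

theorem lintegral_rpow_mul_superlevel_le {p : ℝ} (hp : 1 < p) (s : ℝ) :
    ∫⁻ t in Ioi (0 : ℝ), ENNReal.ofReal (t ^ (p - 1)) * (if t / 2 ≤ s then 1 else 0)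
      ≤ ENNReal.ofReal (2 ^ p) * ENNReal.ofReal (s ^ p) := by
  rcases le_or_gt s 0 with hs | hs
  · refine le_trans (le_of_eq ?_) zero_le
    refine (setLIntegral_congr_fun (g := fun _ => 0) measurableSet_Ioi fun t ht => ?_).trans
      lintegral_zero
    rw [mem_Ioi] at ht
    simp only
    rw [if_neg (fun hc => by linarith), mul_zero]
  · calc ∫⁻ t in Ioi (0 : ℝ), ENNReal.ofReal (t ^ (p - 1)) * (if t / 2 ≤ s then 1 else 0)
        ≤ ∫⁻ t in Ioi (0 : ℝ), (Icc 0 (2 * s)).indicator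
            (fun _ => ENNReal.ofReal ((2 * s) ^ (p - 1))) t := by
          refine setLIntegral_mono' measurableSet_Ioi fun t ht => ?_
          rw [mem_Ioi] at ht
          by_cases hts : t / 2 ≤ s
          · rw [if_pos hts, indicator_of_mem (show t ∈ Icc 0 (2 * s) from
              ⟨ht.le, by linarith⟩), mul_one]
            refine ENNReal.ofReal_le_ofReal ?_
            exact Real.rpow_le_rpow ht.le (by linarith) (by linarith)
          · rw [if_neg hts, mul_zero]; exact zero_le
      _ ≤ ∫⁻ t, (Icc 0 (2 * s)).indicator (fun _ => ENNReal.ofReal ((2 * s) ^ (p - 1))) t :=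
          setLIntegral_le_lintegral _ _
      _ = ENNReal.ofReal (2 ^ p) * ENNReal.ofReal (s ^ p) := by
          rw [lintegral_indicator measurableSet_Icc, setLIntegral_const, Real.volume_Icc,
            ← ENNReal.ofReal_mul (by positivity), ← ENNReal.ofReal_mul (by positivity),
            ← Real.mul_rpow two_pos.le hs.le, Real.rpow_sub_one (by positivity)]
          congr 1
          field_simp
          ring

/-- A layer cake estimate: if the measure of the superlevel sets `{t ≤ s}` is bounded by the
integral of `(t/2)⁻ᵖ P` over the shell `{t/2 ≤ s ≤ t}` plus that of `R` over `{t/2 ≤ s}`, then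
`∫ sᵖ` is bounded by the integral of `P + sᵖ R`. The shells are dyadic, so that every point lies in
them for a set of parameters `t` of bounded measure with respect to `dt/t`. -/
theorem lintegral_rpow_le_of_superlevel_le {μ ν : Measure α} [SFinite μ] {s : α → ℝ}
    (hs : Measurable s) (hs0 : ∀ x, 0 ≤ s x) {P R : α → ℝ≥0∞} (hP : AEMeasurable P μ)
    (hR : AEMeasurable R μ) {p : ℝ} (hp : 1 < p) {κ : ℝ≥0∞}
    (H : ∀ t : ℝ, 0 < t → ν {x | t ≤ s x} ≤
      κ * ∫⁻ x, ((if t / 2 ≤ s x ∧ s x ≤ t then ENNReal.ofReal ((t / 2)⁻¹ ^ p) else 0) * P x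
        + (if t / 2 ≤ s x then 1 else 0) * R x) ∂μ) :
    ∫⁻ x, ENNReal.ofReal (s x ^ p) ∂ν
      ≤ ENNReal.ofReal (p * 2 ^ p) * κ * ∫⁻ x, (P x + ENNReal.ofReal (s x ^ p) * R x) ∂μ := by
  have hp0 : 0 < p := zero_lt_one.trans hp
  set K₁ : ℝ → α → ℝ≥0∞ := fun t x =>
    if t / 2 ≤ s x ∧ s x ≤ t then ENNReal.ofReal ((t / 2)⁻¹ ^ p) else 0
  set K₂ : ℝ → α → ℝ≥0∞ := fun t x => if t / 2 ≤ s x then 1 else 0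
  have hs2 : Measurable fun a : ℝ × α => s a.2 := hs.comp measurable_snd
  have ht2 : Measurable fun a : ℝ × α => a.1 / 2 := measurable_fst.div_const 2
  have hK₁ : Measurable (Function.uncurry K₁) :=
    Measurable.ite ((measurableSet_le ht2 hs2).inter (measurableSet_le hs2 measurable_fst))
      ((ht2.inv.pow_const p).ennreal_ofReal) measurable_const
  have hK₂ : Measurable (Function.uncurry K₂) :=
    Measurable.ite (measurableSet_le ht2 hs2) measurable_const measurable_const
  have hT : Measurable fun t : ℝ => ENNReal.ofReal (t ^ (p - 1)) :=
    (measurable_id.pow_const (p - 1)).ennreal_ofReal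
  have hTK₁ : Measurable fun a : ℝ × α => ENNReal.ofReal (a.1 ^ (p - 1)) * K₁ a.1 a.2 :=
    (hT.comp measurable_fst).mul hK₁
  have hTK₂ : Measurable fun a : ℝ × α => ENNReal.ofReal (a.1 ^ (p - 1)) * K₂ a.1 a.2 :=
    (hT.comp measurable_fst).mul hK₂
  rw [lintegral_rpow_eq_lintegral_meas_le_mul ν (Eventually.of_forall hs0) hs.aemeasurable hp0]
  have hJ : AEMeasurable (Function.uncurry fun t x => ENNReal.ofReal (t ^ (p - 1)) * K₁ t x * P x
      + ENNReal.ofReal (t ^ (p - 1)) * K₂ t x * R x) ((volume.restrict (Ioi (0 : ℝ))).prod μ) :=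
    (hTK₁.aemeasurable.mul hP.comp_snd).add (hTK₂.aemeasurable.mul hR.comp_snd)
  have e1 : ∫⁻ t in Ioi (0 : ℝ), ν {x | t ≤ s x} * ENNReal.ofReal (t ^ (p - 1))
      ≤ κ * ∫⁻ t in Ioi (0 : ℝ), ∫⁻ x, (ENNReal.ofReal (t ^ (p - 1)) * K₁ t x * P x
        + ENNReal.ofReal (t ^ (p - 1)) * K₂ t x * R x) ∂μ := by
    refine le_trans ?_ (lintegral_const_mul'' κ hJ.lintegral_prod_right').le
    refine setLIntegral_mono' measurableSet_Ioi fun t ht => ?_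
    refine (mul_le_mul' (H t ht) le_rfl).trans (le_of_eq ?_)
    rw [mul_assoc, ← lintegral_mul_const' _ _ ENNReal.ofReal_ne_top]
    congr 1
    refine lintegral_congr fun x => ?_
    simp only [Function.uncurry_apply_pair, K₁, K₂]
    ring
  have e2 : ∫⁻ t in Ioi (0 : ℝ), ∫⁻ x, (ENNReal.ofReal (t ^ (p - 1)) * K₁ t x * P x
        + ENNReal.ofReal (t ^ (p - 1)) * K₂ t x * R x) ∂μ
      ≤ ENNReal.ofReal (2 ^ p) * ∫⁻ x, (P x + ENNReal.ofReal (s x ^ p) * R x) ∂μ := by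
    rw [lintegral_lintegral_swap]
    · rw [← lintegral_const_mul' _ _ ENNReal.ofReal_ne_top]
      refine lintegral_mono fun x => ?_
      have m₁ : Measurable fun t => ENNReal.ofReal (t ^ (p - 1)) * K₁ t x :=
        hTK₁.comp (measurable_id.prodMk measurable_const)
      have m₂ : Measurable fun t => ENNReal.ofReal (t ^ (p - 1)) * K₂ t x :=
        hTK₂.comp (measurable_id.prodMk measurable_const)
      rw [lintegral_add_left (m₁.mul_const _), lintegral_mul_const _ m₁, lintegral_mul_const _ m₂,
        mul_add, ← mul_assoc]
      exact add_le_add (mul_le_mul' (lintegral_rpow_mul_shell_le (s x)) le_rfl)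
        (mul_le_mul' (lintegral_rpow_mul_superlevel_le hp (s x)) le_rfl)
    · exact hJ
  calc ENNReal.ofReal p * ∫⁻ t in Ioi (0 : ℝ), ν {x | t ≤ s x} * ENNReal.ofReal (t ^ (p - 1))
      ≤ ENNReal.ofReal p * (κ * (ENNReal.ofReal (2 ^ p) *
          ∫⁻ x, (P x + ENNReal.ofReal (s x ^ p) * R x) ∂μ)) :=
        mul_le_mul' le_rfl (e1.trans (mul_le_mul' le_rfl e2))
    _ = _ := by rw [ENNReal.ofReal_mul hp0.le]; ring

end LayerCake

section Admissible

variable {Ω : Set (E N)} {p : ℝ} {A : E N → Matrix (Fin N) (Fin N) ℝ} {V : E N → ℝ}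

/-- The energy of the truncations of `φ`, integrated over all levels, is bounded by that of `φ`. -/
theorem IsPositiveSolution.lintegral_truncation_le (h : IsAdmissible Ω p A V) {u : E N → ℝ}
    (hu : IsPositiveSolution Ω p A (posPot V) u) {B : ℝ} (hB0 : 0 ≤ B) :
    ∃ C : ℝ, ∀ φ, IsTestFunction Ω p φ → ∫⁻ x in Ω,
      (ENNReal.ofReal ((B * (matNorm (A x) (weakGrad Ω φ x)) +
          (B + 1) * (|φ x| / u x * matNorm (A x) (weakGrad Ω u x))) ^ p + posPot V x * |φ x| ^ p)
        + ENNReal.ofReal ((|φ x| / u x) ^ p) *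
          ENNReal.ofReal (matNorm (A x) (weakGrad Ω u x) ^ p + posPot V x * u x ^ p))
      ≤ ENNReal.ofReal C * ENNReal.ofReal (energy Ω p A (posPot V) φ) := by
  have hp := h.pos
  set D := 2 / (p - 1) * (p * ((p - 1) / (2 * p)) ^ (1 - p) + 1) with hD
  have hp1 : 0 < p - 1 := sub_pos.2 h.one_lt
  have hD0 : 0 ≤ D := by positivity
  set c := (2 * (B + 1)) ^ p with hc
  have hc0 : 0 ≤ c := by positivity
  refine ⟨(c + 2) + (c + 1) * D, fun φ hφ => ?_⟩
  have i1 := integrable_energy h hφ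
  have i2 := integrable_ratio_rpow h hu hφ
  have hle : (∫ x in Ω, ((c + 2) * (matNorm (A x) (weakGrad Ω φ x) ^ p + posPot V x * |φ x| ^ p)
      + (c + 1) * (|φ x| / u x * matNorm (A x) (weakGrad Ω u x)) ^ p))
      ≤ ((c + 2) + (c + 1) * D) * energy Ω p A (posPot V) φ := by
    rw [integral_add (i1.const_mul _) (i2.const_mul _), integral_const_mul, integral_const_mul]
    have := mul_le_mul_of_nonneg_left (hu.integral_ratio_le h hφ) (by positivity : 0 ≤ c + 1)
    have e : energy Ω p A (posPot V) φ
      = ∫ x in Ω, (matNorm (A x) (weakGrad Ω φ x) ^ p + posPot V x * |φ x| ^ p) := rfl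
    rw [← e, add_mul]
    linarith
  rw [← ENNReal.ofReal_mul (by positivity)]
  refine le_trans ?_ (ENNReal.ofReal_le_ofReal hle)
  have i3 : Integrable (fun x =>
      (c + 2) * (matNorm (A x) (weakGrad Ω φ x) ^ p + posPot V x * |φ x| ^ p)
      + (c + 1) * (|φ x| / u x * matNorm (A x) (weakGrad Ω u x)) ^ p) (volume.restrict Ω) :=
    (i1.const_mul _).add (i2.const_mul _)
  rw [ofReal_integral_eq_lintegral_ofReal i3]
  · refine setLIntegral_mono' h.isOpen.measurableSet fun x hxΩ => ?_
    have hux := hu.pos x hxΩ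
    have hW := posPot_nonneg V x
    set W := posPot V x
    set m := matNorm (A x) (weakGrad Ω u x)
    set b := matNorm (A x) (weakGrad Ω φ x)
    have hm : 0 ≤ m := matNorm_nonneg _ _
    have hb : 0 ≤ b := matNorm_nonneg _ _
    set s := |φ x| / u x with hs
    have hs0 : 0 ≤ s := div_nonneg (abs_nonneg _) hux.le
    have hsm : 0 ≤ s * m := mul_nonneg hs0 hm
    rw [← ENNReal.ofReal_mul (by positivity), ← ENNReal.ofReal_add (by positivity) (by positivity)]
    refine ENNReal.ofReal_le_ofReal ?_
    -- `B b + (B + 1) s m ≤ 2 (B + 1) max b (s m)`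
    have h1 : (B * b + (B + 1) * (s * m)) ^ p ≤ c * (b ^ p + (s * m) ^ p) := by
      have hmax : 0 ≤ max b (s * m) := hb.trans (le_max_left _ _)
      calc (B * b + (B + 1) * (s * m)) ^ p ≤ (2 * (B + 1) * max b (s * m)) ^ p := by
            refine Real.rpow_le_rpow (by positivity) ?_ hp.le
            nlinarith [mul_le_mul_of_nonneg_left (le_max_left b (s * m)) hB0,
              mul_le_mul_of_nonneg_left (le_max_right b (s * m)) (by linarith : 0 ≤ B + 1)]
        _ = c * max b (s * m) ^ p := by rw [Real.mul_rpow (by positivity) hmax]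
        _ ≤ c * (b ^ p + (s * m) ^ p) := by
            refine mul_le_mul_of_nonneg_left ?_ hc0
            rcases max_choice b (s * m) with he | he <;> rw [he]
            · exact le_add_of_nonneg_right (by positivity)
            · exact le_add_of_nonneg_left (by positivity)
    have h2 : s ^ p * (m ^ p + W * u x ^ p) = (s * m) ^ p + W * |φ x| ^ p := by
      have : |φ x| = s * u x := by rw [hs]; field_simp
      rw [this, Real.mul_rpow hs0 hm, Real.mul_rpow hs0 hux.le]
      ring
    have h3 : 0 ≤ b ^ p := by positivity
    have h4 : 0 ≤ W * |φ x| ^ p := by positivity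
    rw [h2]
    nlinarith [mul_nonneg hc0 h4]
  · filter_upwards [ae_restrict_mem h.isOpen.measurableSet] with x hxΩ
    have := hu.pos x hxΩ
    have h1 := matNorm_nonneg (A x) (weakGrad Ω u x)
    have h2 := matNorm_nonneg (A x) (weakGrad Ω φ x)
    have h3 := posPot_nonneg V x
    simp only [Pi.zero_apply]
    positivity

/-- An inequality of Maz'ya type: the best constant in the Hardy inequality is bounded by a multiple
of the Hardy norm, with a factor that does not depend on the weight. -/
theorem IsPositiveSolution.exists_lintegral_le_hardyNorm_mul (h : IsAdmissible Ω p A V)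
    {u : E N → ℝ} (hu : IsPositiveSolution Ω p A (posPot V) u) :
    ∃ C : ℝ, ∀ w, IsHardyWeight Ω p A (posPot V) w → ∀ φ, IsTestFunction Ω p φ →
      ∫⁻ x in Ω, ENNReal.ofReal (|w x| * |φ x| ^ p)
        ≤ ENNReal.ofReal C * hardyNorm Ω p A (posPot V) u w
          * ENNReal.ofReal (energy Ω p A (posPot V) φ) := by
  obtain ⟨B, hB0, hB⟩ := exists_abs_deriv_evenStep_le
  obtain ⟨D, hD⟩ := hu.lintegral_truncation_le h hB0
  have hp := h.pos
  refine ⟨p * 2 ^ p * D, fun w hw φ hφ => ?_⟩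
  have hKΩ := hφ.tsupport_subset
  have hK : IsCompact (tsupport φ) := hφ.hasCompactSupport
  have hKm := (isClosed_tsupport φ).measurableSet
  have hΩm := h.isOpen.measurableSet
  have hratio : ContinuousOn (fun x => |φ x| / u x) (tsupport φ) :=
    hφ.continuous.abs.continuousOn.div (hu.continuousOn.mono hKΩ) fun x hx =>
      (hu.pos x (hKΩ hx)).ne'
  -- the indicator function makes the quotient measurable on the whole space
  set s : E N → ℝ := (tsupport φ).indicator fun x => |φ x| / u x with hs
  have hsm : Measurable s := by
    classical
    rw [hs, ← piecewise_eq_indicator]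
    exact hratio.measurable_piecewise continuousOn_const hKm
  have hs0 : ∀ x, 0 ≤ s x := fun x => indicator_nonneg
    (fun x hx => div_nonneg (abs_nonneg _) (hu.pos x (hKΩ hx)).le) x
  have hse : ∀ x, s x = |φ x| / u x := by
    intro x
    by_cases hx : x ∈ tsupport φ
    · exact indicator_of_mem hx _
    · rw [hs, indicator_of_notMem hx, image_eq_zero_of_notMem_tsupport hx]
      simp
  have hum : AEMeasurable u (volume.restrict Ω) := hu.continuousOn.aemeasurable hΩm
  have hwm : AEMeasurable w (volume.restrict Ω) := hw.1.aestronglyMeasurable.aemeasurable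
  have hWm : AEMeasurable (posPot V) (volume.restrict Ω) :=
    aemeasurable_const.max h.morrey.1.aestronglyMeasurable.aemeasurable
  have hUm := h.aemeasurable_matNorm
    hu.memW1pLoc.hasWeakGrad.locIntGrad.aestronglyMeasurable.aemeasurable
  have hFm := h.aemeasurable_matNorm (hφ.memLp_weakGrad h.isOpen).aestronglyMeasurable.aemeasurable
  have hφm : AEMeasurable φ (volume.restrict Ω) := hφ.continuous.measurable.aemeasurable
  have hden : AEMeasurable (fun x => ENNReal.ofReal (|w x| * |u x| ^ p)) (volume.restrict Ω) :=
    (hwm.norm.mul (hum.norm.pow_const p)).ennreal_ofReal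
  set ν := (volume.restrict Ω).withDensity fun x => ENNReal.ofReal (|w x| * |u x| ^ p) with hν
  have hP : AEMeasurable (fun x => ENNReal.ofReal ((B * (matNorm (A x) (weakGrad Ω φ x)) +
      (B + 1) * (|φ x| / u x * matNorm (A x) (weakGrad Ω u x))) ^ p + posPot V x * |φ x| ^ p))
      (volume.restrict Ω) :=
    (((((hFm.const_mul B).add (((hφm.norm.div hum).mul hUm).const_mul (B + 1))).pow_const p)).add
      (hWm.mul (hφm.norm.pow_const p))).ennreal_ofReal
  have hR : AEMeasurable (fun x => ENNReal.ofReal (matNorm (A x) (weakGrad Ω u x) ^ p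
      + posPot V x * u x ^ p)) (volume.restrict Ω) :=
    ((hUm.pow_const p).add (hWm.mul (hum.pow_const p))).ennreal_ofReal
  have main := lintegral_rpow_le_of_superlevel_le (ν := ν) hsm hs0 hP hR h.one_lt
    (κ := hardyNorm Ω p A (posPot V) u w) (fun t ht => by
      have hFe : {x | t ≤ s x} = tsupport φ ∩ (fun x => |φ x| / u x) ⁻¹' Ici t := by
        ext x
        refine ⟨fun hx => ?_, fun hx => ?_⟩
        · have hxK : x ∈ tsupport φ := by
            by_contra h0
            rw [mem_ofPred_eq, hs, indicator_of_notMem h0] at hx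
            linarith
          exact ⟨hxK, by rw [mem_ofPred_eq, hse] at hx; exact hx⟩
        · rw [mem_ofPred_eq, hse]; exact hx.2
      have hFc : IsCompact {x | t ≤ s x} := by
        rw [hFe]
        exact hK.of_isClosed_subset (hratio.preimage_isClosed_of_isClosed (isClosed_tsupport φ)
          isClosed_Ici) inter_subset_left
      have hFΩ : {x | t ≤ s x} ⊆ Ω := by
        rw [hFe]; exact inter_subset_left.trans hKΩ
      obtain ⟨ψ, hψ, hψF, hψd⟩ := hu.exists_truncation h hφ hB0 hB (half_pos ht)
      rw [hν, withDensity_apply _ hFc.measurableSet, Measure.restrict_restrict hFc.measurableSet,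
        inter_eq_left.2 hFΩ]
      refine (hw.lintegral_le_hardyNorm_mul h hu.pos hFc hFΩ hψ fun x hx => ?_).trans
        (mul_le_mul' le_rfl ?_)
      · refine hψF x (hFΩ hx) ?_
        rw [mem_ofPred_eq, hse] at hx
        linarith
      · rw [ofReal_energy h hψ]
        refine lintegral_mono_ae ?_
        filter_upwards [hψd] with x hx
        rw [mul_div_cancel₀ t two_ne_zero] at hx
        rw [hse]
        refine (ENNReal.ofReal_le_ofReal hx).trans (ENNReal.ofReal_add_le.trans (add_le_add ?_ ?_))
        · split_ifs
          · rw [ENNReal.ofReal_mul (by positivity)]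
          · simp
        · split_ifs <;> simp)
  have e1 : ∫⁻ x in Ω, ENNReal.ofReal (|w x| * |φ x| ^ p) = ∫⁻ x, ENNReal.ofReal (s x ^ p) ∂ν := by
    rw [hν, lintegral_withDensity_eq_lintegral_mul₀ hden
      (hsm.pow_const p).ennreal_ofReal.aemeasurable]
    refine setLIntegral_congr_fun hΩm fun x hxΩ => ?_
    have hux := hu.pos x hxΩ
    simp only [Pi.mul_apply]
    rw [← ENNReal.ofReal_mul (by positivity), hse, mul_assoc, abs_of_pos hux,
      ← Real.mul_rpow hux.le (by positivity), mul_div_cancel₀ _ hux.ne']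
  rw [e1]
  refine main.trans ?_
  have hD' := hD φ hφ
  simp only [hse]
  calc _ ≤ ENNReal.ofReal (p * 2 ^ p) * hardyNorm Ω p A (posPot V) u w *
        (ENNReal.ofReal D * ENNReal.ofReal (energy Ω p A (posPot V) φ)) := mul_le_mul' le_rfl hD'
    _ = _ := by rw [ENNReal.ofReal_mul (p := p * 2 ^ p) (by positivity)]; ring

end Admissible

/-! ### Compactness of the functional -/

theorem ofReal_abs_mul_abs_rpow {p : ℝ} (hp : 0 ≤ p) (a b : ℝ) :
    ENNReal.ofReal (|a| * |b| ^ p) = ‖a‖ₑ * ‖b‖ₑ ^ p := by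
  rw [ENNReal.ofReal_mul (abs_nonneg _), ← Real.enorm_eq_ofReal_abs,
    ← enorm_rpow_eq_ofReal hp]

theorem MemLinftyC.exists_lintegral_le {Ω : Set (E N)} {g : E N → ℝ} (hg : MemLinftyC Ω g)
    (p : ℝ) : ∃ C : ℝ≥0∞, C ≠ ⊤ ∧ ∃ K : Set (E N), IsCompact K ∧ K ⊆ Ω ∧ ∀ f : E N → ℝ,
      ∫⁻ x in Ω, ‖g x‖ₑ * ‖f x‖ₑ ^ p ≤ C * ∫⁻ x in K, ‖f x‖ₑ ^ p := by
  obtain ⟨hb, K, hK, hKΩ, h0⟩ := hg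
  refine ⟨eLpNorm g ⊤ (volume.restrict Ω), hb.eLpNorm_ne_top, K, hK, hKΩ, fun f => ?_⟩
  have hr : (volume.restrict Ω).restrict K = volume.restrict K := by
    rw [Measure.restrict_restrict hK.measurableSet, inter_eq_left.2 hKΩ]
  rw [← lintegral_const_mul' _ _ hb.eLpNorm_ne_top, ← hr, ← lintegral_indicator hK.measurableSet]
  refine lintegral_mono_ae ?_
  filter_upwards [h0, enorm_ae_le_eLpNormEssSup g (volume.restrict Ω)] with x hx hle
  by_cases hxK : x ∈ K
  · rw [indicator_of_mem hxK, eLpNorm_exponent_top]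
    exact mul_le_mul' hle le_rfl
  · rw [hx hxK]
    simp

section Admissible

variable {Ω : Set (E N)} {p : ℝ} {A : E N → Matrix (Fin N) (Fin N) ℝ} {V : E N → ℝ}

theorem IsHardyWeight.sub (h : IsAdmissible Ω p A V) {g w : E N → ℝ}
    (hg : IsHardyWeight Ω p A (posPot V) g) (hw : IsHardyWeight Ω p A (posPot V) w) :
    IsHardyWeight Ω p A (posPot V) (g - w) := by
  obtain ⟨hgl, C, hC, hCle⟩ := hg
  obtain ⟨hwl, D, hD, hDle⟩ := hw
  have hl := hgl.sub hwl
  refine ⟨hl, C + D, add_pos hC hD, fun φ hφ => ?_⟩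
  have i1 := h.integrable_mul_rpow hgl hφ
  have i2 := h.integrable_mul_rpow hwl hφ
  calc ∫ x in Ω, |(g - w) x| * |φ x| ^ p
      ≤ ∫ x in Ω, (|g x| * |φ x| ^ p + |w x| * |φ x| ^ p) := by
        refine integral_mono (h.integrable_mul_rpow hl hφ) (i1.add i2) fun x => ?_
        simp only [Pi.sub_apply]
        rw [← add_mul]
        exact mul_le_mul_of_nonneg_right (abs_sub _ _) (by positivity)
    _ ≤ (C + D) * energy Ω p A (posPot V) φ := by
        rw [integral_add i1 i2, add_mul]
        exact add_le_add (hCle φ hφ) (hDle φ hφ)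

theorem IsHardyWeight.exists_lintegral_fn_le (h : IsAdmissible Ω p A V)
    (hsub : IsSubcritical Ω p A (posPot V)) {g : E N → ℝ}
    (hg : IsHardyWeight Ω p A (posPot V) g) : ∃ C : ℝ≥0∞, C ≠ ⊤ ∧ ∀ x : BeppoLevi h,
      ∫⁻ y in Ω, ‖g y‖ₑ * ‖BeppoLevi.fn x y‖ₑ ^ p ≤ C * ‖x‖ₑ ^ p := by
  obtain ⟨C, -, hle⟩ := hg.exists_lintegral_le h
  refine ⟨ENNReal.ofReal C, ENNReal.ofReal_ne_top, BeppoLevi.lintegral_le h hsub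
    hg.1.aestronglyMeasurable ENNReal.ofReal_ne_top fun φ hφ => ?_⟩
  simp only [← ofReal_abs_mul_abs_rpow h.pos.le]
  exact hle φ hφ

theorem lintegral_fn_lt_top (h : IsAdmissible Ω p A V) (hsub : IsSubcritical Ω p A (posPot V))
    {g : E N → ℝ} (hg : IsHardyWeight Ω p A (posPot V) g) (x : BeppoLevi h) :
    ∫⁻ y in Ω, ‖g y‖ₑ * ‖BeppoLevi.fn x y‖ₑ ^ p < ⊤ := by
  obtain ⟨C, hC, hle⟩ := hg.exists_lintegral_fn_le h hsub
  exact (hle x).trans_lt (ENNReal.mul_lt_top hC.lt_top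
    (ENNReal.rpow_lt_top_of_nonneg h.pos.le enorm_ne_top))

/-- Along weakly null sequences `∫ |g| |y|ᵖ` tends to zero: up to an error which the capacity
inequality makes small, `g` is bounded with compact support. -/
theorem MemHardyZero.tendsto_lintegral_zero (h : IsAdmissible Ω p A V)
    (hsub : IsSubcritical Ω p A (posPot V)) {u : E N → ℝ}
    (hu : IsPositiveSolution Ω p A (posPot V) u) {g : E N → ℝ}
    (hg : MemHardyZero Ω p A (posPot V) u g) {y : ℕ → BeppoLevi h} {M : ℝ} (hM : ∀ n, ‖y n‖ ≤ M)
    (hy : ∀ l : BeppoLevi h →L[ℝ] ℝ, Tendsto (fun n => l (y n)) atTop (𝓝 0)) :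
    Tendsto (fun n => ∫⁻ x in Ω, ‖g x‖ₑ * ‖BeppoLevi.fn (y n) x‖ₑ ^ p) atTop (𝓝 0) := by
  have hp := h.pos
  obtain ⟨C, hC⟩ := hu.exists_lintegral_le_hardyNorm_mul h
  have hM' : ∀ n, ‖y n‖ₑ ^ p ≤ ENNReal.ofReal M ^ p := fun n => by
    rw [← ofReal_norm]
    exact ENNReal.rpow_le_rpow (ENNReal.ofReal_le_ofReal (hM n)) hp.le
  rw [ENNReal.tendsto_nhds_zero]
  intro ε hε
  have hfin : ENNReal.ofReal C * ENNReal.ofReal M ^ p ≠ ⊤ :=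
    ENNReal.mul_ne_top ENNReal.ofReal_ne_top
      (ENNReal.rpow_ne_top_of_nonneg hp.le ENNReal.ofReal_ne_top)
  obtain ⟨δ, hδ, hδε⟩ := ENNReal.exists_nnreal_pos_mul_lt hfin (ENNReal.half_pos hε.ne').ne'
  obtain ⟨w, hw, hwc, hwδ⟩ := hg.2 δ (by exact_mod_cast hδ)
  obtain ⟨D, hD, K, hK, hKΩ, hDle⟩ := hwc.exists_lintegral_le p
  have hd := hg.1.sub h hw
  have h1 : ∀ n, ∫⁻ x in Ω, ‖(g - w) x‖ₑ * ‖BeppoLevi.fn (y n) x‖ₑ ^ p ≤ ε / 2 := fun n => by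
    refine (BeppoLevi.lintegral_le h hsub hd.1.aestronglyMeasurable
      (C := ENNReal.ofReal C * hardyNorm Ω p A (posPot V) u (g - w))
      (ENNReal.mul_ne_top ENNReal.ofReal_ne_top (hwδ.trans ENNReal.coe_lt_top).ne)
      (fun φ hφ => ?_) (y n)).trans ?_
    · simp only [← ofReal_abs_mul_abs_rpow hp.le]
      exact hC _ hd φ hφ
    · calc ENNReal.ofReal C * hardyNorm Ω p A (posPot V) u (g - w) * ‖y n‖ₑ ^ p
          ≤ ENNReal.ofReal C * δ * ENNReal.ofReal M ^ p :=
            mul_le_mul' (mul_le_mul' le_rfl hwδ.le) (hM' n)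
        _ = δ * (ENNReal.ofReal C * ENNReal.ofReal M ^ p) := by ring
        _ ≤ ε / 2 := hδε.le
  have h2 : Tendsto (fun n => D * ∫⁻ x in K, ‖BeppoLevi.fn (y n) x‖ₑ ^ p) atTop (𝓝 0) := by
    have := ENNReal.Tendsto.const_mul (BeppoLevi.tendsto_lintegral_zero h hsub hM hy hK hKΩ)
      (Or.inr hD)
    rwa [mul_zero] at this
  filter_upwards [ENNReal.tendsto_nhds_zero.1 h2 (ε / 2) (ENNReal.half_pos hε.ne')] with n hn
  have hfm : AEMeasurable (BeppoLevi.fn (y n)) (volume.restrict Ω) :=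
    (BeppoLevi.fn_spec h hsub (y n)).1.1.aemeasurable
  calc ∫⁻ x in Ω, ‖g x‖ₑ * ‖BeppoLevi.fn (y n) x‖ₑ ^ p
      ≤ ∫⁻ x in Ω, (‖(g - w) x‖ₑ * ‖BeppoLevi.fn (y n) x‖ₑ ^ p
          + ‖w x‖ₑ * ‖BeppoLevi.fn (y n) x‖ₑ ^ p) := by
        refine lintegral_mono fun x => ?_
        rw [← add_mul]
        refine mul_le_mul' ?_ le_rfl
        calc ‖g x‖ₑ = ‖(g - w) x + w x‖ₑ := by simp
          _ ≤ _ := enorm_add_le _ _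
    _ = (∫⁻ x in Ω, ‖(g - w) x‖ₑ * ‖BeppoLevi.fn (y n) x‖ₑ ^ p)
          + ∫⁻ x in Ω, ‖w x‖ₑ * ‖BeppoLevi.fn (y n) x‖ₑ ^ p :=
        lintegral_add_left' (hd.1.aestronglyMeasurable.aemeasurable.enorm.mul
          (hfm.enorm.pow_const p)) _
    _ ≤ ε / 2 + ε / 2 := add_le_add (h1 n) ((hDle _).trans hn)
    _ = ε := ENNReal.add_halves ε

theorem MemHardyZero.isCompactFunctional (h : IsAdmissible Ω p A V)
    (hsub : IsSubcritical Ω p A (posPot V)) {u : E N → ℝ}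
    (hu : IsPositiveSolution Ω p A (posPot V) u) {g : E N → ℝ}
    (hg : MemHardyZero Ω p A (posPot V) u g) : IsCompactFunctional (T h g) := by
  intro x x₀ hx
  have hp := h.pos
  have := h.fact_one_le
  have hgm : AEMeasurable g (volume.restrict Ω) := hg.1.1.aestronglyMeasurable.aemeasurable
  set ν := (volume.restrict Ω).withDensity fun y => ‖g y‖ₑ with hν
  have hνΩ : ν ≪ volume.restrict Ω := withDensity_absolutelyContinuous _ _
  have hfm : ∀ z : BeppoLevi h, AEStronglyMeasurable (BeppoLevi.fn z) (volume.restrict Ω) :=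
    fun z => (BeppoLevi.fn_spec h hsub z).1.1
  have hnorm : ∀ z : BeppoLevi h, eLpNorm (BeppoLevi.fn z) (ENNReal.ofReal p) ν ^ p
      = ∫⁻ y in Ω, ‖g y‖ₑ * ‖BeppoLevi.fn z y‖ₑ ^ p := fun z => by
    rw [eLpNorm_ofReal_rpow hp, hν, lintegral_withDensity_eq_lintegral_mul₀ hgm.enorm
      ((hfm z).aemeasurable.enorm.pow_const p)]
    rfl
  have hmem : ∀ z : BeppoLevi h, MemLp (BeppoLevi.fn z) (ENNReal.ofReal p) ν := fun z => by
    refine ⟨(hfm z).mono_ac hνΩ, ?_⟩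
    have := lintegral_fn_lt_top h hsub hg.1 z
    rw [← hnorm] at this
    exact (ENNReal.rpow_lt_top_iff_of_pos hp).1 this
  -- `T_g` is the `p`-th power of the norm in `L^p(|g| dx)`
  have hT : ∀ z : BeppoLevi h, T h g z = ‖(hmem z).toLp‖ ^ p := fun z => by
    have hm : AEStronglyMeasurable (fun y => |g y| * |BeppoLevi.fn z y| ^ p)
        (volume.restrict Ω) :=
      (hgm.norm.mul ((hfm z).aemeasurable.norm.pow_const p)).aestronglyMeasurable
    rw [Lp.norm_toLp, ENNReal.toReal_rpow, hnorm, T, integral_eq_lintegral_of_nonneg_ae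
      (Eventually.of_forall fun y => by positivity) hm]
    simp only [ofReal_abs_mul_abs_rpow hp.le]
  simp only [hT]
  obtain ⟨M, hM⟩ := exists_norm_le_of_tendsto_weakly (x := fun n => x n - x₀) (x₀ := 0)
    fun l => by simpa using (hx l).sub_const (l x₀)
  have key := hg.tendsto_lintegral_zero h hsub hu hM
    fun l => by simpa using (hx l).sub_const (l x₀)
  refine Tendsto.rpow_const (Tendsto.norm ?_) (Or.inr hp.le)
  rw [Lp.tendsto_Lp_iff_tendsto_eLpNorm'']
  simp only [← hnorm] at key
  have h3 := key.ennrpow_const (1 / p)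
  rw [ENNReal.zero_rpow_of_pos (by positivity)] at h3
  refine h3.congr fun n => ?_
  rw [← ENNReal.rpow_mul, mul_one_div_cancel hp.ne', ENNReal.rpow_one]
  exact eLpNorm_congr_ae (hνΩ.ae_eq (BeppoLevi.fn_sub h hsub (x n) x₀))

end Admissible

end HardyWeights

end

theorem theorem4p3 {N : ℕ} (hN : 1 ≤ N) {Ω : Set (HardyWeights.E N)} {p : ℝ}
    {A : HardyWeights.E N → Matrix (Fin N) (Fin N) ℝ} {V : HardyWeights.E N → ℝ}
    (h : HardyWeights.IsAdmissible Ω p A V)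
    (hsub : HardyWeights.IsSubcritical Ω p A (HardyWeights.posPot V))
    {u : HardyWeights.E N → ℝ}
    (hu : HardyWeights.IsPositiveSolution Ω p A (HardyWeights.posPot V) u)
    {g : HardyWeights.E N → ℝ}
    (hg : HardyWeights.MemHardyZero Ω p A (HardyWeights.posPot V) u g) :
    -- the elements of the Beppo-Levi space are functions on `Ω`, so that `T_g` makes sense
    (∀ x : HardyWeights.BeppoLevi h, HardyWeights.Represents x (HardyWeights.BeppoLevi.fn x) ∧
      ∀ f, HardyWeights.Represents x f →
        f =ᵐ[volume.restrict Ω] HardyWeights.BeppoLevi.fn x) ∧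
    -- `T_g` is finite on the Beppo-Levi space
    (∀ x : HardyWeights.BeppoLevi h,
      IntegrableOn (fun y => |g y| * |HardyWeights.BeppoLevi.fn x y| ^ p) Ω volume) ∧
    -- `T_g` is compact
    HardyWeights.IsCompactFunctional (HardyWeights.T h g) := by
  refine ⟨fun x => HardyWeights.BeppoLevi.fn_spec h hsub x, fun x => ⟨?_, ?_⟩,
    hg.isCompactFunctional h hsub hu⟩
  · exact (hg.1.1.aestronglyMeasurable.aemeasurable.norm.mul
      ((HardyWeights.BeppoLevi.fn_spec h hsub x).1.1.aemeasurable.norm.pow_const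
        p)).aestronglyMeasurable
  · rw [hasFiniteIntegral_iff_ofReal (Eventually.of_forall fun y => by positivity)]
    simp only [HardyWeights.ofReal_abs_mul_abs_rpow h.pos.le]
    exact HardyWeights.lintegral_fn_lt_top h hsub hg.1 x
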